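/- Let $U\subset\mathbb C^2$ be an open set containing the origin, let $r>0$, let $f$ be a holomorphic function on $U$, and let $P(x,y,\varepsilon)$, $Q(x,y,\varepsilon)$ be holomorphic functions on $U\times\{|\varepsilon|<r\}$, all taking real values at real points. Suppose that $f(0,0)=0$, that the origin is a hyperbolic Morse critical point of $f$ (that is, $df(0,0)=0$ and the Hessian determinant of $f$ at the origin is negative), and that $\partial_x\partial_y f(0,0)>0$. Consider the deformed foliation $$\mathcal F_\varepsilon:\quad df+\varepsilon\,(P\,dx+Q\,dy)=0 ,$$ and suppose that its separatrices at the origin are the coordinate axes, that is, that $\{x=0\}$ and $\{y=0\}$ are invariant by $\mathcal F_\varepsilon$ for all $|\varepsilon|<r$ (so that $f$ vanishes on the axes near the origin and is positive in the open first quadrant near the origin). Let $x_0,y_0>0$ be such that the real segments joining the origin to $(x_0,0)$ and to $(0,y_0)$ lie in $U$ and contain no critical point of $f$ other than the origin. Let $\sigma,\tau\subset U$ be complex discs through $(0,y_0)$ and $(x_0,0)$ respectively, parameterized by the restriction $z$ of $f$; that is, $\sigma$ and $\tau$ are the images of holomorphic maps $z\mapsto\sigma(z)$ and $z\mapsto\tau(z)$,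 defined on discs $|z|<R_\sigma$ and $|z|<R_\tau$, real for real $z$, with $f(\sigma(z))=z=f(\tau(z))$, $\sigma(0)=(0,y_0)$, $\tau(0)=(x_0,0)$. For real $\varepsilon$ and $z>0$ close to $0$, the Dulac map $d_\varepsilon$ is defined by $d_\varepsilon(z)=w$, where $\tau(w)$ is the first point of $\{\tau(v):0<v<R_\tau\}$ met by the real orbit of the vector field $(\partial_yf+\varepsilon Q)\,\partial_x-(\partial_xf+\varepsilon P)\,\partial_y$ starting at $\sigma(z)$, this orbit staying in the open first quadrant until then. Let $\sigma_\bullet$ be the universal covering of $\sigma\setminus\{\sigma(0)\}$, with polar coordinates $\rho>0$, $\varphi\in\mathbb R$, $z=\rho e^{i\varphi}$, and holomorphic coordinate $\log z=\log\rho+i\varphi$. Then there exist $\varepsilon_0>0$ and a continuous function $\varphi\mapsto\rho(\varphi)$ from $\mathbb R$ to $(0,\infty)$ such that $d_\varepsilon(z)$ is defined for all real $\varepsilon$ with $|\varepsilon|<\varepsilon_0$ and all $0<z<\rho(0)$, and the function $(\varepsilon,z)\mapsto d_\varepsilon(z)$ extends to a holomorphic function on the domain $$\{(\varepsilon,\rho,\varphi)\in\mathbb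 C\times\sigma_\bullet:\ |\varepsilon|<\varepsilon_0,\ 0<\rho<\rho(\varphi)\},$$ where real $z>0$ corresponds to $\rho=z$, $\varphi=0$. -/

import Mathlib

open Set Metric

noncomputable section

namespace Dulac

/-- The inclusion of the real plane into the complex plane `ℂ × ℂ`. -/
def toC (p : ℝ × ℝ) : ℂ × ℂ := ((p.1 : ℂ), (p.2 : ℂ))

/-- The partial derivative of `f` with respect to the first variable. -/
def dx (f : ℂ × ℂ → ℂ) (p : ℂ × ℂ) : ℂ := fderiv ℂ f p (1, 0)

/-- The partial derivative of `f` with respect to the second variable. -/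
def dy (f : ℂ × ℂ → ℂ) (p : ℂ × ℂ) : ℂ := fderiv ℂ f p (0, 1)

/-- A one-parameter real analytic deformation `df + ε (P dx + Q dy) = 0` of the foliation `df = 0`,
extended to the complex domain `U × {|ε| < r}`. The function `f` has a hyperbolic Morse critical
point at the origin, the coordinate axes are the separatrices for every `ε`, and `f` is positive
in the first quadrant near the origin. -/
structure DeformedSaddle where
  /-- the domain in the `(x, y)`-space -/
  U : Set (ℂ × ℂ)
  isOpen_U : IsOpen U
  zero_mem : (0, 0) ∈ U
  /-- the radius of the parameter disc -/
  r : ℝ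
  r_pos : 0 < r
  f : ℂ × ℂ → ℂ
  /-- coefficients of `ω_ε = P(x,y,ε) dx + Q(x,y,ε) dy`; the argument is `((x, y), ε)` -/
  P : (ℂ × ℂ) × ℂ → ℂ
  Q : (ℂ × ℂ) × ℂ → ℂ
  f_analytic : AnalyticOnNhd ℂ f U
  P_analytic : AnalyticOnNhd ℂ P (U ×ˢ ball 0 r)
  Q_analytic : AnalyticOnNhd ℂ Q (U ×ˢ ball 0 r)
  f_real : ∀ p : ℝ × ℝ, toC p ∈ U → (f (toC p)).im = 0
  P_real : ∀ (p : ℝ × ℝ) (ε : ℝ), toC p ∈ U → |ε| < r → (P (toC p, (ε : ℂ))).im = 0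
  Q_real : ∀ (p : ℝ × ℝ) (ε : ℝ), toC p ∈ U → |ε| < r → (Q (toC p, (ε : ℂ))).im = 0
  /-- the origin is a critical point of `f`, on the level `0` -/
  f_zero : f (0, 0) = 0
  f_crit : fderiv ℂ f (0, 0) = 0
  /-- the Hessian determinant of `f` at the origin is negative -/
  f_saddle : (dx (dx f) (0, 0) * dy (dy f) (0, 0) - dx (dy f) (0, 0) ^ 2).re < 0
  /-- `f` is positive in the first quadrant near the origin -/
  f_quadrant : 0 < (dx (dy f) (0, 0)).re
  /-- `{y = 0}` is invariant for every `ε` -/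
  xAxis_invariant : ∀ x ε : ℂ, (x, 0) ∈ U → ‖ε‖ < r → dx f (x, 0) + ε * P ((x, 0), ε) = 0
  /-- `{x = 0}` is invariant for every `ε` -/
  yAxis_invariant : ∀ y ε : ℂ, (0, y) ∈ U → ‖ε‖ < r → dy f (0, y) + ε * Q ((0, y), ε) = 0

/-- The vector field `(f_y + ε Q) ∂x - (f_x + ε P) ∂y`, which spans the kernel of
`df + ε (P dx + Q dy)`. -/
def DeformedSaddle.X (F : DeformedSaddle) (ε : ℂ) (p : ℂ × ℂ) : ℂ × ℂ :=
  (dy F.f p + ε * F.Q (p, ε), -(dx F.f p + ε * F.P (p, ε)))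

/-- A complex cross-section through the point `p`, defined over the reals and parameterized by the
restriction `z` of `f` to it. The identity `f (param z) = z` makes it transversal to `df = 0`. -/
structure CrossSection (F : DeformedSaddle) (p : ℂ × ℂ) where
  /-- the radius of the disc -/
  R : ℝ
  R_pos : 0 < R
  /-- the point of the cross-section at which `f` takes the value `z` -/
  param : ℂ → ℂ × ℂ
  analytic : AnalyticOnNhd ℂ param (ball 0 R)
  mapsTo : MapsTo param (ball 0 R) F.U
  param_zero : param 0 = p
  f_param : ∀ z ∈ ball (0 : ℂ) R, F.f (param z) = z
  real : ∀ z : ℝ, |z| < R → (param z).1.im = 0 ∧ (param z).2.im = 0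

/-- `IsDulacValue σ τ ε z w`: for the real parameter `ε` and real `z > 0`, the orbit of `X_ε`
starting at the point of `σ` with coordinate `z` stays in the open first quadrant until its first
intersection with the half `{w > 0}` of `τ`, which is the point with coordinate `w`.
That is, `w = d_ε(z)` for the Dulac map `d_ε`. -/
def IsDulacValue {F : DeformedSaddle} {p q : ℂ × ℂ} (σ : CrossSection F p) (τ : CrossSection F q)
    (ε z w : ℝ) : Prop :=
  |ε| < F.r ∧ 0 < z ∧ z < σ.R ∧ 0 < w ∧ w < τ.R ∧
  ∃ (T : ℝ) (γ : ℝ → ℝ × ℝ), 0 < T ∧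
    toC (γ 0) = σ.param z ∧ toC (γ T) = τ.param w ∧
    (∀ t ∈ Icc 0 T, toC (γ t) ∈ F.U ∧ 0 < (γ t).1 ∧ 0 < (γ t).2 ∧
      HasDerivWithinAt (fun s => toC (γ s)) (F.X ε (toC (γ t))) (Icc 0 T) t) ∧
    ∀ t ∈ Ico 0 T, ∀ v : ℝ, 0 < v → v < τ.R → toC (γ t) ≠ τ.param v

/-- The domain `{|ε| < ε₀, 0 < |z| < ρ(arg z)}` in the product of the `ε`-plane and the universal
covering of the punctured cross-section. The universal covering has the global coordinate
`ζ = log z = log |z| + i φ`, so `|z| = exp (Re ζ)` and `φ = Im ζ`. -/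
def contDomain (ε₀ : ℝ) (ρ : ℝ → ℝ) : Set (ℂ × ℂ) :=
  {q | ‖q.1‖ < ε₀ ∧ Real.exp q.2.re < ρ q.2.im}

end Dulac

end

open Set Metric Filter Topology
open scoped ContDiff NNReal ENNReal

noncomputable section

/-! Fix a small `d > 0` and factor the Dulac map into a departure from `σ` to `{y = d}`, a passage
near the saddle from `{y = d}` to `{x = d}`, and a landing from `{x = d}` on `τ`. Departure and
landing follow compact arcs of the separatrices without singular points, so they are given by
functions holomorphic in `ε` and the transversal coordinate near the origin (`exists_flowBox`,
`exists_departure`, `exists_landing`). All multivaluedness sits in the saddle passage.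

For the passage the foliation is parametrized so that `x' = c x` with a constant complex `c`. An
orbit starting at `x = e^ξ` with `c = log d - ξ` reaches `x = d` exactly at time one, and its path
is a straight segment in the coordinate `log x`. Since both axes stay invariant for every `ε`, the
field is `(λ x, -λ y)` up to errors small relative to `|x|` and `|y|` respectively, on a whole
polydisc in `(x, y, ε)`. Hence `y' = c (-y + small)`, and `|y|` decays as long as `|Im c| ≤ Re c`
(`norm_snd_le`, `exists_saddle_passage`). This condition only asks `|e^ξ|` to be small in terms of
`Im ξ`; the bound on `ε` is that of the polydisc and does not depend on the argument. This is why
one `ε₀` serves the whole universal covering, with `ρ(φ)` a multiple of `e^(-|φ|)`.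

Holomorphy comes from analytic dependence on initial points (`IsSol.hasFlow`), since `ε` and `c` are
carried along as constant coordinates of the state. That theorem is obtained from the implicit
function theorem in `C([0,1], E)` for short times, then by concatenation.

For real data the three pieces are genuine orbits in the first quadrant. It remains to see that
their concatenation meets the positive half of `τ` at one point only; `isDulacValue_of_isSol` then
extracts the first hit. -/

namespace Dulac

/-! ### Superposition operators on spaces of continuous functions. -/

section Nemytskii

variable {X : Type*} [TopologicalSpace X] [CompactSpace X]
  {E : Type*} [NormedAddCommGroup E] [NormedSpace ℂ E]
  {G : Type*} [NormedAddCommGroup G] [NormedSpace ℂ G]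

/-- A continuous multilinear map acts pointwise on continuous functions. -/
def pointwiseMultilinear {n : ℕ} (m : ContinuousMultilinearMap ℂ (fun _ : Fin n => E) G) :
    ContinuousMultilinearMap ℂ (fun _ : Fin n => C(X, E)) C(X, G) :=
  MultilinearMap.mkContinuous
    { toFun := fun h => ⟨fun t => m fun i => h i t, by fun_prop⟩
      map_update_add' := by
        intro _ h i a b
        ext t
        have key : ∀ c : C(X, E), (fun j => Function.update h i c j t)
            = Function.update (fun j => h j t) i (c t) := by
          intro c
          funext j
          by_cases hj : j = i
          · subst hj; simp
          · simp [hj]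
        simp [key]
      map_update_smul' := by
        intro _ h i a b
        ext t
        have key : ∀ c : C(X, E), (fun j => Function.update h i c j t)
            = Function.update (fun j => h j t) i (c t) := by
          intro c
          funext j
          by_cases hj : j = i
          · subst hj; simp
          · simp [hj]
        simp [key] }
    ‖m‖ (by
      intro h
      rw [ContinuousMap.norm_le _ (by positivity)]
      intro t
      refine (m.le_opNorm _).trans ?_
      gcongr with i
      exact (h i).norm_coe_le_norm t)

lemma norm_pointwiseMultilinear_le {n : ℕ}
    (m : ContinuousMultilinearMap ℂ (fun _ : Fin n => E) G) :
    ‖pointwiseMultilinear (X := X) m‖ ≤ ‖m‖ :=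
  MultilinearMap.mkContinuous_norm_le _ (norm_nonneg _) _

/-- The superposition operator `u ↦ V ∘ u` is analytic near a constant function. -/
lemma exists_analyticAt_superposition [CompleteSpace G] {V : E → G} {p₀ : E}
    (hV : AnalyticAt ℂ V p₀) :
    ∃ N : C(X, E) → C(X, G), AnalyticAt ℂ N (ContinuousMap.const X p₀) ∧
      ∀ᶠ u in 𝓝 (ContinuousMap.const X p₀), ∀ t, N u t = V (u t) := by
  obtain ⟨p, r, hp⟩ := hV
  let P : FormalMultilinearSeries ℂ C(X, E) C(X, G) := fun n => pointwiseMultilinear (p n)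
  -- The pointwise coefficients have norms bounded by those of `p n`, so the radius of convergence
  -- does not shrink.
  have hrad : p.radius ≤ P.radius := by
    refine ENNReal.le_of_forall_nnreal_lt fun s hs => ?_
    obtain ⟨C, -, hC⟩ := p.norm_mul_pow_le_of_lt_radius hs
    refine P.le_radius_of_bound C fun n => le_trans ?_ (hC n)
    gcongr
    exact norm_pointwiseMultilinear_le _
  have hP : 0 < P.radius := hp.radius_pos.trans_le hrad
  have hball := P.hasFPowerSeriesOnBall hP
  refine ⟨fun u => P.sum (u - ContinuousMap.const X p₀), ?_, ?_⟩
  · have h0 : AnalyticAt ℂ P.sum (ContinuousMap.const X p₀ - ContinuousMap.const X p₀) := by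
      rw [sub_self]; exact hball.analyticAt
    exact h0.comp (f := fun u => u - ContinuousMap.const X p₀) (by fun_prop)
  · filter_upwards [Metric.eball_mem_nhds (ContinuousMap.const X p₀) hp.r_pos] with u hu t
    set h := u - ContinuousMap.const X p₀ with hh
    have hnorm : (‖h‖ₑ : ℝ≥0∞) < r := by
      simpa [edist_eq_enorm_sub] using hu
    have h1 : HasSum (fun n => P n fun _ => h) (P.sum h) := by
      have := hball.hasSum (y := h) (by
        simpa using hnorm.trans_le (hp.r_le.trans hrad))
      simpa using this
    -- Evaluation at `t` is continuous and linear, so the series in `C(X, G)` can be evaluated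
    -- termwise and compared with the series of `V` at `u t`.
    have h2 := h1.mapL (ContinuousMap.evalCLM ℂ t : C(X, G) →L[ℂ] G)
    have h3 : HasSum (fun n => p n fun _ => h t) (V (p₀ + h t)) := by
      apply hp.hasSum
      simp only [mem_eball, edist_zero_right]
      refine lt_of_le_of_lt ?_ hnorm
      rw [enorm_le_iff_norm_le]
      exact h.norm_coe_le_norm t
    have h4 := h2.unique h3
    simpa [hh] using h4

end Nemytskii

/-! ### Short-time analytic flow from the implicit function theorem. -/

section LocalFlow

variable {E : Type*} [NormedAddCommGroup E] [NormedSpace ℂ E] [CompleteSpace E]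

/-- The operator `u ↦ ∫₀ᵗ u` on continuous functions on the unit interval. -/
def volterra (E : Type*) [NormedAddCommGroup E] [NormedSpace ℂ E] [CompleteSpace E] :
    C(unitInterval, E) →L[ℂ] C(unitInterval, E) :=
  LinearMap.mkContinuous
    { toFun := fun u =>
        ⟨fun t => ∫ s in (0 : ℝ)..t, u (projIcc 0 1 zero_le_one s), by
          have hc : Continuous fun s : ℝ => u (projIcc 0 1 zero_le_one s) :=
            u.continuous.comp continuous_projIcc
          exact (intervalIntegral.continuous_primitive (fun a b => hc.intervalIntegrable a b)
            0).comp continuous_subtype_val⟩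
      map_add' := by
        intro u v
        ext t
        have hc : ∀ u : C(unitInterval, E), Continuous fun s : ℝ => u (projIcc 0 1 zero_le_one s) :=
          fun u => u.continuous.comp continuous_projIcc
        simp only [ContinuousMap.coe_mk, ContinuousMap.add_apply]
        exact intervalIntegral.integral_add ((hc u).intervalIntegrable _ _)
          ((hc v).intervalIntegrable _ _)
      map_smul' := by
        intro c u
        ext t
        simp [intervalIntegral.integral_smul] }
    1 (by
      intro u
      rw [ContinuousMap.norm_le _ (by positivity)]
      intro t
      have := intervalIntegral.norm_integral_le_of_norm_le_const (a := 0) (b := (t : ℝ))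
        (f := fun s => u (projIcc 0 1 zero_le_one s)) (C := ‖u‖)
        (fun s _ => u.norm_coe_le_norm _)
      refine this.trans ?_
      have ht : |(t : ℝ) - 0| ≤ 1 := by
        rw [sub_zero, abs_of_nonneg t.2.1]; exact t.2.2
      rw [one_mul]
      exact mul_le_of_le_one_right (norm_nonneg _) ht)

lemma volterra_apply (u : C(unitInterval, E)) (t : unitInterval) :
    volterra E u t = ∫ s in (0 : ℝ)..t, u (projIcc 0 1 zero_le_one s) := rfl

/-- Short-time solutions of an analytic differential equation depend analytically on the
initial point. -/
lemma exists_analytic_short_solution {V : E → E} {p₀ : E} (hV : AnalyticAt ℂ V p₀) {O : Set E}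
    (hO : O ∈ 𝓝 p₀) :
    ∃ τ : ℝ, 0 < τ ∧ ∃ Ψ : E → C(unitInterval, E), ∀ᶠ p in 𝓝 p₀,
      AnalyticAt ℂ Ψ p ∧ Ψ p 0 = p ∧ (∀ t, Ψ p t ∈ O) ∧
      ∀ t ∈ Icc (0 : ℝ) 1, HasDerivWithinAt (fun s => Ψ p (projIcc 0 1 zero_le_one s))
        (τ • V (Ψ p (projIcc 0 1 zero_le_one t))) (Icc 0 1) t := by
  obtain ⟨N, hN, hNV⟩ := exists_analyticAt_superposition (X := unitInterval) hV
  let cst : E →L[ℂ] C(unitInterval, E) := LinearMap.mkContinuous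
    { toFun := fun p => ContinuousMap.const _ p
      map_add' := fun _ _ => rfl
      map_smul' := fun _ _ => rfl } 1 (fun p => by
        rw [ContinuousMap.norm_le _ (by positivity), one_mul]; exact fun _ => le_rfl)
  have hcst : ∀ p, cst p = ContinuousMap.const _ p := fun _ => rfl
  -- Near the base point, zeros of `G` are solutions of `u = p + τ ∫ V(u)` on the unit interval. The
  -- speed `τ` is a complex variable, so that the implicit function theorem over `ℂ` applies.
  let G : (ℂ × E) × C(unitInterval, E) → C(unitInterval, E) :=
    fun q => q.2 - cst q.1.2 - q.1.1 • volterra E (N q.2)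
  let b : (ℂ × E) × C(unitInterval, E) := ((0, p₀), ContinuousMap.const _ p₀)
  have hN2 : AnalyticAt ℂ (fun q : (ℂ × E) × C(unitInterval, E) => N q.2) b :=
    hN.comp (f := fun q : (ℂ × E) × C(unitInterval, E) => q.2) analyticAt_snd
  have hN3 : AnalyticAt ℂ (fun q : (ℂ × E) × C(unitInterval, E) => volterra E (N q.2)) b :=
    ((volterra E).analyticAt _).comp hN2
  have h12 : AnalyticAt ℂ (fun q : (ℂ × E) × C(unitInterval, E) => cst q.1.2) b :=
    (cst ∘L .snd ℂ ℂ E ∘L .fst ℂ (ℂ × E) C(unitInterval, E)).analyticAt b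
  have h11 : AnalyticAt ℂ (fun q : (ℂ × E) × C(unitInterval, E) => q.1.1) b :=
    (ContinuousLinearMap.fst ℂ ℂ E ∘L .fst ℂ (ℂ × E) C(unitInterval, E)).analyticAt b
  have hG : AnalyticAt ℂ G b := (analyticAt_snd.sub h12).sub (h11.smul hN3)
  have hGc : ContDiffAt ℂ ω G b := hG.contDiffAt
  have hb0 : G b = 0 := by simp [G, b, hcst]
  -- At speed zero `G` is `u - p`, whose derivative in `u` is the identity.
  have hinv : (fderiv ℂ G b ∘L .inr ℂ (ℂ × E) C(unitInterval, E)).IsInvertible := by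
    have h1 : HasFDerivAt (fun u : C(unitInterval, E) => G ((0, p₀), u))
        (fderiv ℂ G b ∘L .inr ℂ (ℂ × E) C(unitInterval, E)) (ContinuousMap.const _ p₀) := by
      have := hG.differentiableAt.hasFDerivAt.comp (ContinuousMap.const unitInterval p₀)
        (hasFDerivAt_prodMk_right (𝕜 := ℂ) (0, p₀) (ContinuousMap.const unitInterval p₀))
      exact this
    have h2 : HasFDerivAt (fun u : C(unitInterval, E) => G ((0, p₀), u))
        (ContinuousLinearMap.id ℂ C(unitInterval, E)) (ContinuousMap.const _ p₀) := by
      simp only [G, zero_smul, sub_zero]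
      exact (hasFDerivAt_id _).sub_const _
    rw [h1.unique h2]
    exact ⟨ContinuousLinearEquiv.refl ℂ _, rfl⟩
  let ψ := hGc.implicitFunction (by simp) hinv
  have hψ : AnalyticAt ℂ ψ (0, p₀) :=
    (hGc.contDiffAt_implicitFunction (by simp) hinv).analyticAt
  have hψ0 : ψ (0, p₀) = ContinuousMap.const _ p₀ :=
    hGc.implicitFunction_apply_self (by simp) hinv
  have hψG : ∀ᶠ x in 𝓝 ((0 : ℂ), p₀), G (x, ψ x) = 0 := by
    have := hGc.eventually_apply_implicitFunction (by simp) hinv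
    rw [hb0] at this
    exact this
  obtain ⟨η, hη, hηO⟩ := Metric.mem_nhds_iff.1 (inter_mem hO (hV.eventually_analyticAt))
  have hcont : ∀ᶠ x in 𝓝 ((0 : ℂ), p₀), (∀ t, N (ψ x) t = V (ψ x t)) ∧ ∀ t, ψ x t ∈ ball p₀ η := by
    have hc := hψ.continuousAt.tendsto
    rw [hψ0] at hc
    have hnear : ∀ᶠ u in 𝓝 (ContinuousMap.const unitInterval p₀), ∀ t, u t ∈ ball p₀ η := by
      filter_upwards [Metric.ball_mem_nhds _ hη] with u hu t
      exact (ContinuousMap.dist_apply_le_dist (f := u) (g := ContinuousMap.const _ p₀) t).trans_lt hu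
    exact hc.eventually (hNV.and hnear)
  have hall := (hψ.eventually_analyticAt.and hψG).and hcont
  rw [nhds_prod_eq] at hall
  -- One fixed positive speed must work for all `p` near `p₀`, so the neighbourhood in the product
  -- is read as a neighbourhood in `τ` first.
  have hall' := hall.curry
  obtain ⟨δ, hδ, hδ'⟩ := Metric.eventually_nhds_iff.1 hall'
  refine ⟨δ / 2, by positivity, fun p => ψ (((δ / 2 : ℝ) : ℂ), p), ?_⟩
  have hτ := hδ' (y := ((δ / 2 : ℝ) : ℂ)) (by
    rw [dist_zero_right, Complex.norm_real, Real.norm_eq_abs, abs_of_pos (by positivity)]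
    linarith)
  filter_upwards [hτ] with p hp
  obtain ⟨⟨han, heq⟩, hNp, hball⟩ := hp
  have hψ_eq : ∀ t : unitInterval, ψ (((δ / 2 : ℝ) : ℂ), p) t
      = p + (δ / 2) • ∫ s in (0 : ℝ)..t,
        V (ψ (((δ / 2 : ℝ) : ℂ), p) (projIcc 0 1 zero_le_one s)) := by
    intro t
    have := congrArg (fun u : C(unitInterval, E) => u t) heq
    simp only [G, hcst, ContinuousMap.sub_apply, ContinuousMap.const_apply,
      ContinuousMap.smul_apply, volterra_apply, ContinuousMap.zero_apply, hNp] at this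
    rw [sub_sub, sub_eq_zero] at this
    rw [this]
    congr 1
  refine ⟨?_, ?_, fun t => (hηO (hball t)).1, ?_⟩
  · exact han.comp (f := fun p => (((δ / 2 : ℝ) : ℂ), p)) (by fun_prop)
  · rw [hψ_eq 0]; simp
  · intro t ht
    set u := ψ (((δ / 2 : ℝ) : ℂ), p) with hu
    have hc : Continuous fun s : ℝ => V (u (projIcc 0 1 zero_le_one s)) := by
      have h1 : Continuous fun s : ℝ => N u (projIcc 0 1 zero_le_one s) :=
        (N u).continuous.comp continuous_projIcc
      simpa only [hNp] using h1
    have hd : HasDerivAt (fun t : ℝ => p + (δ / 2) • ∫ s in (0 : ℝ)..t,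
        V (u (projIcc 0 1 zero_le_one s)))
        ((δ / 2) • V (u (projIcc 0 1 zero_le_one t))) t :=
      ((intervalIntegral.integral_hasDerivAt_right (hc.intervalIntegrable _ _)
        (hc.stronglyMeasurableAtFilter _ _) hc.continuousAt).const_smul _).const_add _
    refine hd.hasDerivWithinAt.congr_of_mem ?_ ht
    intro s hs
    rw [hψ_eq]
    simp [projIcc_of_mem zero_le_one hs]

end LocalFlow

/-! ### Solutions on intervals: gluing, uniqueness and invariant subspaces. -/

section Solutions

variable {E : Type*} [NormedAddCommGroup E] [NormedSpace ℝ E]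
  {G : Type*} [NormedAddCommGroup G] [NormedSpace ℝ G]

/-- `u` is a solution of `u' = V u` on `[0, T]` with values in `W`. -/
def IsSol (V : E → E) (W : Set E) (u : ℝ → E) (T : ℝ) : Prop :=
  ∀ t ∈ Icc 0 T, u t ∈ W ∧ HasDerivWithinAt u (V (u t)) (Icc 0 T) t

variable {V : E → E} {W W' : Set E} {u v : ℝ → E} {S T a b : ℝ}

lemma IsSol.continuousOn (h : IsSol V W u T) : ContinuousOn u (Icc 0 T) :=
  fun t ht => (h t ht).2.continuousWithinAt

lemma IsSol.restrict (h : IsSol V W u T) (hS : S ≤ T) : IsSol V W u S := fun t ht =>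
  ⟨(h t ⟨ht.1, ht.2.trans hS⟩).1,
    (h t ⟨ht.1, ht.2.trans hS⟩).2.mono (Icc_subset_Icc_right hS)⟩

lemma IsSol.congr (h : IsSol V W u T) (huv : EqOn v u (Icc 0 T)) : IsSol V W v T := fun t ht => by
  rw [huv ht]
  exact ⟨(h t ht).1, (h t ht).2.congr_of_mem huv ht⟩

lemma IsSol.shift (h : IsSol V W u (a + b)) (ha : 0 ≤ a) : IsSol V W (fun t => u (a + t)) b := by
  intro t ht
  have hm : a + t ∈ Icc 0 (a + b) := ⟨by linarith [ht.1], by linarith [ht.2]⟩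
  refine ⟨(h _ hm).1, ?_⟩
  have h1 : HasDerivWithinAt (fun t : ℝ => a + t) 1 (Icc 0 b) t :=
    ((hasDerivAt_id t).const_add a).hasDerivWithinAt
  have h2 := (h _ hm).2.scomp t h1 (fun s hs => ⟨by linarith [hs.1], by linarith [hs.2]⟩)
  rw [one_smul] at h2
  exact h2

lemma IsSol.reverse (h : IsSol V W u T) : IsSol (fun p => -V p) W (fun t => u (T - t)) T := by
  intro t ht
  have hm : T - t ∈ Icc 0 T := ⟨by linarith [ht.2], by linarith [ht.1]⟩
  refine ⟨(h _ hm).1, ?_⟩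
  have h1 : HasDerivWithinAt (fun t : ℝ => T - t) (-1) (Icc 0 T) t :=
    ((hasDerivAt_id t).const_sub T).hasDerivWithinAt
  have h2 := (h _ hm).2.scomp t h1 (fun s hs => ⟨by linarith [hs.2], by linarith [hs.1]⟩)
  rw [neg_one_smul] at h2
  exact h2

lemma IsSol.scale (h : IsSol V W u T) {k : ℝ} (hk : 0 < k) :
    IsSol (fun p => k • V p) W (fun t => u (k * t)) (T / k) := by
  intro t ht
  have key : ∀ s ∈ Icc 0 (T / k), k * s ∈ Icc 0 T := fun s hs =>
    ⟨mul_nonneg hk.le hs.1, by have := (le_div_iff₀ hk).1 hs.2; linarith⟩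
  refine ⟨(h _ (key t ht)).1, ?_⟩
  have h1 : HasDerivWithinAt (fun t : ℝ => k * t) k (Icc 0 (T / k)) t := by
    simpa using ((hasDerivAt_id t).const_mul k).hasDerivWithinAt
  exact (h _ (key t ht)).2.scomp t h1 key

lemma IsSol.append (hu : IsSol V W u a) (hv : IsSol V W v b) (ha : 0 ≤ a)
    (huv : v 0 = u a) : IsSol V W (fun t => if t ≤ a then u t else v (t - a)) (a + b) := by
  set w : ℝ → E := fun t => if t ≤ a then u t else v (t - a) with hw
  have hwu : EqOn w u (Icc 0 a) := fun t ht => by simp [hw, ht.2]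
  have hwv : EqOn w (fun t => v (t - a)) (Icc a (a + b)) := by
    intro t ht
    rcases ht.1.eq_or_lt with rfl | h
    · simp [hw, huv]
    · simp [hw, not_le.2 h]
  have h1 : ∀ t ∈ Icc 0 a, w t ∈ W ∧ HasDerivWithinAt w (V (w t)) (Icc 0 a) t :=
    hu.congr hwu
  have h2 : ∀ t ∈ Icc a (a + b), w t ∈ W ∧ HasDerivWithinAt w (V (w t)) (Icc a (a + b)) t := by
    intro t ht
    have hm : t - a ∈ Icc 0 b := ⟨by linarith [ht.1], by linarith [ht.2]⟩
    have e1 : HasDerivWithinAt (fun t : ℝ => t - a) 1 (Icc a (a + b)) t :=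
      ((hasDerivAt_id t).sub_const a).hasDerivWithinAt
    have e0 : MapsTo (fun t : ℝ => t - a) (Icc a (a + b)) (Icc 0 b) :=
      fun s hs => ⟨by linarith [hs.1], by linarith [hs.2]⟩
    have e2 := (hv _ hm).2.scomp t e1 e0
    rw [one_smul] at e2
    have e3 : w t = v (t - a) := hwv ht
    rw [e3]
    exact ⟨(hv _ hm).1, e2.congr_of_mem hwv ht⟩
  intro t ht
  rcases lt_trichotomy t a with hlt | rfl | hgt
  · have ht' : t ∈ Icc 0 a := ⟨ht.1, hlt.le⟩
    refine ⟨(h1 t ht').1, (h1 t ht').2.mono_of_mem_nhdsWithin ?_⟩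
    have : Icc 0 (a + b) ∩ Iio a ∈ 𝓝[Icc 0 (a + b)] t :=
      inter_mem_nhdsWithin _ (Iio_mem_nhds hlt)
    exact mem_of_superset this fun s hs => ⟨hs.1.1, hs.2.le⟩
  -- At the junction both one-sided derivatives equal the field at the common value.
  · have hb : 0 ≤ b := by linarith [ht.2]
    have e1 := (h1 t ⟨ht.1, le_rfl⟩)
    have e2 := (h2 t ⟨le_rfl, ht.2⟩)
    refine ⟨e1.1, ?_⟩
    have := e1.2.union e2.2
    rwa [Icc_union_Icc_eq_Icc ht.1 ht.2] at this
  · have ht' : t ∈ Icc a (a + b) := ⟨hgt.le, ht.2⟩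
    refine ⟨(h2 t ht').1, (h2 t ht').2.mono_of_mem_nhdsWithin ?_⟩
    have : Icc 0 (a + b) ∩ Ioi a ∈ 𝓝[Icc 0 (a + b)] t :=
      inter_mem_nhdsWithin _ (Ioi_mem_nhds hgt)
    exact mem_of_superset this fun s hs => ⟨hs.2.le, hs.1.2⟩

/-- A linear constraint `J u = 0` that is infinitesimally invariant is preserved forward in time. -/
lemma IsSol.map_eq_zero_forward (h : IsSol V W u T) (J : E →L[ℝ] G)
    (hJ : ∀ p ∈ W, J p = 0 → ∃ C : ℝ, ∀ᶠ q in 𝓝 p, ‖J (V q)‖ ≤ C * ‖J q‖)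
    (h0 : J (u 0) = 0) : ∀ t ∈ Icc 0 T, J (u t) = 0 := by
  have hJc : ContinuousOn (fun t => J (u t)) (Icc 0 T) := J.continuous.comp_continuousOn h.continuousOn
  -- Continuous induction: the set of good times is closed, and Grönwall's inequality with the local
  -- constant `C` extends it to the right of each of its points.
  have hcl : IsClosed ({t | J (u t) = 0} ∩ Icc 0 T) := by
    rw [inter_comm]
    exact hJc.preimage_isClosed_of_isClosed isClosed_Icc (isClosed_singleton (x := (0 : G)))
  refine hcl.Icc_subset_of_forall_exists_gt h0 ?_
  rintro t ⟨ht0, ht⟩ y hy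
  obtain ⟨C, hC⟩ := hJ (u t) (h t (Ico_subset_Icc_self ht)).1 ht0
  have hcont : ContinuousWithinAt u (Icc 0 T) t := h.continuousOn t (Ico_subset_Icc_self ht)
  have hev : ∀ᶠ s in 𝓝[Icc 0 T] t, ‖J (V (u s))‖ ≤ C * ‖J (u s)‖ := hcont.eventually hC
  obtain ⟨δ, hδ, hball⟩ := Metric.mem_nhdsWithin_iff.1 hev
  set r := min (t + δ / 2) (min y T) with hr
  have htr : t < r := by
    simp only [hr, lt_min_iff]
    exact ⟨by linarith, hy, ht.2⟩
  have hrT : r ≤ T := (min_le_right _ _).trans (min_le_right _ _)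
  have hrδ : r ≤ t + δ / 2 := min_le_left _ _
  have hsub : Icc t r ⊆ Icc 0 T := Icc_subset_Icc ht.1 hrT
  have hz := eq_zero_of_abs_deriv_le_mul_abs_self_of_eq_zero_right (f := fun s => J (u s))
    (f' := fun s => J (V (u s))) (K := C) (a := t) (b := r) (hJc.mono hsub)
    (by
      intro s hs
      have hs' : s ∈ Icc 0 T := hsub (Ico_subset_Icc_self hs)
      have h1 : HasDerivWithinAt (fun s => J (u s)) (J (V (u s))) (Icc 0 T) s :=
        J.hasFDerivAt.comp_hasDerivWithinAt s (h s hs').2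
      refine h1.mono_of_mem_nhdsWithin ?_
      have : Ici s ∩ Iio T ∈ 𝓝[Ici s] s :=
        inter_mem_nhdsWithin _ (Iio_mem_nhds (hs.2.trans_le hrT))
      exact mem_of_superset this fun q hq => ⟨hs'.1.trans hq.1, hq.2.le⟩)
    ht0
    (by
      intro s hs
      refine hball ⟨?_, hsub (Ico_subset_Icc_self hs)⟩
      rw [mem_ball, Real.dist_eq, abs_of_nonneg (by linarith [hs.1])]
      linarith [hs.2])
  exact ⟨r, hz r (right_mem_Icc.2 htr.le), htr, (min_le_right _ _).trans (min_le_left _ _)⟩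

/-- A linear constraint `J u = 0` that is infinitesimally invariant holds at all times if it holds
at one time. -/
lemma IsSol.map_eq_zero (h : IsSol V W u T) (J : E →L[ℝ] G)
    (hJ : ∀ p ∈ W, J p = 0 → ∃ C : ℝ, ∀ᶠ q in 𝓝 p, ‖J (V q)‖ ≤ C * ‖J q‖)
    {t₀ : ℝ} (ht₀ : t₀ ∈ Icc 0 T) (h0 : J (u t₀) = 0) : ∀ t ∈ Icc 0 T, J (u t) = 0 := by
  intro t ht
  rcases le_total t t₀ with hle | hle
  · have h1 := (h.restrict ht₀.2).reverse
    have h2 := h1.map_eq_zero_forward J (by simpa using hJ) (by simpa using h0) (t₀ - t)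
      ⟨by linarith, by linarith [ht.1]⟩
    simpa using h2
  · have h1 : IsSol V W (fun t => u (t₀ + t)) (T - t₀) :=
      IsSol.shift (by simpa using h) ht₀.1
    have h2 := h1.map_eq_zero_forward J hJ (by simpa using h0) (t - t₀)
      ⟨by linarith, by linarith [ht.2]⟩
    simpa using h2

/-- The field is Lipschitz near every point of `W`. -/
def LocLip (V : E → E) (W : Set E) : Prop :=
  ∀ p ∈ W, ∃ C : ℝ, ∀ᶠ q in 𝓝 (p, p), ‖V q.1 - V q.2‖ ≤ C * ‖q.1 - q.2‖

lemma IsSol.prodMk (hu : IsSol V W u T) (hv : IsSol V W v T) :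
    IsSol (fun q : E × E => (V q.1, V q.2)) (W ×ˢ W) (fun t => (u t, v t)) T := fun t ht =>
  ⟨⟨(hu t ht).1, (hv t ht).1⟩, (hu t ht).2.prodMk (hv t ht).2⟩

/-- Uniqueness is the invariance of the diagonal under the product field, and the Lipschitz
condition is exactly the infinitesimal invariance required. -/
lemma IsSol.eqOn_of_eq (hV : LocLip V W) (hu : IsSol V W u T) (hv : IsSol V W v T) {t₀ : ℝ}
    (ht₀ : t₀ ∈ Icc 0 T) (h0 : u t₀ = v t₀) : EqOn u v (Icc 0 T) := by
  intro t ht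
  have := (hu.prodMk hv).map_eq_zero
    (ContinuousLinearMap.fst ℝ E E - ContinuousLinearMap.snd ℝ E E) (by
      rintro ⟨p, q⟩ ⟨hp, -⟩ hpq
      have hpq' : p = q := by simpa [sub_eq_zero] using hpq
      subst hpq'
      obtain ⟨C, hC⟩ := hV p hp
      exact ⟨C, by simpa using hC⟩) ht₀ (by simpa [sub_eq_zero] using h0) t ht
  simpa [sub_eq_zero] using this

/-- The field is tangent to `ker J` and `π` projects onto `ker J`. Hence `J (V q) = J (V q - V (π
q))`, which the Lipschitz condition bounds by a multiple of `‖q - π q‖`, thus of `‖J q‖`. -/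
lemma IsSol.map_eq_zero_of_locLip (hV : LocLip V W) (h : IsSol V W u T) (J : E →L[ℝ] G)
    (π : E →L[ℝ] E) (hJπ : ∀ p, J (π p) = 0) (hπ : ∀ p, J p = 0 → π p = p)
    {C₀ : ℝ} (hC₀ : ∀ p, ‖p - π p‖ ≤ C₀ * ‖J p‖)
    (hVπ : ∀ p ∈ W, J p = 0 → J (V p) = 0) (hW : IsOpen W)
    {t₀ : ℝ} (ht₀ : t₀ ∈ Icc 0 T) (h0 : J (u t₀) = 0) : ∀ t ∈ Icc 0 T, J (u t) = 0 := by
  refine h.map_eq_zero J ?_ ht₀ h0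
  intro p hp hJp
  obtain ⟨C, hC⟩ := hV p hp
  refine ⟨‖J‖ * (|C| * C₀), ?_⟩
  have ht : Tendsto (fun q => (q, π q)) (𝓝 p) (𝓝 (p, p)) := by
    have : Continuous fun q => (q, π q) := by fun_prop
    simpa [hπ p hJp] using this.tendsto p
  have hWπ : ∀ᶠ q in 𝓝 p, π q ∈ W := by
    have : Tendsto π (𝓝 p) (𝓝 p) := by simpa [hπ p hJp] using π.continuous.tendsto p
    exact this.eventually (hW.mem_nhds hp)
  filter_upwards [ht.eventually hC, hWπ] with q hq hqW
  have e1 : J (V q) = J (V q - V (π q)) := by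
    rw [map_sub, hVπ _ hqW (hJπ q), sub_zero]
  rw [e1]
  calc ‖J (V q - V (π q))‖ ≤ ‖J‖ * ‖V q - V (π q)‖ := J.le_opNorm _
    _ ≤ ‖J‖ * (|C| * (C₀ * ‖J q‖)) := by
        gcongr
        refine hq.trans ?_
        calc C * ‖q - π q‖ ≤ |C| * ‖q - π q‖ := by gcongr; exact le_abs_self C
          _ ≤ _ := by gcongr; exact hC₀ q
    _ = _ := by ring

end Solutions

/-! ### Analytic dependence on initial points for long times. -/

section Flow

variable {E : Type*} [NormedAddCommGroup E] [NormedSpace ℂ E]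
  {V : E → E} {W K : Set E} {u v : ℝ → E} {S T a b : ℝ}

lemma locLip_of_analyticOnNhd [CompleteSpace E] (hV : AnalyticOnNhd ℂ V W) : LocLip V W := by
  intro p hp
  obtain ⟨C, s, hs, hC⟩ := ((hV p hp).contDiffAt (n := 1)).exists_lipschitzOnWith
  refine ⟨C, ?_⟩
  rw [nhds_prod_eq]
  filter_upwards [prod_mem_prod hs hs] with q hq
  exact hC.norm_sub_le hq.1 hq.2

/-- Near the solution `u` on `[0, T]` there are solutions with all nearby initial points; they are
uniformly close to `u` and their endpoints depend analytically on the initial point. -/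
def HasFlow (V : E → E) (W : Set E) (u : ℝ → E) (T : ℝ) : Prop :=
  ∃ g : E → E, AnalyticAt ℂ g (u 0) ∧ ∀ η > 0, ∀ᶠ q in 𝓝 (u 0), ∃ v, IsSol V W v T ∧ v 0 = q ∧
    v T = g q ∧ ∀ t ∈ Icc 0 T, dist (v t) (u t) < η

lemma HasFlow.congr (h : HasFlow V W u T) (hT : 0 ≤ T) (huv : EqOn v u (Icc 0 T)) :
    HasFlow V W v T := by
  obtain ⟨g, hg, h⟩ := h
  rw [← huv ⟨le_rfl, hT⟩] at hg h
  refine ⟨g, hg, fun η hη => (h η hη).mono ?_⟩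
  rintro q ⟨w, h1, h2, h3, h4⟩
  exact ⟨w, h1, h2, h3, fun t ht => by rw [huv ht]; exact h4 t ht⟩

/-- The endpoint maps are composed, and nearby solutions are glued in the middle. -/
lemma HasFlow.append (ha : 0 ≤ a) (hb : 0 ≤ b) (h1 : HasFlow V W u a)
    (h2 : HasFlow V W (fun t => u (a + t)) b) : HasFlow V W u (a + b) := by
  obtain ⟨g, hg, h1⟩ := h1
  obtain ⟨k, hk, h2⟩ := h2
  simp only [add_zero] at hk h2
  -- The map `g` is fixed before `η`, so closeness at `q = u 0` for every `η` forces equality.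
  have hga : g (u 0) = u a := by
    by_contra hne
    obtain ⟨w, -, -, hw, hd⟩ := (h1 (dist (g (u 0)) (u a)) (dist_pos.2 hne)).self_of_nhds
    have := hd a ⟨ha, le_rfl⟩
    rw [hw] at this
    exact lt_irrefl _ this
  refine ⟨k ∘ g, AnalyticAt.comp (by rwa [hga]) hg, fun η hη => ?_⟩
  have hgt : Tendsto g (𝓝 (u 0)) (𝓝 (u a)) := by
    rw [← hga]; exact hg.continuousAt
  filter_upwards [h1 η hη, hgt.eventually (h2 η hη)] with q hq1 hq2
  obtain ⟨w, hw, hw0, hwa, hwd⟩ := hq1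
  obtain ⟨x, hx, hx0, hxb, hxd⟩ := hq2
  refine ⟨_, hw.append hx ha (by rw [hx0, hwa]), by simp [ha, hw0], ?_, ?_⟩
  · rcases hb.eq_or_lt with rfl | hb
    · simp only [add_zero, le_refl, if_true, Function.comp]
      rw [hwa, ← hxb, hx0]
    · simp [hb, hxb]
  · intro t ht
    by_cases hta : t ≤ a
    · simpa [hta] using hwd t ⟨ht.1, hta⟩
    · have := hxd (t - a) ⟨by linarith, by linarith [ht.2]⟩
      simpa [hta] using this

variable [CompleteSpace E]

/-- The short solution is an analytic function of `p` with values in `C([0,1], E)`: evaluating it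
gives the analytic endpoint map, and its continuity in the sup norm gives uniform closeness. -/
lemma exists_local_hasFlow (hW : IsOpen W) (hV : AnalyticOnNhd ℂ V W) {p₀ : E} (hp₀ : p₀ ∈ W) :
    ∃ τ : ℝ, 0 < τ ∧ ∀ᶠ p in 𝓝 p₀, ∀ θ ∈ Icc 0 τ, ∃ u, u 0 = p ∧ IsSol V W u θ ∧
      HasFlow V W u θ := by
  obtain ⟨τ, hτ, Ψ, hΨ⟩ := exists_analytic_short_solution (hV p₀ hp₀) (hW.mem_nhds hp₀)
  let U : E → ℝ → E := fun p t => Ψ p (projIcc 0 1 zero_le_one (τ⁻¹ * t))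
  have hU : ∀ᶠ p in 𝓝 p₀, U p 0 = p ∧ IsSol V W (U p) τ := by
    filter_upwards [hΨ] with p hp
    have h1 : IsSol (fun q => τ • V q) W (fun s => Ψ p (projIcc 0 1 zero_le_one s)) 1 :=
      fun t ht => ⟨hp.2.2.1 _, hp.2.2.2 t ht⟩
    have h2 := h1.scale (inv_pos.2 hτ)
    refine ⟨by simp [U, projIcc_left]; exact hp.2.1, ?_⟩
    simpa [smul_smul, hτ.ne', U] using h2
  refine ⟨τ, hτ, ?_⟩
  filter_upwards [hΨ, hU, hU.eventually_nhds] with p hp hUp hUev θ hθ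
  refine ⟨U p, hUp.1, hUp.2.restrict hθ.2, fun q => U q θ, ?_, fun η hη => ?_⟩
  · rw [hUp.1]
    exact ((ContinuousMap.evalCLM ℂ (projIcc (0 : ℝ) 1 zero_le_one (τ⁻¹ * θ)) :
      C(unitInterval, E) →L[ℂ] E).analyticAt _).comp hp.1
  · rw [hUp.1]
    have hc := hp.1.continuousAt.eventually (Metric.ball_mem_nhds (Ψ p) hη)
    filter_upwards [hUev, hc] with q hq hqc
    exact ⟨U q, hq.2.restrict hθ.2, hq.1, rfl, fun t _ =>
      (ContinuousMap.dist_apply_le_dist _).trans_lt hqc⟩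

/-- Compactness gives a common step length. All shorter durations are included so that a subdivision
may contain one shorter step. -/
lemma exists_uniform_hasFlow (hW : IsOpen W) (hV : AnalyticOnNhd ℂ V W) (hK : IsCompact K)
    (hKW : K ⊆ W) : ∃ τ : ℝ, 0 < τ ∧ ∀ p ∈ K, ∀ θ ∈ Icc 0 τ, ∃ u, u 0 = p ∧ IsSol V W u θ ∧
      HasFlow V W u θ := by
  refine hK.induction_on (p := fun s => ∃ τ : ℝ, 0 < τ ∧ ∀ p ∈ s, ∀ θ ∈ Icc 0 τ,
    ∃ u, u 0 = p ∧ IsSol V W u θ ∧ HasFlow V W u θ) ⟨1, one_pos, by simp⟩ ?_ ?_ ?_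
  · rintro s t hst ⟨τ, hτ, h⟩
    exact ⟨τ, hτ, fun p hp => h p (hst hp)⟩
  · rintro s t ⟨τ, hτ, h⟩ ⟨τ', hτ', h'⟩
    refine ⟨min τ τ', lt_min hτ hτ', ?_⟩
    rintro p (hp | hp) θ hθ
    · exact h p hp θ ⟨hθ.1, hθ.2.trans (min_le_left _ _)⟩
    · exact h' p hp θ ⟨hθ.1, hθ.2.trans (min_le_right _ _)⟩
  · intro p hp
    obtain ⟨τ, hτ, h⟩ := exists_local_hasFlow hW hV (hKW hp)
    exact ⟨_, mem_nhdsWithin_of_mem_nhds h, τ, hτ, fun q hq => hq⟩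

/-- Solutions of an analytic differential equation depend analytically on the initial point. -/
theorem IsSol.hasFlow (hW : IsOpen W) (hV : AnalyticOnNhd ℂ V W) (hT : 0 ≤ T)
    (h : IsSol V W u T) : HasFlow V W u T := by
  obtain ⟨τ, hτ, hloc⟩ := exists_uniform_hasFlow hW hV (isCompact_Icc.image_of_continuousOn
    h.continuousOn) (by rintro _ ⟨t, ht, rfl⟩; exact (h t ht).1)
  have key : ∀ n : ℕ, ∀ t ∈ Icc 0 T, t ≤ n * τ → HasFlow V W u t := by
    intro n
    induction n with
    | zero =>
      intro t ht htn
      obtain rfl : t = 0 := le_antisymm (by simpa using htn) ht.1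
      obtain ⟨w, hw0, -, hw⟩ := hloc (u 0) ⟨0, ht, rfl⟩ 0 ⟨le_rfl, hτ.le⟩
      refine hw.congr le_rfl fun s hs => ?_
      obtain rfl : s = 0 := le_antisymm hs.2 hs.1
      exact hw0.symm
    | succ n ih =>
      intro t ht htn
      -- The last step starts at `s` and has length at most `τ`; the maximum covers the case where a
      -- single step suffices.
      set s := max 0 (t - τ) with hs
      have hs0 : 0 ≤ s := le_max_left _ _
      have hst : s ≤ t := max_le ht.1 (by linarith)
      have hsn : s ≤ n * τ := max_le (by positivity) (by push_cast at htn; linarith)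
      have hsT : s ∈ Icc 0 T := ⟨hs0, hst.trans ht.2⟩
      obtain ⟨w, hw0, hws, hwf⟩ := hloc (u s) ⟨s, hsT, rfl⟩ (t - s)
        ⟨by linarith, by linarith [le_max_right 0 (t - τ)]⟩
      have h1 : IsSol V W (fun r => u (s + r)) (t - s) :=
        IsSol.shift (by simpa using h.restrict ht.2) hs0
      have h2 := h1.eqOn_of_eq (locLip_of_analyticOnNhd hV) hws (t₀ := 0)
        ⟨le_rfl, by linarith⟩ (by simp [hw0])
      have h3 := (ih s hsT hsn).append hs0 (by linarith) (hwf.congr (by linarith) h2)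
      simpa using h3
  obtain ⟨n, hn⟩ := exists_nat_ge (T / τ)
  exact key n T ⟨hT, le_rfl⟩ ((div_le_iff₀ hτ).1 hn)

/-- A solution that cannot leave a compact set exists for all times. -/
theorem exists_isSol_of_compact (hW : IsOpen W) (hV : AnalyticOnNhd ℂ V W) (hK : IsCompact K)
    (hKW : K ⊆ W) {p : E} (hp : p ∈ K) (hT : 0 ≤ T)
    (hstay : ∀ t ∈ Icc 0 T, ∀ u, IsSol V W u t → u 0 = p → u t ∈ K) :
    ∃ u, IsSol V W u T ∧ u 0 = p := by
  obtain ⟨τ, hτ, hloc⟩ := exists_uniform_hasFlow hW hV hK hKW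
  have key : ∀ n : ℕ, ∀ t ∈ Icc 0 T, t ≤ n * τ → ∃ u, IsSol V W u t ∧ u 0 = p := by
    intro n
    induction n with
    | zero =>
      intro t ht htn
      obtain rfl : t = 0 := le_antisymm (by simpa using htn) ht.1
      obtain ⟨w, hw0, hw, -⟩ := hloc p hp 0 ⟨le_rfl, hτ.le⟩
      exact ⟨w, hw, hw0⟩
    | succ n ih =>
      intro t ht htn
      set s := max 0 (t - τ) with hs
      have hs0 : 0 ≤ s := le_max_left _ _
      have hst : s ≤ t := max_le ht.1 (by linarith)
      have hsn : s ≤ n * τ := max_le (by positivity) (by push_cast at htn; linarith)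
      have hsT : s ∈ Icc 0 T := ⟨hs0, hst.trans ht.2⟩
      obtain ⟨u, hu, hu0⟩ := ih s hsT hsn
      obtain ⟨w, hw0, hws, -⟩ := hloc (u s) (hstay s hsT u hu hu0) (t - s)
        ⟨by linarith, by linarith [le_max_right 0 (t - τ)]⟩
      have h3 := hu.append hws hs0 hw0
      refine ⟨_, by simpa using h3, by simp [hs0, hu0]⟩
  obtain ⟨n, hn⟩ := exists_nat_ge (T / τ)
  exact key n T ⟨hT, le_rfl⟩ ((div_le_iff₀ hτ).1 hn)

open Classical in
/-- The time-one map of `u' = V u` on `W`. -/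
def timeOne (V : E → E) (W : Set E) (p : E) : E :=
  if h : ∃ u, IsSol V W u 1 ∧ u 0 = p then h.choose 1 else p

/-- Uniqueness makes the choice in `timeOne` immaterial. -/
lemma IsSol.timeOne_eq (hV : AnalyticOnNhd ℂ V W) (h : IsSol V W u 1) :
    timeOne V W (u 0) = u 1 := by
  have hex : ∃ v, IsSol V W v 1 ∧ v 0 = u 0 := ⟨u, h, rfl⟩
  rw [timeOne, dif_pos hex]
  exact hex.choose_spec.1.eqOn_of_eq (locLip_of_analyticOnNhd hV) h (t₀ := 0) (by simp)
    hex.choose_spec.2 (by simp)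

lemma IsSol.analyticAt_timeOne (hW : IsOpen W) (hV : AnalyticOnNhd ℂ V W) (h : IsSol V W u 1) :
    AnalyticAt ℂ (timeOne V W) (u 0) := by
  obtain ⟨g, hg, hev⟩ := h.hasFlow hW hV zero_le_one
  refine hg.congr ?_
  filter_upwards [hev 1 one_pos] with q hq
  obtain ⟨v, hv, hv0, hv1, -⟩ := hq
  rw [← hv1, ← hv0, hv.timeOne_eq hV]

end Flow

/-! ### Partial derivatives under exchange of coordinates, and their reality. -/

lemma dx_comp_swap (f : ℂ × ℂ → ℂ) : dx (f ∘ Prod.swap) = dy f ∘ Prod.swap := by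
  funext p
  have := (ContinuousLinearEquiv.prodComm ℂ ℂ ℂ).comp_right_fderiv (f := f) (x := p)
  change fderiv ℂ (f ∘ (ContinuousLinearEquiv.prodComm ℂ ℂ ℂ)) p (1, 0) = _
  rw [this]
  simp [dy]

lemma dy_comp_swap (f : ℂ × ℂ → ℂ) : dy (f ∘ Prod.swap) = dx f ∘ Prod.swap := by
  funext p
  have := (ContinuousLinearEquiv.prodComm ℂ ℂ ℂ).comp_right_fderiv (f := f) (x := p)
  change fderiv ℂ (f ∘ (ContinuousLinearEquiv.prodComm ℂ ℂ ℂ)) p (0, 1) = _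
  rw [this]
  simp [dx]

lemma dy_dx_eq_dx_dy {f : ℂ × ℂ → ℂ} {p : ℂ × ℂ} (hf : AnalyticAt ℂ f p) :
    dy (dx f) p = dx (dy f) p := by
  have hd : DifferentiableAt ℂ (fderiv ℂ f) p := hf.fderiv.differentiableAt
  have h1 : ∀ v w : ℂ × ℂ, fderiv ℂ (fun q => fderiv ℂ f q v) p w = fderiv ℂ (fderiv ℂ f) p w v := by
    intro v w
    rw [fderiv_clm_apply hd (differentiableAt_const v)]
    simp
  have hs : IsSymmSndFDerivAt ℂ f p :=
    (hf.contDiffAt (n := ω)).isSymmSndFDerivAt (by simp)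
  change fderiv ℂ (fun q => fderiv ℂ f q (1, 0)) p (0, 1)
    = fderiv ℂ (fun q => fderiv ℂ f q (0, 1)) p (1, 0)
  rw [h1, h1]
  exact hs _ _

lemma analyticAt_dx {f : ℂ × ℂ → ℂ} {p : ℂ × ℂ} (hf : AnalyticAt ℂ f p) : AnalyticAt ℂ (dx f) p :=
  ((ContinuousLinearMap.apply ℂ ℂ ((1, 0) : ℂ × ℂ)).analyticAt _).comp hf.fderiv

lemma analyticAt_dy {f : ℂ × ℂ → ℂ} {p : ℂ × ℂ} (hf : AnalyticAt ℂ f p) : AnalyticAt ℂ (dy f) p :=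
  ((ContinuousLinearMap.apply ℂ ℂ ((0, 1) : ℂ × ℂ)).analyticAt _).comp hf.fderiv

lemma im_fderiv_eq_zero {f : ℂ × ℂ → ℂ} {U : Set (ℂ × ℂ)} (hU : IsOpen U)
    (hf : AnalyticOnNhd ℂ f U) (hr : ∀ p : ℝ × ℝ, toC p ∈ U → (f (toC p)).im = 0)
    {p : ℝ × ℝ} (hp : toC p ∈ U) (v : ℝ × ℝ) : (fderiv ℂ f (toC p) (toC v)).im = 0 := by
  have hline : HasDerivAt (fun t : ℝ => toC (p + t • v)) (toC v) 0 := by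
    have h1 : ∀ a b : ℝ, HasDerivAt (fun t : ℝ => ((a + t * b : ℝ) : ℂ)) (b : ℂ) 0 := by
      intro a b
      have := (((hasDerivAt_id (0 : ℝ)).mul_const b).const_add a).ofReal_comp
      simpa using this
    exact (h1 p.1 v.1).prodMk (h1 p.2 v.2)
  have h0 : toC (p + (0 : ℝ) • v) = toC p := by simp
  have hfd : HasFDerivAt f ((fderiv ℂ f (toC p)).restrictScalars ℝ) (toC (p + (0 : ℝ) • v)) := by
    rw [h0]
    exact ((hf _ hp).differentiableAt.hasFDerivAt).restrictScalars ℝ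
  have h2 := Complex.imCLM.hasFDerivAt.comp_hasDerivAt (0 : ℝ)
    (hfd.comp_hasDerivAt (0 : ℝ) hline)
  have h3 : (Complex.imCLM ∘ fun t : ℝ => f (toC (p + t • v))) =ᶠ[𝓝 0] fun _ => (0 : ℝ) := by
    have : ∀ᶠ t in 𝓝 (0 : ℝ), toC (p + t • v) ∈ U :=
      hline.continuousAt.eventually (hU.mem_nhds (by simpa using hp))
    filter_upwards [this] with t ht
    exact hr _ ht
  have h4 := (h2.congr_of_eventuallyEq h3.symm).unique (hasDerivAt_const (0 : ℝ) (0 : ℝ))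
  exact h4

/-! ### The field on the axes and near the saddle. -/

namespace DeformedSaddle

variable (F : DeformedSaddle)

/-- The same foliation with the two coordinates exchanged. -/
def swap : DeformedSaddle where
  U := Prod.swap ⁻¹' F.U
  isOpen_U := F.isOpen_U.preimage continuous_swap
  zero_mem := F.zero_mem
  r := F.r
  r_pos := F.r_pos
  f := F.f ∘ Prod.swap
  P := fun q => F.Q (q.1.swap, q.2)
  Q := fun q => F.P (q.1.swap, q.2)
  f_analytic := fun p hp => (F.f_analytic _ hp).comp
    ((ContinuousLinearEquiv.prodComm ℂ ℂ ℂ).toContinuousLinearMap.analyticAt p)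
  P_analytic := fun q hq => AnalyticAt.comp (g := F.Q)
    (f := fun q : (ℂ × ℂ) × ℂ => (q.1.swap, q.2)) (F.Q_analytic (q.1.swap, q.2) hq)
    (((ContinuousLinearEquiv.prodComm ℂ ℂ ℂ).toContinuousLinearMap.prodMap
      (ContinuousLinearMap.id ℂ ℂ)).analyticAt q)
  Q_analytic := fun q hq => AnalyticAt.comp (g := F.P)
    (f := fun q : (ℂ × ℂ) × ℂ => (q.1.swap, q.2)) (F.P_analytic (q.1.swap, q.2) hq)
    (((ContinuousLinearEquiv.prodComm ℂ ℂ ℂ).toContinuousLinearMap.prodMap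
      (ContinuousLinearMap.id ℂ ℂ)).analyticAt q)
  f_real := fun p hp => F.f_real p.swap hp
  P_real := fun p ε hp hε => F.Q_real p.swap ε hp hε
  Q_real := fun p ε hp hε => F.P_real p.swap ε hp hε
  f_zero := F.f_zero
  f_crit := by
    have := (ContinuousLinearEquiv.prodComm ℂ ℂ ℂ).comp_right_fderiv (f := F.f) (x := (0, 0))
    change fderiv ℂ (F.f ∘ (ContinuousLinearEquiv.prodComm ℂ ℂ ℂ)) (0, 0) = _
    rw [this]
    have h0 : (ContinuousLinearEquiv.prodComm ℂ ℂ ℂ) (0, 0) = (0, 0) := rfl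
    rw [h0, F.f_crit]
    simp
  f_saddle := by
    have := F.f_saddle
    simp only [dx_comp_swap, dy_comp_swap, Function.comp, Prod.swap_prod_mk]
    rw [dy_dx_eq_dx_dy (F.f_analytic _ F.zero_mem), mul_comm]
    exact this
  f_quadrant := by
    have := F.f_quadrant
    simp only [dx_comp_swap, dy_comp_swap, Function.comp, Prod.swap_prod_mk]
    rw [dy_dx_eq_dx_dy (F.f_analytic _ F.zero_mem)]
    exact this
  xAxis_invariant := fun x ε hx hε => by
    rw [dx_comp_swap]
    exact F.yAxis_invariant x ε hx hε
  yAxis_invariant := fun y ε hy hε => by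
    rw [dy_comp_swap]
    exact F.xAxis_invariant y ε hy hε

/-- Exchanging the coordinates preserves the foliation but reverses time. -/
lemma swap_X (ε : ℂ) (p : ℂ × ℂ) : F.swap.X ε p = -(F.X ε p.swap).swap := by
  simp [X, swap, dx_comp_swap, dy_comp_swap]

lemma analyticAt_X {q : (ℂ × ℂ) × ℂ} (hp : q.1 ∈ F.U) (hε : ‖q.2‖ < F.r) :
    AnalyticAt ℂ (fun q : (ℂ × ℂ) × ℂ => F.X q.2 q.1) q := by
  have hq : q ∈ F.U ×ˢ ball (0 : ℂ) F.r := ⟨hp, by simpa using hε⟩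
  have hx : AnalyticAt ℂ (fun q : (ℂ × ℂ) × ℂ => dx F.f q.1) q :=
    (analyticAt_dx (F.f_analytic _ hp)).comp analyticAt_fst
  have hy : AnalyticAt ℂ (fun q : (ℂ × ℂ) × ℂ => dy F.f q.1) q :=
    (analyticAt_dy (F.f_analytic _ hp)).comp analyticAt_fst
  exact (hy.add (analyticAt_snd.mul (F.Q_analytic _ hq))).prod
    (hx.add (analyticAt_snd.mul (F.P_analytic _ hq))).neg

lemma X_real {p : ℝ × ℝ} {ε : ℝ} (hp : toC p ∈ F.U) (hε : |ε| < F.r) :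
    (F.X ε (toC p)).1.im = 0 ∧ (F.X ε (toC p)).2.im = 0 := by
  have h1 : (dx F.f (toC p)).im = 0 := by
    simpa [toC, dx] using im_fderiv_eq_zero F.isOpen_U F.f_analytic F.f_real hp (1, 0)
  have h2 : (dy F.f (toC p)).im = 0 := by
    simpa [toC, dy] using im_fderiv_eq_zero F.isOpen_U F.f_analytic F.f_real hp (0, 1)
  simp [X, h1, h2, F.P_real p ε hp hε, F.Q_real p ε hp hε]

lemma X_snd_xAxis {x ε : ℂ} (hx : (x, 0) ∈ F.U) (hε : ‖ε‖ < F.r) : (F.X ε (x, 0)).2 = 0 := by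
  simp [X, F.xAxis_invariant x ε hx hε]

lemma X_fst_yAxis {y ε : ℂ} (hy : (0, y) ∈ F.U) (hε : ‖ε‖ < F.r) : (F.X ε (0, y)).1 = 0 := by
  simp [X, F.yAxis_invariant y ε hy hε]

lemma dx_xAxis {x : ℂ} (hx : (x, 0) ∈ F.U) : dx F.f (x, 0) = 0 := by
  simpa using F.xAxis_invariant x 0 hx (by simpa using F.r_pos)

/-- The eigenvalue `∂ₓ∂_y f (0, 0)` of the saddle. -/
def eig : ℝ := (dx (dy F.f) (0, 0)).re

lemma eig_pos : 0 < F.eig := F.f_quadrant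

lemma dx_dy_eq_eig : dx (dy F.f) (0, 0) = F.eig := by
  have h := im_fderiv_eq_zero (f := dy F.f) F.isOpen_U
    (fun p hp => analyticAt_dy (F.f_analytic p hp))
    (fun p hp => by
      simpa [toC, dy] using im_fderiv_eq_zero F.isOpen_U F.f_analytic F.f_real hp (0, 1))
    (p := (0, 0)) F.zero_mem (1, 0)
  refine Complex.ext ?_ ?_
  · simp [eig]
  · simpa [toC, dx] using h

lemma swap_eig : F.swap.eig = F.eig := by
  have : dx (dy F.swap.f) (0, 0) = dy (dx F.f) (0, 0) := by
    change dx (dy (F.f ∘ Prod.swap)) (0, 0) = _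
    rw [dy_comp_swap, dx_comp_swap]; rfl
  rw [eig, this, dy_dx_eq_dx_dy (F.f_analytic _ F.zero_mem)]
  rfl

/-- Near the origin the `∂x`-component of the field is comparable to `eig * x`. -/
lemma eventually_X_fst {κ : ℝ} (hκ : 0 < κ) :
    ∀ᶠ q : (ℂ × ℂ) × ℂ in 𝓝 0, ‖(F.X q.2 q.1).1 - F.eig * q.1.1‖ ≤ κ * ‖q.1.1‖ := by
  have h0 : (0 : (ℂ × ℂ) × ℂ).1 ∈ F.U := F.zero_mem
  have ha : AnalyticAt ℂ (fun q : (ℂ × ℂ) × ℂ => (F.X q.2 q.1).1) 0 :=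
    analyticAt_fst.comp (F.analyticAt_X h0 (by simpa using F.r_pos))
  have hs := ha.hasStrictFDerivAt
  have hL : fderiv ℂ (fun q : (ℂ × ℂ) × ℂ => (F.X q.2 q.1).1) 0 ((1, 0), 0) = F.eig := by
    have hline : HasDerivAt (fun t : ℂ => (((t, 0), 0) : (ℂ × ℂ) × ℂ)) ((1, 0), 0) 0 :=
      ((hasDerivAt_id (0 : ℂ)).prodMk (hasDerivAt_const _ _)).prodMk (hasDerivAt_const _ _)
    have h1 := HasFDerivAt.comp_hasDerivAt (f := fun t : ℂ => (((t, 0), 0) : (ℂ × ℂ) × ℂ)) (0 : ℂ)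
      ha.differentiableAt.hasFDerivAt hline
    have hline2 : HasDerivAt (fun t : ℂ => ((t, 0) : ℂ × ℂ)) (1, 0) 0 :=
      (hasDerivAt_id (0 : ℂ)).prodMk (hasDerivAt_const _ _)
    have h2 := HasFDerivAt.comp_hasDerivAt (f := fun t : ℂ => ((t, 0) : ℂ × ℂ)) (0 : ℂ)
      (analyticAt_dy (F.f_analytic _ F.zero_mem)).differentiableAt.hasFDerivAt hline2
    have h3 := h1.unique (h2.congr_of_eventuallyEq (Eventually.of_forall fun t => by
      simp [X]))
    rw [h3]
    exact F.dx_dy_eq_eig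
  -- Strict differentiability compares `q` with its projection to `{x = 0}`, where the component
  -- vanishes by invariance. The error is therefore relative to `|x|`, uniformly in `y` and `ε`.
  have hlo := hs.isLittleO.def hκ
  have ht : Tendsto (fun q : (ℂ × ℂ) × ℂ => (q, (((0, q.1.2), q.2) : (ℂ × ℂ) × ℂ))) (𝓝 0)
      (𝓝 (0, 0)) := by
    have : Continuous fun q : (ℂ × ℂ) × ℂ => (q, (((0, q.1.2), q.2) : (ℂ × ℂ) × ℂ)) := by fun_prop
    exact this.tendsto 0
  have hU : ∀ᶠ q : (ℂ × ℂ) × ℂ in 𝓝 0, ((0, q.1.2) : ℂ × ℂ) ∈ F.U := by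
    have : Continuous fun q : (ℂ × ℂ) × ℂ => ((0, q.1.2) : ℂ × ℂ) := by fun_prop
    exact this.continuousAt.eventually (F.isOpen_U.mem_nhds F.zero_mem)
  have hr : ∀ᶠ q : (ℂ × ℂ) × ℂ in 𝓝 0, ‖q.2‖ < F.r := by
    have : Continuous fun q : (ℂ × ℂ) × ℂ => ‖q.2‖ := by fun_prop
    exact this.continuousAt.eventually (Iio_mem_nhds (by simpa using F.r_pos))
  filter_upwards [ht.eventually hlo, hU, hr] with q hq hqU hqr
  have hsub : q - ((0, q.1.2), q.2) = q.1.1 • (((1, 0), 0) : (ℂ × ℂ) × ℂ) := by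
    ext <;> simp
  simp only [hsub, map_smul, hL, F.X_fst_yAxis hqU hqr, sub_zero, norm_smul, smul_eq_mul] at hq
  rw [mul_comm (F.eig : ℂ)]
  simpa using hq

lemma eventually_X_snd {κ : ℝ} (hκ : 0 < κ) :
    ∀ᶠ q : (ℂ × ℂ) × ℂ in 𝓝 0, ‖(F.X q.2 q.1).2 + F.eig * q.1.2‖ ≤ κ * ‖q.1.2‖ := by
  have h := F.swap.eventually_X_fst hκ
  have ht : Tendsto (fun q : (ℂ × ℂ) × ℂ => (q.1.swap, q.2)) (𝓝 0) (𝓝 0) := by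
    have : Continuous fun q : (ℂ × ℂ) × ℂ => (q.1.swap, q.2) := by fun_prop
    exact this.tendsto 0
  filter_upwards [ht.eventually h] with q hq
  rw [swap_X, swap_eig] at hq
  rw [← norm_neg]
  simpa [sub_eq_add_neg, add_comm] using hq

end DeformedSaddle

/-! ### Reparametrization of tangent curves. -/

section Reparametrization

variable {E : Type*} [NormedAddCommGroup E] [NormedSpace ℝ E] {V : E → E} {W : Set E} {u : ℝ → E}

/-- A curve everywhere positively tangent to `V` can be reparametrized to a solution. -/
lemma exists_isSol_of_pos_tangent {g : ℝ → ℝ} (hg : ContinuousOn g (Icc 0 1))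
    (hpos : ∀ t ∈ Icc (0 : ℝ) 1, 0 < g t)
    (hu : ∀ t ∈ Icc (0 : ℝ) 1, u t ∈ W ∧ HasDerivWithinAt u (g t • V (u t)) (Icc 0 1) t) :
    ∃ (T : ℝ) (v : ℝ → E), 0 < T ∧ IsSol V W v T ∧ v 0 = u 0 ∧ v T = u 1 := by
  -- The constant extension outside the interval keeps a positive lower bound, so its primitive is
  -- an increasing bijection of `ℝ`, whose inverse is the new time.
  set k : ℝ → ℝ := IccExtend zero_le_one ((Icc (0 : ℝ) 1).domRestrict g) with hk
  have hkc : Continuous k := (continuousOn_iff_continuous_domRestrict.1 hg).Icc_extend'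
  have hkg : ∀ t ∈ Icc (0 : ℝ) 1, k t = g t := fun t ht => by
    rw [hk, IccExtend_of_mem zero_le_one _ ht]; rfl
  obtain ⟨m, hm, hmin⟩ : ∃ m, 0 < m ∧ ∀ t, m ≤ k t := by
    obtain ⟨t₀, ht₀, hle⟩ := isCompact_Icc.exists_isMinOn (nonempty_Icc.2 zero_le_one) hg
    refine ⟨g t₀, hpos t₀ ht₀, fun t => ?_⟩
    exact hle (projIcc 0 1 zero_le_one t).2
  set θ : ℝ → ℝ := fun s => ∫ r in (0 : ℝ)..s, k r with hθ
  have hθd : ∀ s, HasDerivAt θ (k s) s := fun s =>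
    intervalIntegral.integral_hasDerivAt_right (hkc.intervalIntegrable _ _)
      (hkc.stronglyMeasurableAtFilter _ _) hkc.continuousAt
  have hθ0 : θ 0 = 0 := by simp [hθ]
  have hmono : StrictMono θ := strictMono_of_hasDerivAt_pos hθd fun s => hm.trans_le (hmin s)
  have hlin : Monotone fun s => θ s - m * s := by
    refine monotone_of_hasDerivAt_nonneg (f' := fun s => k s - m) (fun s => ?_)
      (fun s => sub_nonneg.2 (hmin s))
    simpa using (hθd s).fun_sub ((hasDerivAt_id s).const_mul m)
  have hθc : Continuous θ := continuous_iff_continuousAt.2 fun s => (hθd s).continuousAt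
  have htop : Tendsto θ atTop atTop := by
    refine tendsto_atTop_mono' _ ?_ (tendsto_id.const_mul_atTop hm)
    filter_upwards [eventually_ge_atTop 0] with s hs
    have := hlin hs
    simp only [hθ0, mul_zero, sub_zero] at this
    simp only [id]; linarith
  have hbot : Tendsto θ atBot atBot := by
    refine tendsto_atBot_mono' _ ?_ (tendsto_id.const_mul_atBot hm)
    filter_upwards [eventually_le_atBot 0] with s hs
    have := hlin hs
    simp only [hθ0, mul_zero, sub_zero] at this
    simp only [id]; linarith
  let e : ℝ ≃o ℝ := hmono.orderIsoOfSurjective θ (hθc.surjective htop hbot)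
  have he : ∀ s, e s = θ s := fun _ => rfl
  have he0 : e.symm 0 = 0 := by rw [OrderIso.symm_apply_eq, he, hθ0]
  have heT : e.symm (θ 1) = 1 := by rw [OrderIso.symm_apply_eq, he]
  have hmaps : MapsTo e.symm (Icc 0 (θ 1)) (Icc 0 1) := fun t ht =>
    ⟨by rw [← he0]; exact e.symm.monotone ht.1, by rw [← heT]; exact e.symm.monotone ht.2⟩
  have hT : 0 < θ 1 := by rw [← hθ0]; exact hmono one_pos
  refine ⟨θ 1, fun t => u (e.symm t), hT, ?_, by simp [he0], by simp [heT]⟩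
  intro t ht
  have hs := hmaps ht
  refine ⟨(hu _ hs).1, ?_⟩
  have hinv : HasDerivAt e.symm (k (e.symm t))⁻¹ t :=
    HasDerivAt.of_local_left_inverse e.symm.continuous.continuousAt (hθd _)
      (hm.trans_le (hmin _)).ne' (Eventually.of_forall fun y => e.apply_symm_apply y)
  have h1 := (hu _ hs).2.scomp t hinv.hasDerivWithinAt hmaps
  rw [hkg _ hs, smul_smul, inv_mul_cancel₀ (hpos _ hs).ne', one_smul] at h1
  exact h1

/-- A curve everywhere negatively tangent to `V` can be reparametrized to a solution running
backwards. -/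
lemma exists_isSol_of_neg_tangent {g : ℝ → ℝ} (hg : ContinuousOn g (Icc 0 1))
    (hneg : ∀ t ∈ Icc (0 : ℝ) 1, g t < 0)
    (hu : ∀ t ∈ Icc (0 : ℝ) 1, u t ∈ W ∧ HasDerivWithinAt u (g t • V (u t)) (Icc 0 1) t) :
    ∃ (T : ℝ) (v : ℝ → E), 0 < T ∧ IsSol V W v T ∧ v 0 = u 1 ∧ v T = u 0 := by
  obtain ⟨T, v, hT, hv, h0, h1⟩ := exists_isSol_of_pos_tangent (V := fun p => -V p) (W := W)
    (u := u) (g := fun t => -g t) hg.neg (fun t ht => neg_pos.2 (hneg t ht))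
    (by simpa using hu)
  refine ⟨T, fun t => v (T - t), hT, by simpa using hv.reverse, by simpa using h1, by simpa using h0⟩

end Reparametrization

lemma eq_of_hasDerivWithinAt_zero {E : Type*} [NormedAddCommGroup E] [NormedSpace ℝ E] {g : ℝ → E}
    {T : ℝ} (h : ∀ t ∈ Icc 0 T, HasDerivWithinAt g 0 (Icc 0 T) t) {t : ℝ} (ht : t ∈ Icc 0 T) :
    g t = g 0 := by
  refine constant_of_has_deriv_right_zero (fun s hs => (h s hs).continuousWithinAt) ?_ t ht
  intro s hs
  refine (h s (Ico_subset_Icc_self hs)).mono_of_mem_nhdsWithin ?_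
  have : Ici s ∩ Iio T ∈ 𝓝[Ici s] s := inter_mem_nhdsWithin _ (Iio_mem_nhds hs.2)
  exact mem_of_superset this fun q hq => ⟨hs.1.trans hq.1, hq.2.le⟩

/-! ### The rescaled field on the state space and its invariants. -/

namespace DeformedSaddle

variable (F : DeformedSaddle)

/-- The field `X_ε` rescaled so that `x` grows exponentially. The state `(x, y, ε, c)` contains the
parameter and a complex time `c`, so that the time-one map is the flow for the time `c`. -/
def field (s : ℂ × ℂ × ℂ × ℂ) : ℂ × ℂ × ℂ × ℂ :=
  (s.2.2.2 * s.1,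
    s.2.2.2 * s.1 * (F.X s.2.2.1 (s.1, s.2.1)).2 / (F.X s.2.2.1 (s.1, s.2.1)).1, 0, 0)

/-- The domain of `field`. -/
def dom : Set (ℂ × ℂ × ℂ × ℂ) :=
  {s | ((s.1, s.2.1) ∈ F.U ∧ ‖s.2.2.1‖ < F.r ∧ s.1 ≠ 0) ∧
    0 < ((F.X s.2.2.1 (s.1, s.2.1)).1 / s.1).re}

/-- The projection from states to the arguments of `X`. -/
def arg : ℂ × ℂ × ℂ × ℂ →L[ℂ] (ℂ × ℂ) × ℂ :=
  ((ContinuousLinearMap.fst ℂ ℂ (ℂ × ℂ × ℂ)).prod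
    (.fst ℂ ℂ (ℂ × ℂ) ∘L .snd ℂ ℂ (ℂ × ℂ × ℂ))).prod
    (.fst ℂ ℂ ℂ ∘L .snd ℂ ℂ (ℂ × ℂ) ∘L .snd ℂ ℂ (ℂ × ℂ × ℂ))

lemma analyticAt_X_state {s : ℂ × ℂ × ℂ × ℂ} (hU : (s.1, s.2.1) ∈ F.U) (hr : ‖s.2.2.1‖ < F.r) :
    AnalyticAt ℂ (fun s : ℂ × ℂ × ℂ × ℂ => F.X s.2.2.1 (s.1, s.2.1)) s :=
  AnalyticAt.comp (g := fun q : (ℂ × ℂ) × ℂ => F.X q.2 q.1) (f := arg)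
    (F.analyticAt_X (q := arg s) hU hr) (arg.analyticAt s)

lemma isOpen_dom : IsOpen F.dom := by
  have h0 : IsOpen {s : ℂ × ℂ × ℂ × ℂ | (s.1, s.2.1) ∈ F.U ∧ ‖s.2.2.1‖ < F.r ∧ s.1 ≠ 0} := by
    refine (F.isOpen_U.preimage
      (f := fun s : ℂ × ℂ × ℂ × ℂ => (s.1, s.2.1)) (by fun_prop)).inter (IsOpen.inter ?_ ?_)
    · exact isOpen_lt (f := fun s : ℂ × ℂ × ℂ × ℂ => ‖s.2.2.1‖) (by fun_prop) continuous_const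
    · exact isOpen_ne_fun (f := fun s : ℂ × ℂ × ℂ × ℂ => s.1) (by fun_prop) continuous_const
  have hc : ContinuousOn (fun s : ℂ × ℂ × ℂ × ℂ => ((F.X s.2.2.1 (s.1, s.2.1)).1 / s.1).re)
      {s : ℂ × ℂ × ℂ × ℂ | (s.1, s.2.1) ∈ F.U ∧ ‖s.2.2.1‖ < F.r ∧ s.1 ≠ 0} := by
    intro s hs
    have h1 := (F.analyticAt_X_state hs.1 hs.2.1).continuousAt
    exact (Complex.continuous_re.continuousAt.comp
      (h1.fst.div continuousAt_fst hs.2.2)).continuousWithinAt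
  exact hc.isOpen_inter_preimage h0 isOpen_Ioi

variable {F}

lemma X_fst_ne_zero {s : ℂ × ℂ × ℂ × ℂ} (hs : s ∈ F.dom) : (F.X s.2.2.1 (s.1, s.2.1)).1 ≠ 0 := by
  intro h
  have := hs.2
  simp [h] at this

lemma analyticOnNhd_field : AnalyticOnNhd ℂ F.field F.dom := by
  intro s hs
  have hX := F.analyticAt_X_state hs.1.1 hs.1.2.1
  have h1 : AnalyticAt ℂ (fun s : ℂ × ℂ × ℂ × ℂ => s.1) s := analyticAt_fst
  have h2 : AnalyticAt ℂ (fun s : ℂ × ℂ × ℂ × ℂ => s.2.2.2) s :=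
    (ContinuousLinearMap.snd ℂ ℂ ℂ ∘L .snd ℂ ℂ (ℂ × ℂ) ∘L .snd ℂ ℂ (ℂ × ℂ × ℂ)).analyticAt s
  have hX1 : AnalyticAt ℂ (fun s : ℂ × ℂ × ℂ × ℂ => (F.X s.2.2.1 (s.1, s.2.1)).1) s :=
    analyticAt_fst.comp hX
  have hX2 : AnalyticAt ℂ (fun s : ℂ × ℂ × ℂ × ℂ => (F.X s.2.2.1 (s.1, s.2.1)).2) s :=
    analyticAt_snd.comp hX
  exact (h2.mul h1).prod ((((h2.mul h1).mul hX2).div hX1 (X_fst_ne_zero hs)).prod analyticAt_const)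

lemma locLip_field : LocLip F.field F.dom := locLip_of_analyticOnNhd analyticOnNhd_field

variable {u v : ℝ → ℂ × ℂ × ℂ × ℂ} {T t : ℝ}

lemma param_eq (hu : IsSol F.field F.dom u T) (ht : t ∈ Icc 0 T) : (u t).2.2 = (u 0).2.2 :=
  eq_of_hasDerivWithinAt_zero (g := fun t => (u t).2.2)
    (fun s hs => (hu s hs).2.snd.snd) ht

/-- The equation `x' = c x` has constant `c`. This explicit formula lets the arrival on `{x = d}` at
time one be prescribed by the choice of `c`. -/
lemma fst_eq (hu : IsSol F.field F.dom u T) (ht : t ∈ Icc 0 T) :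
    (u t).1 = (u 0).1 * Complex.exp ((u 0).2.2.2 * t) := by
  set c := (u 0).2.2.2 with hc
  have h := eq_of_hasDerivWithinAt_zero (g := fun t => (u t).1 * Complex.exp (-(c * t))) (T := T)
    (fun s hs => by
      have h1 : HasDerivWithinAt (fun t => (u t).1) (c * (u s).1) (Icc 0 T) s := by
        have h := (ContinuousLinearMap.fst ℝ ℂ (ℂ × ℂ × ℂ)).hasFDerivAt.comp_hasDerivWithinAt s
          (hu s hs).2
        have he : (ContinuousLinearMap.fst ℝ ℂ (ℂ × ℂ × ℂ)) (F.field (u s)) = c * (u s).1 := by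
          simp [field, param_eq hu hs, hc]
        rwa [he] at h
      have h2 : HasDerivWithinAt (fun t : ℝ => Complex.exp (-(c * t)))
          (Complex.exp (-(c * s)) * (-(c * 1))) (Icc 0 T) s :=
        (((hasDerivAt_id s).ofReal_comp.const_mul c).neg.cexp).hasDerivWithinAt
      have h3 := h1.fun_mul h2
      rw [show c * (u s).1 * Complex.exp (-(c * s)) + (u s).1 * (Complex.exp (-(c * s)) * -(c * 1))
        = 0 by ring] at h3
      exact h3) ht
  simp only [Complex.ofReal_zero, mul_zero, neg_zero, Complex.exp_zero, mul_one] at h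
  rw [← h, mul_assoc, ← Complex.exp_add]
  simp

/-- The `x`-axis is invariant. -/
lemma snd_eq_zero (hu : IsSol F.field F.dom u T) {t₀ : ℝ} (ht₀ : t₀ ∈ Icc 0 T)
    (h0 : (u t₀).2.1 = 0) (ht : t ∈ Icc 0 T) : (u t).2.1 = 0 := by
  let J : ℂ × ℂ × ℂ × ℂ →L[ℝ] ℂ := .fst ℝ ℂ (ℂ × ℂ) ∘L .snd ℝ ℂ (ℂ × ℂ × ℂ)
  let π : ℂ × ℂ × ℂ × ℂ →L[ℝ] ℂ × ℂ × ℂ × ℂ :=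
    (ContinuousLinearMap.id ℝ ℂ).prodMap
      ((0 : ℂ →L[ℝ] ℂ).prodMap (ContinuousLinearMap.id ℝ (ℂ × ℂ)))
  have hJ : ∀ p, J p = p.2.1 := fun _ => rfl
  have hπ : ∀ p, π p = (p.1, 0, p.2.2) := fun _ => rfl
  refine hu.map_eq_zero_of_locLip locLip_field J π (fun p => by simp [hJ, hπ]) ?_ (C₀ := 1) ?_ ?_
    F.isOpen_dom ht₀ h0 t ht
  · intro p hp
    rw [hJ] at hp
    rw [hπ, ← hp]
  · intro p
    simp [hπ, hJ, Prod.norm_def]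
  · intro p hp hp0
    rw [hJ] at hp0 ⊢
    have hU := hp.1.1
    rw [hp0] at hU
    simp [field, hp0, F.X_snd_xAxis hU hp.1.2.1]

/-- Real states are invariant. -/
lemma isReal_of_isReal (hu : IsSol F.field F.dom u T) {x y ε c : ℝ}
    (h0 : u 0 = ((x : ℂ), (y : ℂ), (ε : ℂ), (c : ℂ))) (ht : t ∈ Icc 0 T) :
    ∃ a b : ℝ, u t = ((a : ℂ), (b : ℂ), (ε : ℂ), (c : ℂ)) := by
  let I := Complex.imCLM
  let R : ℂ →L[ℝ] ℂ := Complex.ofRealCLM ∘L Complex.reCLM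
  let J : ℂ × ℂ × ℂ × ℂ →L[ℝ] ℝ × ℝ × ℝ × ℝ := I.prodMap (I.prodMap (I.prodMap I))
  let π : ℂ × ℂ × ℂ × ℂ →L[ℝ] ℂ × ℂ × ℂ × ℂ := R.prodMap (R.prodMap (R.prodMap R))
  have hJ : ∀ p, J p = (p.1.im, p.2.1.im, p.2.2.1.im, p.2.2.2.im) := fun _ => rfl
  have hπ : ∀ p, π p = ((p.1.re : ℂ), (p.2.1.re : ℂ), (p.2.2.1.re : ℂ), (p.2.2.2.re : ℂ)) :=
    fun _ => rfl
  have hre : ∀ z : ℂ, z.im = 0 → (z.re : ℂ) = z := fun z hz => Complex.ext (by simp) (by simp [hz])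
  have h := hu.map_eq_zero_of_locLip locLip_field J π (fun p => by simp [hJ, hπ]) ?_ (C₀ := 1) ?_ ?_
    F.isOpen_dom (t₀ := 0) ⟨le_rfl, ht.1.trans ht.2⟩ (by simp [hJ, h0]) t ht
  · simp only [hJ, Prod.mk_eq_zero] at h
    have hp := param_eq hu ht
    refine ⟨(u t).1.re, (u t).2.1.re, ?_⟩
    rw [hre _ h.1, hre _ h.2.1]
    rw [h0] at hp
    rw [Prod.ext_iff, Prod.ext_iff]
    exact ⟨rfl, rfl, hp⟩
  · intro p hp
    simp only [hJ, Prod.mk_eq_zero] at hp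
    rw [hπ, hre _ hp.1, hre _ hp.2.1, hre _ hp.2.2.1, hre _ hp.2.2.2]
  · intro p
    have key : ∀ z : ℂ, ‖z - z.re‖ = ‖z.im‖ := fun z => by
      have : z - z.re = z.im * Complex.I := by
        rw [sub_eq_iff_eq_add, add_comm]; exact (Complex.re_add_im z).symm
      simp [this]
    simp [hπ, hJ, Prod.norm_def, key]
  · intro p hp hp0
    simp only [hJ, Prod.mk_eq_zero] at hp0
    obtain ⟨h1, h2, h3, h4⟩ := hp0
    have hU : toC (p.1.re, p.2.1.re) ∈ F.U := by
      simpa [toC, hre _ h1, hre _ h2] using hp.1.1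
    have hε : |p.2.2.1.re| < F.r := by
      have := hp.1.2.1
      rw [← hre _ h3, Complex.norm_real] at this
      exact this
    have hX := F.X_real hU hε
    simp only [toC, hre _ h1, hre _ h2, hre _ h3] at hX
    simp [hJ, field, Complex.div_im, Complex.mul_im, Complex.mul_re, hX, h1, h4]

end DeformedSaddle

namespace DeformedSaddle

variable {F : DeformedSaddle} {u : ℝ → ℂ × ℂ × ℂ × ℂ} {T t : ℝ}

/-- The open first quadrant is invariant. -/
lemma pos_of_pos (hu : IsSol F.field F.dom u T) {x y ε c : ℝ} (hx : 0 < x) (hy : 0 < y)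
    (h0 : u 0 = ((x : ℂ), (y : ℂ), (ε : ℂ), (c : ℂ))) (ht : t ∈ Icc 0 T) :
    ∃ a b : ℝ, 0 < a ∧ 0 < b ∧ u t = ((a : ℂ), (b : ℂ), (ε : ℂ), (c : ℂ)) := by
  obtain ⟨a, b, hab⟩ := isReal_of_isReal hu h0 ht
  refine ⟨a, b, ?_, ?_, hab⟩
  · have h := fst_eq hu ht
    rw [hab, h0] at h
    have h' : (a : ℂ) = ((x * Real.exp (c * t) : ℝ) : ℂ) := by push_cast; exact h
    rw [Complex.ofReal_injective h']
    positivity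
  -- If `y` lost its sign it would vanish at some time, and invariance of the `x`-axis would make it
  -- vanish at the start.
  · by_contra hb
    have hcont : ContinuousOn (fun s => (u s).2.1.re) (Icc 0 t) :=
      Complex.continuous_re.comp_continuousOn
        (hu.continuousOn.mono (Icc_subset_Icc_right ht.2)).snd.fst
    have h0' : (0 : ℝ) ∈ Icc ((u t).2.1.re) ((u 0).2.1.re) := by
      rw [hab, h0]
      exact ⟨by simpa using hb, by simpa using hy.le⟩
    obtain ⟨s, hs, hs0⟩ := intermediate_value_Icc' ht.1 hcont h0'
    have hsT : s ∈ Icc 0 T := ⟨hs.1, hs.2.trans ht.2⟩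
    obtain ⟨a', b', hab'⟩ := isReal_of_isReal hu h0 hsT
    have hz : (u s).2.1 = 0 := by
      simp only [hab', Complex.ofReal_re] at hs0
      simp [hab', hs0]
    have := snd_eq_zero hu hsT hz (t := 0) ⟨le_rfl, ht.1.trans ht.2⟩
    rw [h0] at this
    exact hy.ne' (by simpa using this)

/-- Along a real solution in the first quadrant the projected curve is tangent to `X_ε`, with a
factor of the sign of `c`. -/
lemma exists_tangent (hu : IsSol F.field F.dom u T) {x y ε c : ℝ} (hx : 0 < x) (hy : 0 < y)
    (h0 : u 0 = ((x : ℂ), (y : ℂ), (ε : ℂ), (c : ℂ))) :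
    ∃ g : ℝ → ℝ, ContinuousOn g (Icc 0 T) ∧ (∀ t ∈ Icc 0 T, 0 < g t) ∧
      ∀ t ∈ Icc 0 T, HasDerivWithinAt (fun t => ((u t).1, (u t).2.1))
        ((c * g t) • F.X ε ((u t).1, (u t).2.1)) (Icc 0 T) t := by
  have hε : ∀ t ∈ Icc 0 T, (u t).2.2 = ((ε : ℂ), (c : ℂ)) := fun t ht => by
    rw [param_eq hu ht, h0]
  have hX1 : ∀ t ∈ Icc 0 T, 0 < ((F.X ε ((u t).1, (u t).2.1)).1 / (u t).1).re ∧
      ((F.X ε ((u t).1, (u t).2.1)).1 / (u t).1).im = 0 := by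
    intro t ht
    have hd := (hu t ht).1
    have h1 := hd.2
    rw [hε t ht] at h1
    refine ⟨h1, ?_⟩
    obtain ⟨a, b, ha, hb, hab⟩ := pos_of_pos hu hx hy h0 ht
    rw [hab] at hd ⊢
    have hX := F.X_real (p := (a, b)) (ε := ε) hd.1.1 (by
      have := hd.1.2.1
      rwa [Complex.norm_real] at this)
    simp only [toC] at hX
    simp [Complex.div_im, hX.1]
  -- The rescaled field is `c x / X₁` times the original one. For real states `X₁ / x` is real, and
  -- the condition in `dom` makes it positive.
  refine ⟨fun t => (((F.X ε ((u t).1, (u t).2.1)).1 / (u t).1).re)⁻¹, ?_, ?_, ?_⟩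
  · refine ContinuousOn.inv₀ ?_ (fun t ht => (hX1 t ht).1.ne')
    intro t ht
    have h1 := (F.analyticAt_X_state (hu t ht).1.1.1 (hu t ht).1.1.2.1).continuousAt
    have h2 : ContinuousAt (fun s : ℂ × ℂ × ℂ × ℂ => ((F.X s.2.2.1 (s.1, s.2.1)).1 / s.1).re) (u t) :=
      Complex.continuous_re.continuousAt.comp (h1.fst.div continuousAt_fst (hu t ht).1.1.2.2)
    have h3 := h2.comp_continuousWithinAt (hu.continuousOn t ht)
    refine h3.congr (fun s hs => ?_) ?_
    · simp [Function.comp, hε s hs]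
    · simp [Function.comp, hε t ht]
  · exact fun t ht => inv_pos.2 (hX1 t ht).1
  · intro t ht
    have hd : HasDerivWithinAt (fun t => ((u t).1, (u t).2.1))
        ((F.field (u t)).1, (F.field (u t)).2.1) (Icc 0 T) t := by
      let L : ℂ × ℂ × ℂ × ℂ →L[ℝ] ℂ × ℂ := (ContinuousLinearMap.fst ℝ ℂ (ℂ × ℂ × ℂ)).prod
        (.fst ℝ ℂ (ℂ × ℂ) ∘L .snd ℝ ℂ (ℂ × ℂ × ℂ))
      exact L.hasFDerivAt.comp_hasDerivWithinAt t (hu t ht).2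
    convert hd using 1
    have hx0 := (hu t ht).1.1.2.2
    have hne := X_fst_ne_zero (hu t ht).1
    have e := hX1 t ht
    set q := (F.X ε ((u t).1, (u t).2.1)).1 / (u t).1 with hq
    have hqre : (q.re : ℂ) = q := Complex.ext (by simp) (by simp [e.2])
    rw [hε t ht] at hne
    have hk : (c : ℂ) * ((q.re)⁻¹ : ℝ) = c * (u t).1 / (F.X ε ((u t).1, (u t).2.1)).1 := by
      rw [Complex.ofReal_inv, hqre, hq, inv_div, mul_div_assoc]
    have hs : ∀ w : ℂ, (c * (q.re)⁻¹) • w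
        = c * (u t).1 / (F.X ε ((u t).1, (u t).2.1)).1 * w := fun w => by
      rw [← hk, Complex.real_smul]; push_cast; rfl
    refine Prod.ext ?_ ?_
    · change (c * (q.re)⁻¹) • (F.X ε ((u t).1, (u t).2.1)).1 = _
      rw [hs]
      simp only [field, hε t ht]
      field_simp
    · change (c * (q.re)⁻¹) • (F.X ε ((u t).1, (u t).2.1)).2 = _
      rw [hs]
      simp only [field, hε t ht]
      ring

/-- For `ε = 0` the function `f` is a first integral. -/
lemma f_const (hu : IsSol F.field F.dom u T) (h0 : (u 0).2.2.1 = 0) (ht : t ∈ Icc 0 T) :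
    F.f ((u t).1, (u t).2.1) = F.f ((u 0).1, (u 0).2.1) := by
  refine eq_of_hasDerivWithinAt_zero (g := fun t => F.f ((u t).1, (u t).2.1)) (fun s hs => ?_) ht
  have hd : HasDerivWithinAt (fun t => ((u t).1, (u t).2.1))
      ((F.field (u s)).1, (F.field (u s)).2.1) (Icc 0 T) s := by
    let L : ℂ × ℂ × ℂ × ℂ →L[ℝ] ℂ × ℂ := (ContinuousLinearMap.fst ℝ ℂ (ℂ × ℂ × ℂ)).prod
      (.fst ℝ ℂ (ℂ × ℂ) ∘L .snd ℝ ℂ (ℂ × ℂ × ℂ))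
    exact L.hasFDerivAt.comp_hasDerivWithinAt s (hu s hs).2
  have hf : HasFDerivAt F.f ((fderiv ℂ F.f ((u s).1, (u s).2.1)).restrictScalars ℝ)
      ((u s).1, (u s).2.1) :=
    (F.f_analytic _ (hu s hs).1.1.1).differentiableAt.hasFDerivAt.restrictScalars ℝ
  have h := hf.comp_hasDerivWithinAt s hd
  have hne := X_fst_ne_zero (hu s hs).1
  have hε : (u s).2.2.1 = 0 := by rw [param_eq hu hs, h0]
  rw [hε] at hne
  -- At `ε = 0` the velocity is a multiple of `(f_y, -f_x)`.
  have hz : (fderiv ℂ F.f ((u s).1, (u s).2.1)) ((F.field (u s)).1, (F.field (u s)).2.1) = 0 := by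
    have hlin : ∀ a b : ℂ, fderiv ℂ F.f ((u s).1, (u s).2.1) (a, b)
        = a * dx F.f ((u s).1, (u s).2.1) + b * dy F.f ((u s).1, (u s).2.1) := by
      intro a b
      have : ((a, b) : ℂ × ℂ) = a • ((1, 0) : ℂ × ℂ) + b • ((0, 1) : ℂ × ℂ) := by ext <;> simp
      rw [this, map_add, map_smul, map_smul]; rfl
    rw [hlin]
    simp only [X, zero_mul, add_zero] at hne
    simp only [field, hε, X, zero_mul, add_zero]
    field_simp
    ring
  have hz' : ((fderiv ℂ F.f ((u s).1, (u s).2.1)).restrictScalars ℝ)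
      ((F.field (u s)).1, (F.field (u s)).2.1) = 0 := hz
  rw [hz'] at h
  exact h

end DeformedSaddle

/-! ### Flow boxes along a separatrix. -/

namespace DeformedSaddle

variable {F : DeformedSaddle} {x₀ : ℝ}

lemma im_dy_eq_zero {p : ℝ × ℝ} (hp : toC p ∈ F.U) : (dy F.f (toC p)).im = 0 := by
  simpa [toC, dy] using im_fderiv_eq_zero F.isOpen_U F.f_analytic F.f_real hp (0, 1)

/-- On the part of the `x`-axis joining the saddle to the cross-section, `∂_y f` is positive. -/
lemma dy_xAxis_pos (hx : ∀ x : ℝ, 0 ≤ x → x ≤ x₀ → ((x : ℂ), (0 : ℂ)) ∈ F.U)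
    (hx_reg : ∀ x : ℝ, 0 < x → x ≤ x₀ → fderiv ℂ F.f ((x : ℂ), (0 : ℂ)) ≠ 0)
    {x : ℝ} (h0 : 0 < x) (hx0 : x ≤ x₀) :
    ∃ k : ℝ, 0 < k ∧ dy F.f ((x : ℂ), (0 : ℂ)) = k := by
  have him : ∀ y : ℝ, 0 ≤ y → y ≤ x₀ → (dy F.f ((y : ℂ), (0 : ℂ))).im = 0 := fun y h1 h2 => by
    have hU : toC (y, 0) ∈ F.U := by simpa [toC] using hx y h1 h2
    simpa [toC] using im_dy_eq_zero hU
  have hne : ∀ y : ℝ, 0 < y → y ≤ x₀ → (dy F.f ((y : ℂ), (0 : ℂ))).re ≠ 0 := by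
    intro y h1 h2 hre
    apply hx_reg y h1 h2
    have hz : dy F.f ((y : ℂ), (0 : ℂ)) = 0 := Complex.ext hre (him y h1.le h2)
    have hz' := F.dx_xAxis (hx y h1.le h2)
    ext
    · simpa [dx] using hz'
    · simpa [dy] using hz
  refine ⟨(dy F.f ((x : ℂ), (0 : ℂ))).re, ?_,
    Complex.ext (by simp) (by simpa using him x h0.le hx0)⟩
  by_contra hneg
  -- Near the origin `∂_y f` is about `eig * x > 0`. It has no zero on the arc, because `∂ₓ f`
  -- vanishes there and the points are regular, so it cannot change sign.
  have hev := F.eventually_X_fst (κ := F.eig / 2) (half_pos F.eig_pos)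
  have ht : Tendsto (fun y : ℝ => ((((y : ℂ), (0 : ℂ)), (0 : ℂ)) : (ℂ × ℂ) × ℂ)) (𝓝[>] 0) (𝓝 0) := by
    have : Continuous (fun y : ℝ => ((((y : ℂ), (0 : ℂ)), (0 : ℂ)) : (ℂ × ℂ) × ℂ)) := by fun_prop
    exact (this.tendsto' 0 0 (by simp)).mono_left nhdsWithin_le_nhds
  obtain ⟨y, hy, hyx⟩ := ((ht.eventually hev).and (Ioo_mem_nhdsGT h0)).exists
  have hypos : 0 < (dy F.f ((y : ℂ), (0 : ℂ))).re := by
    simp only [X, zero_mul, add_zero] at hy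
    have h1 := (Complex.abs_re_le_norm _).trans hy
    rw [Complex.norm_real, Real.norm_eq_abs, abs_of_pos hyx.1] at h1
    have h2 := (abs_le.1 h1).1
    simp only [Complex.sub_re, Complex.mul_re, Complex.ofReal_re, Complex.ofReal_im, mul_zero,
      sub_zero] at h2
    have := mul_pos F.eig_pos hyx.1
    linarith
  have hcont : ContinuousOn (fun s : ℝ => (dy F.f ((s : ℂ), (0 : ℂ))).re) (Icc y x) := by
    intro s hs
    have h1 : ContinuousAt (dy F.f) ((s : ℂ), (0 : ℂ)) :=
      (analyticAt_dy (F.f_analytic _ (hx s (hyx.1.le.trans hs.1) (hs.2.trans hx0)))).continuousAt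
    have h2 : ContinuousAt (fun s : ℝ => ((s : ℂ), (0 : ℂ))) s := by fun_prop
    exact (Complex.continuous_re.continuousAt.comp
      (ContinuousAt.comp (f := fun s : ℝ => ((s : ℂ), (0 : ℂ))) h1 h2)).continuousWithinAt
  obtain ⟨s, hs, hs0⟩ := intermediate_value_Icc' hyx.2.le hcont ⟨not_lt.1 hneg, hypos.le⟩
  exact hne s (hyx.1.trans_le hs.1) (hs.2.trans hx0) hs0

/-- The state moving along the `x`-axis from `x₀` to `d`. -/
def axisState (x₀ d : ℝ) (t : ℝ) : ℂ × ℂ × ℂ × ℂ :=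
  (((x₀ * Real.exp (Real.log (d / x₀) * t) : ℝ) : ℂ), 0, 0, ((Real.log (d / x₀) : ℝ) : ℂ))

lemma isSol_axisState {d : ℝ} (hd : 0 < d) (hdx : d ≤ x₀)
    (hx : ∀ x : ℝ, 0 ≤ x → x ≤ x₀ → ((x : ℂ), (0 : ℂ)) ∈ F.U)
    (hx_reg : ∀ x : ℝ, 0 < x → x ≤ x₀ → fderiv ℂ F.f ((x : ℂ), (0 : ℂ)) ≠ 0) :
    IsSol F.field F.dom (axisState x₀ d) 1 := by
  have hx₀ : 0 < x₀ := hd.trans_le hdx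
  set c := Real.log (d / x₀) with hc
  have hc0 : c ≤ 0 := Real.log_nonpos (by positivity) ((div_le_one hx₀).2 hdx)
  intro t ht
  set x := x₀ * Real.exp (c * t) with hxdef
  have hxpos : 0 < x := by positivity
  have hxle : x ≤ x₀ := by
    have : Real.exp (c * t) ≤ 1 := Real.exp_le_one_iff.2 (mul_nonpos_of_nonpos_of_nonneg hc0 ht.1)
    exact mul_le_of_le_one_right hx₀.le this
  obtain ⟨k, hk, hkx⟩ := dy_xAxis_pos hx hx_reg hxpos hxle
  have hst : axisState x₀ d t = ((x : ℂ), 0, 0, (c : ℂ)) := rfl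
  have hxU := hx x hxpos.le hxle
  have hr : ‖(0 : ℂ)‖ < F.r := by simpa using F.r_pos
  constructor
  · rw [hst]
    refine ⟨⟨hxU, hr, Complex.ofReal_ne_zero.2 hxpos.ne'⟩, ?_⟩
    simp only [X, zero_mul, add_zero, hkx]
    rw [← Complex.ofReal_div, Complex.ofReal_re]
    positivity
  · rw [hst]
    have hf : F.field ((x : ℂ), 0, 0, (c : ℂ)) = ((c : ℂ) * x, 0, 0, 0) := by
      simp [field, F.X_snd_xAxis hxU hr]
    rw [hf]
    have h1 : HasDerivAt (fun t : ℝ => ((x₀ * Real.exp (c * t) : ℝ) : ℂ))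
        ((x₀ * (Real.exp (c * t) * (c * 1)) : ℝ) : ℂ) t :=
      ((((hasDerivAt_id t).const_mul c).exp).const_mul x₀).ofReal_comp
    have h2 : ((x₀ * (Real.exp (c * t) * (c * 1)) : ℝ) : ℂ) = c * x := by
      rw [hxdef]; push_cast; ring
    rw [h2] at h1
    exact (h1.prodMk (hasDerivAt_const t ((0, 0, (c : ℂ)) : ℂ × ℂ × ℂ))).hasDerivWithinAt

lemma fderiv_f_xAxis {x : ℂ} (hx : (x, 0) ∈ F.U) (v : ℂ × ℂ) :
    fderiv ℂ F.f (x, 0) v = v.2 * dy F.f (x, 0) := by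
  have : v = v.1 • ((1, 0) : ℂ × ℂ) + v.2 • ((0, 1) : ℂ × ℂ) := by ext <;> simp
  conv_lhs => rw [this, map_add, map_smul, map_smul]
  have h := F.dx_xAxis hx
  simp only [dx] at h
  rw [h]
  simp [dy]

/-- The transition from a cross-section at `(x₀, 0)` to `{x = d}` along the `x`-axis, as an
analytic function `h` of the parameter `ε` and of the coordinate on the cross-section. -/
theorem exists_flowBox {d : ℝ} (hd : 0 < d) (hdx : d ≤ x₀)
    (hx : ∀ x : ℝ, 0 ≤ x → x ≤ x₀ → ((x : ℂ), (0 : ℂ)) ∈ F.U)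
    (hx_reg : ∀ x : ℝ, 0 < x → x ≤ x₀ → fderiv ℂ F.f ((x : ℂ), (0 : ℂ)) ≠ 0)
    (τ : CrossSection F ((x₀ : ℂ), (0 : ℂ))) :
    ∃ (h : ℂ × ℂ → ℂ) (k : ℝ), AnalyticAt ℂ h 0 ∧ 0 < k ∧
      (∀ v : ℂ × ℂ, fderiv ℂ h 0 v = k * v.2) ∧ (∀ᶠ ε in 𝓝 (0 : ℂ), h (ε, 0) = 0) ∧
      ∀ η > 0, ∀ᶠ q : ℂ × ℂ in 𝓝 0, ‖q.2‖ < τ.R ∧ ∃ u, IsSol F.field F.dom u 1 ∧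
        u 0 = ((τ.param q.2).1, (τ.param q.2).2, q.1, Complex.log (d / (τ.param q.2).1)) ∧
        u 1 = ((d : ℂ), h q, q.1, Complex.log (d / (τ.param q.2).1)) ∧
        ∀ t ∈ Icc (0 : ℝ) 1, dist (u t) (axisState x₀ d t) < η := by
  have hx₀ : 0 < x₀ := hd.trans_le hdx
  have hsol := isSol_axisState hd hdx hx hx_reg
  obtain ⟨g, hg, hev⟩ := hsol.hasFlow F.isOpen_dom analyticOnNhd_field zero_le_one
  have hb0 : axisState x₀ d 0 = ((x₀ : ℂ), 0, 0, ((Real.log (d / x₀) : ℝ) : ℂ)) := by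
    simp [axisState]
  -- The time component `log (d / x)` makes the solution arrive at `x = d` at time one from any
  -- point of the cross-section near its centre.
  set start : ℂ × ℂ → ℂ × ℂ × ℂ × ℂ := fun q =>
    ((τ.param q.2).1, (τ.param q.2).2, q.1, Complex.log (d / (τ.param q.2).1)) with hstart
  have hR0 : (0 : ℂ) ∈ ball (0 : ℂ) τ.R := by simpa using τ.R_pos
  have hτa : AnalyticAt ℂ (fun q : ℂ × ℂ => τ.param q.2) 0 :=
    AnalyticAt.comp (g := τ.param) (f := fun q : ℂ × ℂ => q.2) (τ.analytic _ hR0) analyticAt_snd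
  have hτ1 : AnalyticAt ℂ (fun q : ℂ × ℂ => (τ.param q.2).1) 0 := analyticAt_fst.comp hτa
  have hτ10 : (τ.param (0 : ℂ × ℂ).2).1 = x₀ := by simp [τ.param_zero]
  have hx₀C : (x₀ : ℂ) ≠ 0 := by exact_mod_cast hx₀.ne'
  have hτ2 : AnalyticAt ℂ (fun q : ℂ × ℂ => (τ.param q.2).2) 0 := analyticAt_snd.comp hτa
  have hstarta : AnalyticAt ℂ start 0 := by
    refine hτ1.prod (hτ2.prod (analyticAt_fst.prod (AnalyticAt.clog ?_ ?_)))
    · exact analyticAt_const.div hτ1 (by rw [hτ10]; exact hx₀C)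
    · rw [hτ10, ← Complex.ofReal_div]
      exact Complex.ofReal_mem_slitPlane.2 (by positivity)
  have hstart0 : start 0 = axisState x₀ d 0 := by
    rw [hb0]
    simp only [hstart, Prod.snd_zero, τ.param_zero, Prod.fst_zero, ← Complex.ofReal_div,
      Complex.ofReal_log (by positivity : 0 ≤ d / x₀)]
  have hga : AnalyticAt ℂ (fun q => g (start q)) 0 :=
    AnalyticAt.comp (by rw [hstart0]; exact hg) hstarta
  set h : ℂ × ℂ → ℂ := fun q => (g (start q)).2.1 with hh
  have hha : AnalyticAt ℂ h 0 := analyticAt_fst.comp (analyticAt_snd.comp hga)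
  have htend : Tendsto start (𝓝 0) (𝓝 (axisState x₀ d 0)) := by
    rw [← hstart0]; exact hstarta.continuousAt
  have hball : ∀ᶠ q : ℂ × ℂ in 𝓝 0, ‖q.2‖ < τ.R := by
    have : Continuous fun q : ℂ × ℂ => ‖q.2‖ := by fun_prop
    exact this.continuousAt.eventually (Iio_mem_nhds (by simpa using τ.R_pos))
  have hmain : ∀ η > 0, ∀ᶠ q : ℂ × ℂ in 𝓝 0, ‖q.2‖ < τ.R ∧ ∃ u, IsSol F.field F.dom u 1 ∧
        u 0 = start q ∧ u 1 = ((d : ℂ), h q, q.1, Complex.log (d / (τ.param q.2).1)) ∧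
        ∀ t ∈ Icc (0 : ℝ) 1, dist (u t) (axisState x₀ d t) < η := by
    intro η hη
    filter_upwards [hball, htend.eventually (hev η hη),
      hτ1.continuousAt.eventually_ne (by rw [hτ10]; exact hx₀C)] with q hq1 hq2 hq3
    obtain ⟨u, hu, hu0, hu1, hud⟩ := hq2
    refine ⟨hq1, u, hu, hu0, ?_, hud⟩
    have e1 := param_eq hu (t := 1) ⟨zero_le_one, le_rfl⟩
    have e2 := fst_eq hu (t := 1) ⟨zero_le_one, le_rfl⟩
    rw [hu0] at e1 e2
    have hne : (d : ℂ) / (τ.param q.2).1 ≠ 0 := div_ne_zero (by exact_mod_cast hd.ne') hq3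
    simp only [hstart, Complex.ofReal_one, mul_one, Complex.exp_log hne] at e2
    rw [mul_div_cancel₀ _ hq3] at e2
    refine Prod.ext e2 (Prod.ext ?_ e1)
    rw [hu1]
  have h0 : ∀ᶠ ε in 𝓝 (0 : ℂ), h (ε, 0) = 0 := by
    have ht : Tendsto (fun ε : ℂ => ((ε, 0) : ℂ × ℂ)) (𝓝 0) (𝓝 0) := by
      have : Continuous fun ε : ℂ => ((ε, 0) : ℂ × ℂ) := by fun_prop
      exact this.tendsto 0
    filter_upwards [ht.eventually (hmain 1 one_pos)] with ε hε
    obtain ⟨-, u, hu, hu0, hu1, -⟩ := hε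
    have := snd_eq_zero hu (t₀ := 0) (t := 1) ⟨le_rfl, zero_le_one⟩
      (by rw [hu0]; simp [hstart, τ.param_zero]) ⟨zero_le_one, le_rfl⟩
    rwa [hu1] at this
  -- At `ε = 0` the transition preserves `f`, and `f` is the coordinate on the cross-section.
  -- Differentiating gives `k = 1 / ∂_y f (d, 0)`.
  have hf : ∀ᶠ w in 𝓝 (0 : ℂ), F.f ((d : ℂ), h (0, w)) = w := by
    have ht : Tendsto (fun w : ℂ => ((0, w) : ℂ × ℂ)) (𝓝 0) (𝓝 0) := by
      have : Continuous fun w : ℂ => ((0, w) : ℂ × ℂ) := by fun_prop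
      exact this.tendsto 0
    filter_upwards [ht.eventually (hmain 1 one_pos)] with w hw
    obtain ⟨hwR, u, hu, hu0, hu1, -⟩ := hw
    have := f_const hu (t := 1) (by rw [hu0]) ⟨zero_le_one, le_rfl⟩
    rw [hu1, hu0] at this
    exact this.trans (τ.f_param w (by simpa using hwR))
  obtain ⟨k, hk, hkd⟩ := dy_xAxis_pos hx hx_reg hd hdx
  refine ⟨h, k⁻¹, hha, inv_pos.2 hk, ?_, h0, hmain⟩
  have hhd := hha.differentiableAt.hasFDerivAt
  have h00 : h 0 = 0 := h0.self_of_nhds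
  have hA : fderiv ℂ h 0 (1, 0) = 0 := by
    have hl : HasDerivAt (fun ε : ℂ => ((ε, 0) : ℂ × ℂ)) (1, 0) 0 :=
      (hasDerivAt_id (0 : ℂ)).prodMk (hasDerivAt_const _ _)
    have h1 := HasFDerivAt.comp_hasDerivAt (f := fun ε : ℂ => ((ε, 0) : ℂ × ℂ)) (0 : ℂ) hhd hl
    exact (h1.congr_of_eventuallyEq (f₁ := fun _ => (0 : ℂ))
      (h0.mono fun ε hε => hε.symm)).unique (hasDerivAt_const _ _)
  have hB : fderiv ℂ h 0 (0, 1) = ((k⁻¹ : ℝ) : ℂ) := by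
    have hl : HasDerivAt (fun w : ℂ => ((0, w) : ℂ × ℂ)) (0, 1) 0 :=
      (hasDerivAt_const _ _).prodMk (hasDerivAt_id (0 : ℂ))
    have h1 := HasFDerivAt.comp_hasDerivAt (f := fun w : ℂ => ((0, w) : ℂ × ℂ)) (0 : ℂ) hhd hl
    have h2 : HasDerivAt (fun w : ℂ => ((d : ℂ), h (0, w))) (0, fderiv ℂ h 0 (0, 1)) 0 :=
      (hasDerivAt_const _ _).prodMk h1
    have hdU := hx d hd.le hdx
    have h3 : HasFDerivAt F.f (fderiv ℂ F.f ((d : ℂ), (0 : ℂ)))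
        ((fun w : ℂ => ((d : ℂ), h (0, w))) 0) := by
      have e : (fun w : ℂ => ((d : ℂ), h (0, w))) 0 = ((d : ℂ), (0 : ℂ)) := Prod.ext rfl h00
      rw [e]
      exact (F.f_analytic _ hdU).differentiableAt.hasFDerivAt
    have h4 := (h3.comp_hasDerivAt (0 : ℂ) h2).congr_of_eventuallyEq (f₁ := fun w => w)
      (hf.mono fun w hw => hw.symm)
    have h5 := h4.unique (hasDerivAt_id' (0 : ℂ))
    rw [fderiv_f_xAxis hdU, hkd] at h5
    have hkC : (k : ℂ) ≠ 0 := by exact_mod_cast hk.ne'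
    rw [Complex.ofReal_inv]
    exact eq_inv_of_mul_eq_one_left h5
  intro v
  have : v = v.1 • ((1, 0) : ℂ × ℂ) + v.2 • ((0, 1) : ℂ × ℂ) := by ext <;> simp
  conv_lhs => rw [this, map_add, map_smul, map_smul, hA, hB]
  simp [mul_comm]

/-- A function that vanishes for `w = 0`, with derivative `k dw` at the origin, is comparable to
`k w`. -/
lemma eventually_norm_sub_le {h : ℂ × ℂ → ℂ} {k : ℝ} (hh : AnalyticAt ℂ h 0)
    (hd : ∀ v : ℂ × ℂ, fderiv ℂ h 0 v = k * v.2) (h0 : ∀ᶠ ε in 𝓝 (0 : ℂ), h (ε, 0) = 0)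
    {κ : ℝ} (hκ : 0 < κ) : ∀ᶠ q : ℂ × ℂ in 𝓝 0, ‖h q - k * q.2‖ ≤ κ * ‖q.2‖ := by
  -- Comparing `(ε, w)` with `(ε, 0)`, where `h` vanishes, makes the error relative to `|w|`,
  -- uniformly in `ε`.
  have hlo := hh.hasStrictFDerivAt.isLittleO.def hκ
  have ht : Tendsto (fun q : ℂ × ℂ => (q, ((q.1, 0) : ℂ × ℂ))) (𝓝 0) (𝓝 (0, 0)) := by
    have : Continuous fun q : ℂ × ℂ => (q, ((q.1, 0) : ℂ × ℂ)) := by fun_prop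
    exact this.tendsto 0
  have ht1 : Tendsto (fun q : ℂ × ℂ => q.1) (𝓝 0) (𝓝 0) := continuous_fst.tendsto 0
  filter_upwards [ht.eventually hlo, ht1.eventually h0] with q hq hq0
  have hsub : q - (q.1, 0) = (0, q.2) := by ext <;> simp
  simp only [hsub, hd, hq0, sub_zero] at hq
  simpa [Prod.norm_def] using hq

/-- The positive half of a cross-section lies in the first quadrant. -/
lemma eventually_param_pos (hx : ∀ x : ℝ, 0 ≤ x → x ≤ x₀ → ((x : ℂ), (0 : ℂ)) ∈ F.U)
    (hx_reg : ∀ x : ℝ, 0 < x → x ≤ x₀ → fderiv ℂ F.f ((x : ℂ), (0 : ℂ)) ≠ 0) (hx₀ : 0 < x₀)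
    (τ : CrossSection F ((x₀ : ℂ), (0 : ℂ))) :
    ∀ᶠ w : ℝ in 𝓝 0, 0 < w → ∃ a b : ℝ, 0 < a ∧ 0 < b ∧ τ.param w = ((a : ℂ), (b : ℂ)) := by
  obtain ⟨k, hk, hkd⟩ := dy_xAxis_pos hx hx_reg hx₀ le_rfl
  have hR0 : (0 : ℂ) ∈ ball (0 : ℂ) τ.R := by simpa using τ.R_pos
  have hU := hx x₀ hx₀.le le_rfl
  have hτd : HasDerivAt τ.param (deriv τ.param 0) 0 :=
    (τ.analytic _ hR0).differentiableAt.hasDerivAt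
  have hf : HasFDerivAt F.f (fderiv ℂ F.f ((x₀ : ℂ), (0 : ℂ))) (τ.param 0) := by
    rw [τ.param_zero]
    exact (F.f_analytic _ hU).differentiableAt.hasFDerivAt
  -- Differentiating `f (τ w) = w` at the centre shows that the second coordinate of `τ` has
  -- derivative `1 / ∂_y f > 0`.
  have h1 := (hf.comp_hasDerivAt (0 : ℂ) hτd).congr_of_eventuallyEq (f₁ := fun w => w)
    (by filter_upwards [isOpen_ball.mem_nhds hR0] with w hw using (τ.f_param w hw).symm)
  have h2 := h1.unique (hasDerivAt_id' (0 : ℂ))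
  rw [fderiv_f_xAxis hU, hkd] at h2
  have hkC : (k : ℂ) ≠ 0 := by exact_mod_cast hk.ne'
  have hd2 : (deriv τ.param 0).2 = ((k⁻¹ : ℝ) : ℂ) := by
    rw [Complex.ofReal_inv]
    exact eq_inv_of_mul_eq_one_left h2
  have h3 : HasDerivAt (fun w => (τ.param w).2) ((k⁻¹ : ℝ) : ℂ) 0 := by
    rw [← hd2]
    exact (ContinuousLinearMap.snd ℂ ℂ ℂ).hasFDerivAt.comp_hasDerivAt (0 : ℂ) hτd
  have h4 := (hasDerivAt_iff_isLittleO.1 h3).def (c := k⁻¹ / 2) (by positivity)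
  have hc1 : ContinuousAt (fun w : ℂ => (τ.param w).1.re) 0 :=
    Complex.continuous_re.continuousAt.comp (τ.analytic _ hR0).continuousAt.fst
  have h5 := hc1.eventually (Ioi_mem_nhds (a := 0) (by simpa [τ.param_zero] using hx₀))
  have ht : Tendsto (fun w : ℝ => (w : ℂ)) (𝓝 0) (𝓝 0) := Complex.continuous_ofReal.tendsto' _ _ rfl
  filter_upwards [ht.eventually h4, ht.eventually h5,
    ht.eventually (isOpen_ball.mem_nhds hR0)] with w hw4 hw5 hwR hw
  have hreal := τ.real w (by simpa using hwR)
  refine ⟨(τ.param w).1.re, (τ.param w).2.re, hw5, ?_,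
    Prod.ext (Complex.ext rfl (by simpa using hreal.1)) (Complex.ext rfl (by simpa using hreal.2))⟩
  simp only [τ.param_zero, sub_zero, smul_eq_mul, Complex.norm_real, Real.norm_eq_abs,
    abs_of_pos hw] at hw4
  have h6 := (abs_le.1 ((Complex.abs_re_le_norm _).trans hw4)).1
  rw [← Complex.ofReal_mul, Complex.sub_re, Complex.ofReal_re] at h6
  have : 0 < k⁻¹ * w := mul_pos (inv_pos.2 hk) hw
  nlinarith

end DeformedSaddle

lemma IsSol.mono {E : Type*} [NormedAddCommGroup E] [NormedSpace ℝ E] {V : E → E} {W W' : Set E}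
    {u : ℝ → E} {T : ℝ} (h : IsSol V W u T) (hW : ∀ t ∈ Icc 0 T, u t ∈ W') :
    IsSol V W' u T := fun t ht => ⟨hW t ht, (h t ht).2⟩

/-! ### The passage near the saddle for complex times. -/

namespace DeformedSaddle

variable (F : DeformedSaddle)

/-- The punctured polydisc `{0 < |x| < δ, |y| < δ, |ε| < δ}` of states. -/
def saddleBox (δ : ℝ) : Set (ℂ × ℂ × ℂ × ℂ) :=
  {s | (‖s.1‖ < δ ∧ ‖s.2.1‖ < δ ∧ ‖s.2.2.1‖ < δ) ∧ s.1 ≠ 0}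

lemma isOpen_saddleBox (δ : ℝ) : IsOpen (saddleBox δ) := by
  refine IsOpen.inter (IsOpen.inter ?_ (IsOpen.inter ?_ ?_)) ?_
  · exact isOpen_lt (f := fun s : ℂ × ℂ × ℂ × ℂ => ‖s.1‖) (by fun_prop) continuous_const
  · exact isOpen_lt (f := fun s : ℂ × ℂ × ℂ × ℂ => ‖s.2.1‖) (by fun_prop) continuous_const
  · exact isOpen_lt (f := fun s : ℂ × ℂ × ℂ × ℂ => ‖s.2.2.1‖) (by fun_prop) continuous_const
  · exact isOpen_ne_fun (f := fun s : ℂ × ℂ × ℂ × ℂ => s.1) (by fun_prop) continuous_const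

/-- In the box of size `δ` the field is close to the linear saddle `(x, -y)`. -/
def IsSaddleRadius (δ : ℝ) : Prop :=
  0 < δ ∧ saddleBox δ ⊆ F.dom ∧ ∀ s ∈ saddleBox δ,
    ‖s.1 * (F.X s.2.2.1 (s.1, s.2.1)).2 / (F.X s.2.2.1 (s.1, s.2.1)).1 + s.2.1‖ ≤ ‖s.2.1‖ / 4

/-- With both components of `X` within a tenth of the eigenvalue of the linear saddle, the relative
error of the slope is at most `(2/10) / (9/10) = 2/9`, which is below `1/4`. -/
lemma eventually_isSaddleRadius : ∀ᶠ δ in 𝓝[>] (0 : ℝ), F.IsSaddleRadius δ := by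
  have hl := F.eig_pos
  have h1 := F.eventually_X_fst (κ := F.eig / 10) (by positivity)
  have h2 := F.eventually_X_snd (κ := F.eig / 10) (by positivity)
  have hU : ∀ᶠ q : (ℂ × ℂ) × ℂ in 𝓝 0, q.1 ∈ F.U :=
    (continuous_fst.tendsto (0 : (ℂ × ℂ) × ℂ)).eventually (F.isOpen_U.mem_nhds F.zero_mem)
  have hr : ∀ᶠ q : (ℂ × ℂ) × ℂ in 𝓝 0, ‖q.2‖ < F.r := by
    have : Continuous fun q : (ℂ × ℂ) × ℂ => ‖q.2‖ := by fun_prop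
    exact this.continuousAt.eventually (Iio_mem_nhds (by simpa using F.r_pos))
  obtain ⟨δ₀, hδ₀, hball⟩ := Metric.eventually_nhds_iff.1 ((h1.and h2).and (hU.and hr))
  filter_upwards [Ioo_mem_nhdsGT hδ₀] with δ hδ
  have hin : ∀ s ∈ saddleBox δ, dist (((s.1, s.2.1), s.2.2.1) : (ℂ × ℂ) × ℂ) 0 < δ₀ := by
    intro s hs
    simp only [dist_zero_right, Prod.norm_def, max_lt_iff]
    exact ⟨⟨hs.1.1.trans hδ.2, hs.1.2.1.trans hδ.2⟩, hs.1.2.2.trans hδ.2⟩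
  refine ⟨hδ.1, ?_, ?_⟩
  · intro s hs
    obtain ⟨⟨e1, -⟩, e3, e4⟩ := hball (hin s hs)
    refine ⟨⟨e3, e4, hs.2⟩, ?_⟩
    simp only at e1
    have hx := norm_pos_iff.2 hs.2
    have e5 : ‖(F.X s.2.2.1 (s.1, s.2.1)).1 / s.1 - F.eig‖ ≤ F.eig / 10 := by
      rw [div_sub' hs.2, norm_div, div_le_iff₀ hx, mul_comm s.1]
      exact e1
    have e6 := (abs_le.1 ((Complex.abs_re_le_norm _).trans e5)).1
    rw [Complex.sub_re, Complex.ofReal_re] at e6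
    linarith
  · intro s hs
    obtain ⟨⟨e1, e2⟩, -, -⟩ := hball (hin s hs)
    simp only at e1 e2
    set A := (F.X s.2.2.1 (s.1, s.2.1)).1 with hA
    set B := (F.X s.2.2.1 (s.1, s.2.1)).2 with hB
    have hx := norm_pos_iff.2 hs.2
    have hAn : 9 / 10 * F.eig * ‖s.1‖ ≤ ‖A‖ := by
      have e5 := norm_sub_norm_le ((F.eig : ℂ) * s.1) A
      rw [norm_sub_rev, norm_mul, Complex.norm_real, Real.norm_eq_abs, abs_of_pos hl] at e5
      linarith
    have hApos : 0 < ‖A‖ := lt_of_lt_of_le (by positivity) hAn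
    have hA0 : A ≠ 0 := norm_pos_iff.1 hApos
    have e7 : s.1 * B / A + s.2.1 = (s.1 * (B + F.eig * s.2.1) + s.2.1 * (A - F.eig * s.1)) / A := by
      field_simp
      ring
    rw [e7, norm_div, div_le_iff₀ hApos]
    calc ‖s.1 * (B + F.eig * s.2.1) + s.2.1 * (A - F.eig * s.1)‖
        ≤ ‖s.1‖ * (F.eig / 10 * ‖s.2.1‖) + ‖s.2.1‖ * (F.eig / 10 * ‖s.1‖) := by
          refine (norm_add_le _ _).trans ?_
          rw [norm_mul, norm_mul]
          gcongr
      _ = ‖s.2.1‖ / 4 * (8 / 10 * F.eig * ‖s.1‖) := by ring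
      _ ≤ ‖s.2.1‖ / 4 * ‖A‖ := by
          refine mul_le_mul_of_nonneg_left (le_trans ?_ hAn) (by positivity)
          have := mul_pos hl hx
          nlinarith

variable {F} {δ : ℝ}

/-- In the saddle box, `|y|` decays along the solutions for complex times `c` with
`|Im c| ≤ Re c`. -/
lemma norm_snd_le (hδ : F.IsSaddleRadius δ) {u : ℝ → ℂ × ℂ × ℂ × ℂ} {T : ℝ}
    (hu : IsSol F.field (saddleBox δ) u T) (hc : |(u 0).2.2.2.im| ≤ (u 0).2.2.2.re) {t : ℝ}
    (ht : t ∈ Icc 0 T) : ‖(u t).2.1‖ ^ 2 * Real.exp ((u 0).2.2.2.re * t) ≤ ‖(u 0).2.1‖ ^ 2 := by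
  set c := (u 0).2.2.2 with hcdef
  have hdom : IsSol F.field F.dom u T := hu.mono fun t ht => hδ.2.1 (hu t ht).1
  have hy : ∀ s ∈ Icc 0 T, HasDerivWithinAt (fun s => (u s).2.1) (F.field (u s)).2.1 (Icc 0 T) s := by
    intro s hs
    exact (ContinuousLinearMap.fst ℝ ℂ (ℂ × ℂ) ∘L
      .snd ℝ ℂ (ℂ × ℂ × ℂ)).hasFDerivAt.comp_hasDerivWithinAt s (hu s hs).2
  have hexp : ∀ s : ℝ, HasDerivAt (fun s : ℝ => Real.exp (c.re * s)) (Real.exp (c.re * s) * (c.re * 1)) s :=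
    fun s => ((hasDerivAt_id s).const_mul c.re).exp
  have hN : ∀ s ∈ Icc 0 T, HasDerivWithinAt (fun s => ‖(u s).2.1‖ ^ 2 * Real.exp (c.re * s))
      (2 * inner ℝ (u s).2.1 (F.field (u s)).2.1 * Real.exp (c.re * s)
        + ‖(u s).2.1‖ ^ 2 * (Real.exp (c.re * s) * (c.re * 1))) (Icc 0 T) s := fun s hs =>
    (hy s hs).norm_sq.fun_mul (hexp s).hasDerivWithinAt
  have hle : ∀ s ∈ Icc 0 T, 2 * inner ℝ (u s).2.1 (F.field (u s)).2.1 * Real.exp (c.re * s)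
        + ‖(u s).2.1‖ ^ 2 * (Real.exp (c.re * s) * (c.re * 1)) ≤ 0 := by
    intro s hs
    set y := (u s).2.1 with hydef
    set w := (u s).1 * (F.X (u s).2.2.1 ((u s).1, (u s).2.1)).2
      / (F.X (u s).2.2.1 ((u s).1, (u s).2.1)).1 + y with hw
    have hwle : ‖w‖ ≤ ‖y‖ / 4 := hδ.2.2 _ (hu s hs).1
    have hfield : (F.field (u s)).2.1 = c * (w - y) := by
      have hcs : (u s).2.2.2 = c := by rw [param_eq hdom hs]
      simp only [field, hcs, hw]
      ring
    -- The sector condition lets `Re c` dominate `|c|`: the error contributes at most `|c| |y|² / 4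
    -- ≤ Re c |y|² / 2`, half of the decay coming from `-c y`.
    have hcn : ‖c‖ ≤ 2 * c.re := (Complex.norm_le_abs_re_add_abs_im c).trans (by
      have : 0 ≤ c.re := (abs_nonneg _).trans hc
      rw [abs_of_nonneg this]; linarith)
    have hinner : inner ℝ y (c * (w - y)) ≤ -(c.re / 2) * ‖y‖ ^ 2 := by
      have e1 : inner ℝ y (c * (w - y)) = inner ℝ y (c * w) - c.re * ‖y‖ ^ 2 := by
        rw [mul_sub, inner_sub_right]
        congr 1
        rw [Complex.inner, ← Complex.normSq_eq_norm_sq, mul_assoc,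
          Complex.mul_conj, Complex.re_mul_ofReal]
      have e2 : inner ℝ y (c * w) ≤ ‖y‖ * (‖c‖ * ‖w‖) := by
        rw [← norm_mul]; exact real_inner_le_norm _ _
      have e3 : ‖y‖ * (‖c‖ * ‖w‖) ≤ ‖y‖ * (2 * c.re * (‖y‖ / 4)) := by
        have : 0 ≤ c.re := (abs_nonneg _).trans hc
        gcongr
      rw [e1]
      nlinarith
    rw [hfield]
    have hE := Real.exp_pos (c.re * s)
    nlinarith [mul_le_mul_of_nonneg_right hinner hE.le]
  have hanti : AntitoneOn (fun s => ‖(u s).2.1‖ ^ 2 * Real.exp (c.re * s)) (Icc 0 T) :=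
    antitoneOn_of_hasDerivWithinAt_nonpos (convex_Icc 0 T)
      (fun s hs => (hN s hs).continuousWithinAt)
      (fun s hs => (hN s (interior_subset hs)).mono interior_subset)
      (fun s hs => hle s (interior_subset hs))
  have := hanti ⟨le_rfl, ht.1.trans ht.2⟩ ht ht.1
  simpa using this

/-- The passage near the saddle from `(e^ξ, d)` to `{x = d}`, for complex `ξ`. -/
theorem exists_saddle_passage (hδ : F.IsSaddleRadius δ) {d : ℝ} (hd : 0 < d) (hdδ : d < δ)
    {ε ξ : ℂ} (hε : ‖ε‖ < δ) (hξ : |ξ.im| < Real.log d - ξ.re) :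
    ∃ u, IsSol F.field F.dom u 1 ∧ u 0 = (Complex.exp ξ, (d : ℂ), ε, (Real.log d : ℂ) - ξ) ∧
      (u 1).1 = d ∧ ‖(u 1).2.1‖ ≤ d * Real.exp (-(Real.log d - ξ.re) / 2) ∧
      ∀ t ∈ Icc (0 : ℝ) 1, ‖(u t).1‖ ≤ d ∧ ‖(u t).2.1‖ ≤ d := by
  set c : ℂ := (Real.log d : ℂ) - ξ with hc
  have hcre : c.re = Real.log d - ξ.re := by simp [hc]
  have hcim : |c.im| = |ξ.im| := by simp [hc]
  have hcpos : 0 < c.re := by rw [hcre]; exact (abs_nonneg _).trans_lt hξ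
  have hcle : |c.im| ≤ c.re := by rw [hcim, hcre]; exact hξ.le
  set p : ℂ × ℂ × ℂ × ℂ := (Complex.exp ξ, (d : ℂ), ε, c) with hp
  have hdexp : ‖Complex.exp ξ‖ * Real.exp c.re = d := by
    rw [Complex.norm_exp, ← Real.exp_add, hcre, add_sub_cancel, Real.exp_log hd]
  have hbounds : ∀ T ∈ Icc (0 : ℝ) 1, ∀ u, IsSol F.field (saddleBox δ) u T → u 0 = p →
      ∀ t ∈ Icc 0 T, (‖Complex.exp ξ‖ ≤ ‖(u t).1‖ ∧ ‖(u t).1‖ ≤ d) ∧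
        ‖(u t).2.1‖ ≤ d * Real.exp (-c.re * t / 2) := by
    intro T hT u hu hu0 t ht
    have hdom : IsSol F.field F.dom u T := hu.mono fun t ht => hδ.2.1 (hu t ht).1
    have ht1 : t ≤ 1 := ht.2.trans hT.2
    have hx := fst_eq hdom ht
    rw [hu0] at hx
    have hxn : ‖(u t).1‖ = ‖Complex.exp ξ‖ * Real.exp (c.re * t) := by
      rw [hx, norm_mul]
      congr 1
      rw [Complex.norm_exp]
      simp [hp]
    have hy := norm_snd_le hδ hu (by rw [hu0]; exact hcle) ht
    rw [hu0] at hy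
    refine ⟨⟨?_, ?_⟩, ?_⟩
    · rw [hxn]
      exact le_mul_of_one_le_right (norm_nonneg _)
        (Real.one_le_exp (mul_nonneg hcpos.le ht.1))
    · rw [hxn, ← hdexp]
      gcongr
      nlinarith
    · refine le_of_sq_le_sq ?_ (by positivity)
      have hE : (d * Real.exp (-c.re * t / 2)) ^ 2 * Real.exp (c.re * t) = d ^ 2 := by
        rw [mul_pow, ← Real.exp_nat_mul, mul_assoc, ← Real.exp_add]
        have : ((2 : ℕ) : ℝ) * (-c.re * t / 2) + c.re * t = 0 := by push_cast; ring
        rw [this]; simp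
      have hy' : ‖(u t).2.1‖ ^ 2 * Real.exp (c.re * t) ≤ d ^ 2 := by
        simpa [hp, abs_of_pos hd] using hy
      rw [← hE] at hy'
      exact le_of_mul_le_mul_right hy' (Real.exp_pos _)
  -- The lower bound on `|x|`, valid since `|x|` grows when `Re c > 0`, keeps `K` away from the
  -- puncture `x = 0` and makes it a compact part of the box.
  set K : Set (ℂ × ℂ × ℂ × ℂ) :=
    (closedBall (0 : ℂ) d ∩ {x | ‖Complex.exp ξ‖ ≤ ‖x‖}) ×ˢ (closedBall (0 : ℂ) d ×ˢ {(ε, c)}) with hK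
  have hKc : IsCompact K :=
    ((isCompact_closedBall _ _).inter_right (isClosed_le continuous_const continuous_norm)).prod
      ((isCompact_closedBall _ _).prod isCompact_singleton)
  have hKW : K ⊆ saddleBox δ := by
    rintro s ⟨⟨h1, h2⟩, h3, h4⟩
    have h4' : s.2.2 = (ε, c) := h4
    rw [mem_closedBall_zero_iff] at h1 h3
    refine ⟨⟨h1.trans_lt hdδ, h3.trans_lt hdδ, by rw [h4']; exact hε⟩, ?_⟩
    refine norm_pos_iff.1 (lt_of_lt_of_le ?_ h2)
    exact norm_pos_iff.2 (Complex.exp_ne_zero ξ)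
  have hbound1 : ∀ T ∈ Icc (0 : ℝ) 1, ∀ u, IsSol F.field (saddleBox δ) u T → u 0 = p →
      ∀ t ∈ Icc 0 T, ‖(u t).2.1‖ ≤ d := by
    intro T hT u hu hu0 t ht
    refine (hbounds T hT u hu hu0 t ht).2.trans (mul_le_of_le_one_right hd.le ?_)
    rw [Real.exp_le_one_iff]
    have := mul_nonneg hcpos.le ht.1
    linarith
  obtain ⟨u, hu, hu0⟩ := exists_isSol_of_compact (K := K) (p := p) (T := 1) (isOpen_saddleBox δ)
    (analyticOnNhd_field.mono hδ.2.1) hKc hKW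
    (by
      refine ⟨⟨?_, le_refl ‖Complex.exp ξ‖⟩, ?_, rfl⟩
      · rw [mem_closedBall_zero_iff, ← hdexp]
        exact le_mul_of_one_le_right (norm_nonneg _) (Real.one_le_exp hcpos.le)
      · simp [hp, abs_of_pos hd])
    zero_le_one
    (by
      intro T hT u hu hu0
      have hTT : T ∈ Icc 0 T := ⟨hT.1, le_rfl⟩
      obtain ⟨⟨h1, h2⟩, -⟩ := hbounds T hT u hu hu0 T hTT
      have hdom : IsSol F.field F.dom u T := hu.mono fun t ht => hδ.2.1 (hu t ht).1
      refine ⟨⟨by simpa using h2, h1⟩, by simpa using hbound1 T hT u hu hu0 T hTT, ?_⟩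
      rw [mem_singleton_iff, param_eq hdom hTT, hu0])
  have hdom : IsSol F.field F.dom u 1 := hu.mono fun t ht => hδ.2.1 (hu t ht).1
  have h11 : (1 : ℝ) ∈ Icc (0 : ℝ) 1 := ⟨zero_le_one, le_rfl⟩
  refine ⟨u, hdom, hu0, ?_, ?_, fun t ht => ⟨(hbounds 1 h11 u hu hu0 t ht).1.2,
    hbound1 1 h11 u hu hu0 t ht⟩⟩
  · have := fst_eq hdom h11
    rw [hu0] at this
    rw [this, hp]
    simp only [Complex.ofReal_one, mul_one]
    rw [← Complex.exp_add, hc, add_sub_cancel, ← Complex.ofReal_exp, Real.exp_log hd]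
  · have := (hbounds 1 h11 u hu hu0 1 h11).2
    rwa [mul_one, hcre] at this

/-- The `y`-coordinate at the end of the passage near the saddle. -/
def saddleMap (F : DeformedSaddle) (d : ℝ) (q : ℂ × ℂ) : ℂ :=
  (timeOne F.field F.dom (Complex.exp q.2, (d : ℂ), q.1, (Real.log d : ℂ) - q.2)).2.1

lemma saddleMap_eq {d : ℝ} {ε ξ : ℂ} {u : ℝ → ℂ × ℂ × ℂ × ℂ} (hu : IsSol F.field F.dom u 1)
    (h0 : u 0 = (Complex.exp ξ, (d : ℂ), ε, (Real.log d : ℂ) - ξ)) :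
    F.saddleMap d (ε, ξ) = (u 1).2.1 := by
  rw [saddleMap, ← h0, hu.timeOne_eq analyticOnNhd_field]

/-- Existence of the passage makes the time-one map analytic at the initial state, which depends
analytically on `(ε, ξ)`. -/
lemma analyticAt_saddleMap (hδ : F.IsSaddleRadius δ) {d : ℝ} (hd : 0 < d) (hdδ : d < δ)
    {ε ξ : ℂ} (hε : ‖ε‖ < δ) (hξ : |ξ.im| < Real.log d - ξ.re) :
    AnalyticAt ℂ (F.saddleMap d) (ε, ξ) := by
  obtain ⟨u, hu, hu0, -⟩ := exists_saddle_passage hδ hd hdδ hε hξ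
  have h1 := hu.analyticAt_timeOne F.isOpen_dom analyticOnNhd_field
  rw [hu0] at h1
  have h2 : AnalyticAt ℂ (fun q : ℂ × ℂ =>
      (Complex.exp q.2, (d : ℂ), q.1, (Real.log d : ℂ) - q.2)) (ε, ξ) :=
    (analyticAt_snd.cexp).prod (analyticAt_const.prod (analyticAt_fst.prod
      (analyticAt_const.sub analyticAt_snd)))
  have h3 := AnalyticAt.comp (g := timeOne F.field F.dom) (f := fun q : ℂ × ℂ =>
      (Complex.exp q.2, (d : ℂ), q.1, (Real.log d : ℂ) - q.2)) h1 h2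
  exact analyticAt_fst.comp (analyticAt_snd.comp h3)

end DeformedSaddle

/-! ### Real orbits in the first quadrant. -/

namespace DeformedSaddle

/-- The real points of `U` in the open first quadrant. -/
def quadrant (F : DeformedSaddle) : Set (ℂ × ℂ) :=
  {p | p ∈ F.U ∧ ∃ a b : ℝ, 0 < a ∧ 0 < b ∧ p = ((a : ℂ), (b : ℂ))}

variable {F : DeformedSaddle} {u : ℝ → ℂ × ℂ × ℂ × ℂ} {x₀ d : ℝ}

lemma mem_quadrant {T t : ℝ} (hu : IsSol F.field F.dom u T) {x y ε c : ℝ} (hx : 0 < x) (hy : 0 < y)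
    (h0 : u 0 = ((x : ℂ), (y : ℂ), (ε : ℂ), (c : ℂ))) (ht : t ∈ Icc 0 T) :
    ((u t).1, (u t).2.1) ∈ F.quadrant := by
  obtain ⟨a, b, ha, hb, hab⟩ := pos_of_pos hu hx hy h0 ht
  exact ⟨(hu t ht).1.1.1, a, b, ha, hb, by rw [hab]⟩

lemma exists_orbit_of_pos (hu : IsSol F.field F.dom u 1) {x y ε c : ℝ} (hx : 0 < x) (hy : 0 < y)
    (h0 : u 0 = ((x : ℂ), (y : ℂ), (ε : ℂ), (c : ℂ))) (hc : 0 < c) {W : Set (ℂ × ℂ)}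
    (hW : ∀ t ∈ Icc (0 : ℝ) 1, ((u t).1, (u t).2.1) ∈ W) :
    ∃ (T : ℝ) (v : ℝ → ℂ × ℂ), 0 < T ∧ IsSol (F.X ε) W v T ∧ v 0 = ((u 0).1, (u 0).2.1) ∧
      v T = ((u 1).1, (u 1).2.1) := by
  obtain ⟨g, hg, hpos, hd⟩ := exists_tangent hu hx hy h0
  exact exists_isSol_of_pos_tangent (u := fun t => ((u t).1, (u t).2.1)) (hg.const_mul c)
    (fun t ht => mul_pos hc (hpos t ht)) (fun t ht => ⟨hW t ht, hd t ht⟩)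

/-- For `c < 0` the rescaled solution runs against `X_ε`, so the two ends are exchanged. This turns
the flow box from `τ` to `{x = d}` into orbits arriving at `τ`. -/
lemma exists_orbit_of_neg (hu : IsSol F.field F.dom u 1) {x y ε c : ℝ} (hx : 0 < x) (hy : 0 < y)
    (h0 : u 0 = ((x : ℂ), (y : ℂ), (ε : ℂ), (c : ℂ))) (hc : c < 0) {W : Set (ℂ × ℂ)}
    (hW : ∀ t ∈ Icc (0 : ℝ) 1, ((u t).1, (u t).2.1) ∈ W) :
    ∃ (T : ℝ) (v : ℝ → ℂ × ℂ), 0 < T ∧ IsSol (F.X ε) W v T ∧ v 0 = ((u 1).1, (u 1).2.1) ∧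
      v T = ((u 0).1, (u 0).2.1) := by
  obtain ⟨g, hg, hpos, hd⟩ := exists_tangent hu hx hy h0
  exact exists_isSol_of_neg_tangent (u := fun t => ((u t).1, (u t).2.1)) (hg.const_mul c)
    (fun t ht => mul_neg_of_neg_of_pos hc (hpos t ht)) (fun t ht => ⟨hW t ht, hd t ht⟩)

/-- The remaining part of a solution, rescaled to the unit interval. -/
lemma isSol_rescale (hu : IsSol F.field F.dom u 1) {t : ℝ} (ht : t ∈ Icc (0 : ℝ) 1) :
    IsSol F.field F.dom (fun s => ((u (t + (1 - t) * s)).1, (u (t + (1 - t) * s)).2.1,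
      (u (t + (1 - t) * s)).2.2.1, (((1 - t : ℝ) : ℂ)) * (u (t + (1 - t) * s)).2.2.2)) 1 := by
  have hmaps : MapsTo (fun s => t + (1 - t) * s) (Icc 0 1) (Icc 0 1) := by
    intro s hs
    have h1 : 0 ≤ (1 - t) * s := mul_nonneg (by linarith [ht.2]) hs.1
    have h2 : (1 - t) * s ≤ 1 - t := mul_le_of_le_one_right (by linarith [ht.2]) hs.2
    exact ⟨by linarith [ht.1], by linarith⟩
  intro s hs
  have hs' := hmaps hs
  refine ⟨(hu _ hs').1, ?_⟩
  have hd : HasDerivWithinAt (fun s : ℝ => t + (1 - t) * s) (1 - t) (Icc 0 1) s := by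
    simpa using (((hasDerivAt_id s).const_mul (1 - t)).const_add t).hasDerivWithinAt
  have h1 := (hu _ hs').2.scomp s hd hmaps
  let L : ℂ × ℂ × ℂ × ℂ →L[ℝ] ℂ × ℂ × ℂ × ℂ := (ContinuousLinearMap.id ℝ ℂ).prodMap
    ((ContinuousLinearMap.id ℝ ℂ).prodMap ((ContinuousLinearMap.id ℝ ℂ).prodMap
      ((1 - t) • ContinuousLinearMap.id ℝ ℂ)))
  have hL : ∀ p, L p = (p.1, p.2.1, p.2.2.1, ((1 - t : ℝ) : ℂ) * p.2.2.2) := fun p => by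
    rw [← Complex.real_smul]; rfl
  have h2 := L.hasFDerivAt.comp_hasDerivWithinAt s h1
  have e1 : (L ∘ (u ∘ fun s => t + (1 - t) * s)) = fun s => ((u (t + (1 - t) * s)).1,
      (u (t + (1 - t) * s)).2.1, (u (t + (1 - t) * s)).2.2.1,
      (((1 - t : ℝ) : ℂ)) * (u (t + (1 - t) * s)).2.2.2) := by
    funext s
    exact hL _
  rw [e1] at h2
  convert h2 using 1
  rw [hL]
  simp only [field, Prod.smul_fst, Prod.smul_snd, Complex.real_smul, mul_zero]
  ext <;> simp <;> ring

lemma f_xAxis_eq_zero (hx : ∀ x : ℝ, 0 ≤ x → x ≤ x₀ → ((x : ℂ), (0 : ℂ)) ∈ F.U) {x : ℝ} (h0 : 0 ≤ x)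
    (h1 : x ≤ x₀) : F.f ((x : ℂ), (0 : ℂ)) = 0 := by
  have h := eq_of_hasDerivWithinAt_zero (g := fun s : ℝ => F.f ((s : ℂ), (0 : ℂ))) (T := x₀)
    (fun s hs => by
      have hU := hx s hs.1 hs.2
      have hl : HasDerivAt (fun s : ℝ => ((s : ℂ), (0 : ℂ))) ((1 : ℂ), (0 : ℂ)) s :=
        (hasDerivAt_id s).ofReal_comp.prodMk (hasDerivAt_const _ _)
      have hf : HasFDerivAt F.f ((fderiv ℂ F.f ((s : ℂ), (0 : ℂ))).restrictScalars ℝ)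
          ((s : ℂ), (0 : ℂ)) :=
        (F.f_analytic _ hU).differentiableAt.hasFDerivAt.restrictScalars ℝ
      have h2 := HasFDerivAt.comp_hasDerivAt (f := fun s : ℝ => ((s : ℂ), (0 : ℂ))) s hf hl
      have h3 : ((fderiv ℂ F.f ((s : ℂ), (0 : ℂ))).restrictScalars ℝ) ((1 : ℂ), (0 : ℂ)) = 0 :=
        F.dx_xAxis hU
      rw [h3] at h2
      exact h2.hasDerivWithinAt) ⟨h0, h1⟩
  rw [h]
  simpa using F.f_zero

lemma axisState_fst_mem (hd : 0 < d) (hdx : d ≤ x₀) {t : ℝ} (ht : t ∈ Icc (0 : ℝ) 1) :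
    ∃ x : ℝ, d ≤ x ∧ x ≤ x₀ ∧ axisState x₀ d t = ((x : ℂ), 0, 0, ((Real.log (d / x₀) : ℝ) : ℂ)) := by
  have hx₀ : 0 < x₀ := hd.trans_le hdx
  have hc0 : Real.log (d / x₀) ≤ 0 := Real.log_nonpos (by positivity) ((div_le_one hx₀).2 hdx)
  refine ⟨x₀ * Real.exp (Real.log (d / x₀) * t), ?_, ?_, rfl⟩
  · have h1 : Real.exp (Real.log (d / x₀)) ≤ Real.exp (Real.log (d / x₀) * t) := by
      rw [Real.exp_le_exp]; nlinarith [ht.1, ht.2]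
    rw [Real.exp_log (by positivity), div_le_iff₀ hx₀] at h1
    linarith
  · exact mul_le_of_le_one_right hx₀.le
      (Real.exp_le_one_iff.2 (mul_nonpos_of_nonpos_of_nonneg hc0 ht.1))

/-- The arc is compact, and `d < x₀` strictly makes its time component `log (d / x₀)` negative; both
conditions are open. -/
lemma exists_tube (hd : 0 < d) (hdx : d < x₀)
    (hx : ∀ x : ℝ, 0 ≤ x → x ≤ x₀ → ((x : ℂ), (0 : ℂ)) ∈ F.U)
    (hx_reg : ∀ x : ℝ, 0 < x → x ≤ x₀ → fderiv ℂ F.f ((x : ℂ), (0 : ℂ)) ≠ 0) {O : Set (ℂ × ℂ)}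
    (hO : IsOpen O) (hOx : ∀ x : ℝ, d ≤ x → x ≤ x₀ → ((x : ℂ), (0 : ℂ)) ∈ O) :
    ∃ η > 0, ∀ t ∈ Icc (0 : ℝ) 1, ∀ s, dist s (axisState x₀ d t) < η →
      (s.1, s.2.1) ∈ O ∧ s.2.2.2.re < 0 := by
  have hx₀ : 0 < x₀ := hd.trans hdx
  have hK : IsCompact (axisState x₀ d '' Icc 0 1) :=
    isCompact_Icc.image_of_continuousOn (isSol_axisState hd hdx.le hx hx_reg).continuousOn
  have hOo : IsOpen {s : ℂ × ℂ × ℂ × ℂ | (s.1, s.2.1) ∈ O ∧ s.2.2.2.re < 0} :=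
    (hO.preimage (f := fun s : ℂ × ℂ × ℂ × ℂ => (s.1, s.2.1)) (by fun_prop)).inter
      (isOpen_lt (f := fun s : ℂ × ℂ × ℂ × ℂ => s.2.2.2.re)
        (Complex.continuous_re.comp (by fun_prop)) continuous_const)
  obtain ⟨η, hη, hsub⟩ := hK.exists_thickening_subset_open hOo (by
    rintro _ ⟨t, ht, rfl⟩
    obtain ⟨x, h1, h2, h3⟩ := axisState_fst_mem hd hdx.le ht
    rw [h3]
    refine ⟨hOx x h1 h2, ?_⟩
    rw [Complex.ofReal_re]
    exact Real.log_neg (by positivity) ((div_lt_one hx₀).2 hdx))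
  refine ⟨η, hη, fun t ht s hs => hsub ?_⟩
  exact mem_thickening_iff.2 ⟨_, ⟨t, ht, rfl⟩, hs⟩

/-- The real transition from the positive half of a cross-section at `(x₀, 0)` to `{x = d}`. -/
lemma exists_real_flowBox (hd : 0 < d) (hdx : d < x₀)
    (hx : ∀ x : ℝ, 0 ≤ x → x ≤ x₀ → ((x : ℂ), (0 : ℂ)) ∈ F.U)
    (hx_reg : ∀ x : ℝ, 0 < x → x ≤ x₀ → fderiv ℂ F.f ((x : ℂ), (0 : ℂ)) ≠ 0)
    (τ : CrossSection F ((x₀ : ℂ), (0 : ℂ))) :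
    ∃ (h : ℂ × ℂ → ℂ) (k : ℝ), AnalyticAt ℂ h 0 ∧ 0 < k ∧
      (∀ v : ℂ × ℂ, fderiv ℂ h 0 v = k * v.2) ∧ (∀ᶠ ε in 𝓝 (0 : ℂ), h (ε, 0) = 0) ∧
      ∀ O : Set (ℂ × ℂ), IsOpen O → (∀ x : ℝ, d ≤ x → x ≤ x₀ → ((x : ℂ), (0 : ℂ)) ∈ O) →
        ∃ r > 0, ∀ ε w : ℝ, |ε| < r → 0 < w → w < r → w < τ.R ∧ ∃ (a b c y : ℝ)
          (u : ℝ → ℂ × ℂ × ℂ × ℂ), 0 < a ∧ 0 < b ∧ c < 0 ∧ 0 < y ∧ IsSol F.field F.dom u 1 ∧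
          u 0 = ((a : ℂ), (b : ℂ), (ε : ℂ), (c : ℂ)) ∧ τ.param w = ((a : ℂ), (b : ℂ)) ∧
          Complex.log (d / a) = c ∧
          u 1 = ((d : ℂ), (y : ℂ), (ε : ℂ), (c : ℂ)) ∧ h ((ε : ℂ), (w : ℂ)) = y ∧
          ∀ t ∈ Icc (0 : ℝ) 1, ((u t).1, (u t).2.1) ∈ O := by
  have hx₀ : 0 < x₀ := hd.trans hdx
  obtain ⟨h, k, hh, hk, hder, h0, hmain⟩ := exists_flowBox hd hdx.le hx hx_reg τ
  refine ⟨h, k, hh, hk, hder, h0, fun O hO hOx => ?_⟩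
  obtain ⟨η, hη, htube⟩ := exists_tube hd hdx hx hx_reg hO hOx
  obtain ⟨r₁, hr₁, hb₁⟩ := Metric.eventually_nhds_iff.1 (hmain η hη)
  obtain ⟨r₂, hr₂, hb₂⟩ := Metric.eventually_nhds_iff.1 (eventually_param_pos hx hx_reg hx₀ τ)
  refine ⟨min r₁ r₂, lt_min hr₁ hr₂, fun ε w hε hw0 hw => ?_⟩
  obtain ⟨hwR, u, hu, hu0, hu1, hud⟩ := hb₁ (y := ((ε : ℂ), (w : ℂ))) (by
    simp only [dist_zero_right, Prod.norm_def, Complex.norm_real, Real.norm_eq_abs, max_lt_iff,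
      abs_of_pos hw0]
    exact ⟨hε.trans_le (min_le_left _ _), hw.trans_le (min_le_left _ _)⟩)
  obtain ⟨a, b, ha, hb, hab⟩ := hb₂ (y := w) (by
    rw [dist_zero_right, Real.norm_eq_abs, abs_of_pos hw0]
    exact hw.trans_le (min_le_right _ _)) hw0
  have hlog : Complex.log (d / (a : ℂ)) = ((Real.log (d / a) : ℝ) : ℂ) := by
    rw [← Complex.ofReal_div, Complex.ofReal_log (by positivity)]
  simp only [hab, hlog] at hu0 hu1
  have h11 : (1 : ℝ) ∈ Icc (0 : ℝ) 1 := ⟨zero_le_one, le_rfl⟩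
  have h00 : (0 : ℝ) ∈ Icc (0 : ℝ) 1 := ⟨le_rfl, zero_le_one⟩
  obtain ⟨a', y, -, hy, hay⟩ := pos_of_pos hu ha hb hu0 h11
  have hhy : h ((ε : ℂ), (w : ℂ)) = y := by
    have := congrArg (fun s => s.2.1) (hu1.symm.trans hay)
    exact this
  refine ⟨?_, a, b, Real.log (d / a), y, u, ha, hb, ?_, hy, hu, hu0, hab, hlog, ?_, hhy,
    fun t ht => (htube t ht _ (hud t ht)).1⟩
  · simpa [abs_of_pos hw0] using hwR
  · have := (htube 0 h00 _ (hud 0 h00)).2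
    rw [hu0] at this
    simpa using this
  · rw [hu1, hhy]

/-- The implicit function theorem applies since `∂_w h = k ≠ 0`. The equivalence also records local
injectivity of `h (ε, ·)`, which later excludes further hits of `τ`. -/
lemma exists_implicit {h : ℂ × ℂ → ℂ} {k : ℝ} (hh : AnalyticAt ℂ h 0) (hk : 0 < k)
    (hder : ∀ v : ℂ × ℂ, fderiv ℂ h 0 v = k * v.2) (h0 : h 0 = 0) :
    ∃ Ψ : ℂ × ℂ → ℂ, AnalyticAt ℂ Ψ 0 ∧
      ∀ᶠ v : (ℂ × ℂ) × ℂ in 𝓝 0, h (v.1.1, v.2) = v.1.2 ↔ Ψ v.1 = v.2 := by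
  let A : (ℂ × ℂ) × ℂ →L[ℂ] ℂ × ℂ :=
    (ContinuousLinearMap.fst ℂ ℂ ℂ ∘L .fst ℂ (ℂ × ℂ) ℂ).prod (.snd ℂ (ℂ × ℂ) ℂ)
  let B : (ℂ × ℂ) × ℂ →L[ℂ] ℂ := .snd ℂ ℂ ℂ ∘L .fst ℂ (ℂ × ℂ) ℂ
  let G : (ℂ × ℂ) × ℂ → ℂ := fun v => h (A v) - B v
  have hA0 : A 0 = 0 := map_zero A
  have hG : AnalyticAt ℂ G 0 :=
    (AnalyticAt.comp (g := h) (f := A) (by rw [hA0]; exact hh) (A.analyticAt 0)).sub (B.analyticAt 0)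
  have hGd : HasFDerivAt G (fderiv ℂ h 0 ∘L A - B) 0 := by
    have h1 : HasFDerivAt h (fderiv ℂ h 0) (A 0) := by
      rw [hA0]; exact hh.differentiableAt.hasFDerivAt
    exact (h1.comp (0 : (ℂ × ℂ) × ℂ) A.hasFDerivAt).sub B.hasFDerivAt
  have hkC : (k : ℂ) ≠ 0 := by exact_mod_cast hk.ne'
  have hinv : (fderiv ℂ G 0 ∘L .inr ℂ (ℂ × ℂ) ℂ).IsInvertible := by
    rw [hGd.fderiv]
    refine ⟨ContinuousLinearEquiv.smulLeft (Units.mk0 (k : ℂ) hkC), ?_⟩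
    ext
    simp [hder, A, B]
  have hGc : ContDiffAt ℂ ω G 0 := hG.contDiffAt
  refine ⟨hGc.implicitFunction (by simp) hinv,
    (hGc.contDiffAt_implicitFunction (by simp) hinv).analyticAt, ?_⟩
  have hG0 : G 0 = 0 := by simp [G, h0]
  filter_upwards [hGc.eventually_apply_eq_iff_implicitFunction (by simp) hinv] with v hv
  rw [hG0] at hv
  rw [← hv]
  simp [G, A, B, sub_eq_zero]

end DeformedSaddle

/-! ### Landing on `τ` and departure from `σ`. -/

namespace DeformedSaddle

variable {F : DeformedSaddle} {x₀ y₀ d : ℝ}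

lemma isOpen_f_lt (F : DeformedSaddle) (r : ℝ) : IsOpen {p | p ∈ F.U ∧ ‖F.f p‖ < r} := by
  have hc : ContinuousOn (fun p => ‖F.f p‖) F.U := fun p hp =>
    (F.f_analytic p hp).continuousAt.norm.continuousWithinAt
  exact hc.isOpen_inter_preimage F.isOpen_U isOpen_Iio

/-- The transition from `{x = d}` to the cross-section `τ`. It is analytic, and for real data it is
given by orbits that meet the positive half of `τ` at one point only. -/
theorem exists_landing (hd : 0 < d) (hdx : d < x₀)
    (hx : ∀ x : ℝ, 0 ≤ x → x ≤ x₀ → ((x : ℂ), (0 : ℂ)) ∈ F.U)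
    (hx_reg : ∀ x : ℝ, 0 < x → x ≤ x₀ → fderiv ℂ F.f ((x : ℂ), (0 : ℂ)) ≠ 0)
    (τ : CrossSection F ((x₀ : ℂ), (0 : ℂ))) :
    ∃ (Ψ : ℂ × ℂ → ℂ) (r : ℝ), 0 < r ∧
      (∀ q : ℂ × ℂ, ‖q.1‖ < r → ‖q.2‖ < r → AnalyticAt ℂ Ψ q) ∧
      ∀ ε y : ℝ, |ε| < r → 0 < y → y < r → ∃ w : ℝ, 0 < w ∧ w < τ.R ∧
        Ψ ((ε : ℂ), (y : ℂ)) = w ∧ ∃ (T : ℝ) (v : ℝ → ℂ × ℂ), 0 < T ∧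
          IsSol (F.X ε) {p | p ∈ F.quadrant ∧
            ∀ v' : ℝ, 0 < v' → v' < τ.R → p = τ.param v' → v' = w} v T ∧
          v 0 = ((d : ℂ), (y : ℂ)) ∧ v T = τ.param w := by
  obtain ⟨h, k, hh, hk, hder, h0, hreal⟩ := exists_real_flowBox hd hdx hx hx_reg τ
  obtain ⟨Ψ, hΨ, hiff⟩ := exists_implicit hh hk hder h0.self_of_nhds
  obtain ⟨r₁, hr₁, hb₁⟩ := Metric.eventually_nhds_iff.1 hiff
  obtain ⟨r₂, hr₂, hb₂⟩ := hreal univ isOpen_univ (fun _ _ _ => trivial)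
  -- The level of `f` is kept small along the whole orbit: if it meets `τ` at `τ(v')`, then `v'` is
  -- that level and is small enough for the flow box and for injectivity.
  obtain ⟨r₃, hr₃, hb₃⟩ := hreal {p | p ∈ F.U ∧ ‖F.f p‖ < min r₁ r₂} (F.isOpen_f_lt _)
    (fun x h1 h2 => by
      refine ⟨hx x (hd.le.trans h1) h2, ?_⟩
      rw [f_xAxis_eq_zero hx (hd.le.trans h1) h2, norm_zero]
      exact lt_min hr₁ hr₂)
  obtain ⟨r₄, hr₄, hb₄⟩ := Metric.eventually_nhds_iff.1
    (hh.eventually_analyticAt.and (eventually_norm_sub_le hh hder h0 (half_pos hk)))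
  obtain ⟨r₅, hr₅, hb₅⟩ := Metric.eventually_nhds_iff.1 h0
  obtain ⟨r₆, hr₆, hb₆⟩ := Metric.eventually_nhds_iff.1 hΨ.eventually_analyticAt
  set m := min (min (min r₁ r₂) (min r₃ r₄)) r₅ with hm
  have hmpos : 0 < m := lt_min (lt_min (lt_min hr₁ hr₂) (lt_min hr₃ hr₄)) hr₅
  have hm1 : m ≤ r₁ := (min_le_left _ _).trans ((min_le_left _ _).trans (min_le_left _ _))
  have hm2 : m ≤ r₂ := (min_le_left _ _).trans ((min_le_left _ _).trans (min_le_right _ _))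
  have hm3 : m ≤ r₃ := (min_le_left _ _).trans ((min_le_right _ _).trans (min_le_left _ _))
  have hm4 : m ≤ r₄ := (min_le_left _ _).trans ((min_le_right _ _).trans (min_le_right _ _))
  have hm5 : m ≤ r₅ := min_le_right _ _
  set w₁ := m / 2 with hw₁
  have hw₁pos : 0 < w₁ := by positivity
  have hw₁m : w₁ < m := by rw [hw₁]; linarith
  refine ⟨Ψ, min (min m r₆) (k * w₁ / 2), lt_min (lt_min hmpos hr₆) (by positivity), ?_, ?_⟩
  · intro q h1 h2
    refine hb₆ ?_
    rw [dist_zero_right, Prod.norm_def, max_lt_iff]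
    exact ⟨h1.trans_le ((min_le_left _ _).trans (min_le_right _ _)),
      h2.trans_le ((min_le_left _ _).trans (min_le_right _ _))⟩
  intro ε y hε hy hyr
  have hεm : |ε| < m := hε.trans_le ((min_le_left _ _).trans (min_le_left _ _))
  have hym : y < m := hyr.trans_le ((min_le_left _ _).trans (min_le_left _ _))
  have hyk : y < k * w₁ / 2 := hyr.trans_le (min_le_right _ _)
  have hdist : ∀ w : ℝ, 0 ≤ w → w ≤ w₁ → dist (((ε : ℂ), (w : ℂ)) : ℂ × ℂ) 0 < m := by
    intro w h1 h2
    simp only [dist_zero_right, Prod.norm_def, Complex.norm_real, Real.norm_eq_abs, max_lt_iff,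
      abs_of_nonneg h1]
    exact ⟨hεm, h2.trans_lt hw₁m⟩
  have hcont : ContinuousOn (fun w : ℝ => (h ((ε : ℂ), (w : ℂ))).re) (Icc 0 w₁) := by
    intro w hw
    have h1 : ContinuousAt h ((ε : ℂ), (w : ℂ)) :=
      (hb₄ ((hdist w hw.1 hw.2).trans_le hm4)).1.continuousAt
    have h2 : ContinuousAt (fun w : ℝ => ((ε : ℂ), (w : ℂ))) w := by fun_prop
    exact (Complex.continuous_re.continuousAt.comp
      (ContinuousAt.comp (f := fun w : ℝ => ((ε : ℂ), (w : ℂ))) h1 h2)).continuousWithinAt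
  have hlow : h ((ε : ℂ), ((0 : ℝ) : ℂ)) = 0 := by
    rw [Complex.ofReal_zero]
    refine hb₅ ?_
    rw [dist_zero_right, Complex.norm_real]
    exact hεm.trans_le hm5
  have hhigh : k * w₁ / 2 ≤ (h ((ε : ℂ), (w₁ : ℂ))).re := by
    have h1 := (hb₄ ((hdist w₁ hw₁pos.le le_rfl).trans_le hm4)).2
    have h2 := (abs_le.1 ((Complex.abs_re_le_norm _).trans h1)).1
    simp only [Complex.norm_real, Real.norm_eq_abs, abs_of_pos hw₁pos] at h2
    rw [← Complex.ofReal_mul, Complex.sub_re, Complex.ofReal_re] at h2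
    linarith
  -- A real preimage of `y` exists because `h (ε, 0) = 0` and `Re h (ε, w₁) ≥ k w₁ / 2 > y`; it
  -- coincides with the value of the analytic inverse `Ψ`.
  obtain ⟨w, hw, hwy⟩ := intermediate_value_Icc hw₁pos.le hcont
    (show y ∈ _ from ⟨by rw [hlow]; exact hy.le, hyk.le.trans hhigh⟩)
  have hw0 : 0 < w := by
    refine lt_of_le_of_ne hw.1 ?_
    rintro rfl
    simp only [hlow, Complex.zero_re] at hwy
    exact hy.ne hwy
  have hwm : w < m := hw.2.trans_lt hw₁m
  obtain ⟨hwR, a, b, c, y', u, ha, hb, hc, hy', hu, hu0, hab, hlog, hu1, hhy, huO⟩ :=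
    hb₃ ε w (hεm.trans_le hm3) hw0 (hwm.trans_le hm3)
  have hyy : y' = y := by
    simp only [hhy, Complex.ofReal_re] at hwy
    exact hwy
  subst hyy
  have hiff' : ∀ v : ℝ, |v| < r₁ → h ((ε : ℂ), (v : ℂ)) = y' → Ψ ((ε : ℂ), (y' : ℂ)) = v := by
    intro v hv hvy
    refine (hb₁ (y := (((ε : ℂ), (y' : ℂ)), (v : ℂ))) ?_).1 hvy
    simp only [dist_zero_right, Prod.norm_def, Complex.norm_real, Real.norm_eq_abs, max_lt_iff,
      abs_of_pos hy]
    exact ⟨⟨hεm.trans_le hm1, hym.trans_le hm1⟩, hv⟩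
  have hΨw := hiff' w (by rw [abs_of_pos hw0]; exact hwm.trans_le hm1) hhy
  refine ⟨w, hw0, hwR, hΨw, ?_⟩
  obtain ⟨T, v, hT, hv, hv0, hvT⟩ := exists_orbit_of_neg hu ha hb hu0 hc
    (W := {p | p ∈ F.quadrant ∧ ∀ v' : ℝ, 0 < v' → v' < τ.R → p = τ.param v' → v' = w}) (by
      intro t ht
      refine ⟨mem_quadrant hu ha hb hu0 ht, fun v' hv' hvR hpv => ?_⟩
      have hfv : F.f ((u t).1, (u t).2.1) = v' := by
        rw [hpv]
        exact τ.f_param v' (by simpa [abs_of_pos hv'] using hvR)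
      have hvr := (huO t ht).2
      rw [hfv, Complex.norm_real, Real.norm_eq_abs] at hvr
      have hv1 : |v'| < r₁ := hvr.trans_le (min_le_left _ _)
      have hv2 : v' < r₂ := by
        rw [abs_of_pos hv'] at hvr; exact hvr.trans_le (min_le_right _ _)
      obtain ⟨-, a', b', c', y'', u', ha', hb', -, -, hu', hu0', hab', hlog', hu1', hhy', -⟩ :=
        hb₂ ε v' (hεm.trans_le hm2) hv' hv2
      -- The rest of the solution, rescaled to unit time, starts on `τ` at `v'` and ends at `(d,
      -- y')`. By uniqueness it is the flow-box solution of `v'`, so `h (ε, v') = y'` and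
      -- injectivity gives `v' = w`.
      have hus := isSol_rescale hu ht
      rw [hab'] at hpv
      have e1 : (u t).1 = a' := congrArg Prod.fst hpv
      have e2 : (u t).2.1 = b' := congrArg Prod.snd hpv
      have e3 : (u t).2.2 = ((ε : ℂ), (c : ℂ)) := by rw [param_eq hu ht, hu0]
      have h11 : (1 : ℝ) ∈ Icc (0 : ℝ) 1 := ⟨zero_le_one, le_rfl⟩
      have hfst := fst_eq hus h11
      simp only [mul_one, mul_zero, add_zero, add_sub_cancel, hu1, e1, e3,
        Complex.ofReal_one] at hfst
      have ha'C : (a' : ℂ) ≠ 0 := by exact_mod_cast ha'.ne'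
      have hc' : (c' : ℂ) = ((1 - t : ℝ) : ℂ) * c := by
        rw [← hlog', hfst, mul_div_cancel_left₀ _ ha'C, ← Complex.ofReal_mul,
          ← Complex.ofReal_exp, ← Complex.ofReal_log (Real.exp_pos _).le, Real.log_exp]
      have huniq := hu'.eqOn_of_eq locLip_field hus (t₀ := 0) ⟨le_rfl, zero_le_one⟩ (by
        simp only [mul_zero, add_zero, e1, e2, e3, hu0', hc']) h11
      have hy2 : h ((ε : ℂ), (v' : ℂ)) = y' := by
        rw [hhy']
        have := congrArg (fun s : ℂ × ℂ × ℂ × ℂ => s.2.1) huniq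
        simpa [hu1', hu1] using this
      have := (hiff' v' hv1 hy2).symm.trans hΨw
      exact_mod_cast this)
  refine ⟨T, v, hT, hv, ?_, ?_⟩
  · rw [hv0, hu1]
  · rw [hvT, hu0, hab]

/-- The cross-section of the foliation with exchanged coordinates. -/
def _root_.Dulac.CrossSection.swap (σ : CrossSection F ((0 : ℂ), (y₀ : ℂ))) :
    CrossSection F.swap ((y₀ : ℂ), (0 : ℂ)) where
  R := σ.R
  R_pos := σ.R_pos
  param := fun z => (σ.param z).swap
  analytic := fun z hz =>
    ((ContinuousLinearEquiv.prodComm ℂ ℂ ℂ).toContinuousLinearMap.analyticAt _).comp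
      (σ.analytic z hz)
  mapsTo := fun z hz => σ.mapsTo hz
  param_zero := by simp [σ.param_zero]
  f_param := fun z hz => σ.f_param z hz
  real := fun z hz => ⟨(σ.real z hz).2, (σ.real z hz).1⟩

lemma fderiv_swap_ne_zero {y : ℂ} (h : fderiv ℂ F.f (0, y) ≠ 0) :
    fderiv ℂ F.swap.f (y, 0) ≠ 0 := by
  have h1 := (ContinuousLinearEquiv.prodComm ℂ ℂ ℂ).comp_right_fderiv (f := F.f) (x := (y, 0))
  change fderiv ℂ (F.f ∘ (ContinuousLinearEquiv.prodComm ℂ ℂ ℂ)) (y, 0) ≠ 0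
  rw [h1]
  intro h2
  apply h
  ext
  · have := congrArg (fun L : ℂ × ℂ →L[ℂ] ℂ => L (0, 1)) h2
    simpa using this
  · have := congrArg (fun L : ℂ × ℂ →L[ℂ] ℂ => L (1, 0)) h2
    simpa using this

/-- The transition from the cross-section `σ` to `{y = d}`. -/
theorem exists_departure (hd : 0 < d) (hdy : d < y₀)
    (hy : ∀ y : ℝ, 0 ≤ y → y ≤ y₀ → ((0 : ℂ), (y : ℂ)) ∈ F.U)
    (hy_reg : ∀ y : ℝ, 0 < y → y ≤ y₀ → fderiv ℂ F.f ((0 : ℂ), (y : ℂ)) ≠ 0)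
    (σ : CrossSection F ((0 : ℂ), (y₀ : ℂ))) {O : Set (ℂ × ℂ)} (hO : IsOpen O)
    (hOy : ∀ y : ℝ, d ≤ y → y ≤ y₀ → ((0 : ℂ), (y : ℂ)) ∈ O) :
    ∃ (h : ℂ × ℂ → ℂ) (k r : ℝ), 0 < k ∧ 0 < r ∧
      (∀ q : ℂ × ℂ, ‖q.1‖ < r → ‖q.2‖ < r → AnalyticAt ℂ h q ∧ ‖h q - k * q.2‖ ≤ k / 2 * ‖q.2‖) ∧
      ∀ ε z : ℝ, |ε| < r → 0 < z → z < r → z < σ.R ∧ ∃ x : ℝ, 0 < x ∧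
        h ((ε : ℂ), (z : ℂ)) = x ∧ ∃ (T : ℝ) (v : ℝ → ℂ × ℂ), 0 < T ∧
          IsSol (F.X ε) (F.quadrant ∩ O) v T ∧ v 0 = σ.param z ∧ v T = ((x : ℂ), (d : ℂ)) := by
  obtain ⟨h, k, hh, hk, hder, h0, hreal⟩ := exists_real_flowBox (F := F.swap) hd hdy
    (fun y h1 h2 => hy y h1 h2) (fun y h1 h2 => fderiv_swap_ne_zero (hy_reg y h1 h2)) σ.swap
  obtain ⟨r₁, hr₁, hb₁⟩ := hreal (Prod.swap ⁻¹' O) (hO.preimage continuous_swap)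
    (fun y h1 h2 => hOy y h1 h2)
  obtain ⟨r₂, hr₂, hb₂⟩ := Metric.eventually_nhds_iff.1
    (hh.eventually_analyticAt.and (eventually_norm_sub_le hh hder h0 (half_pos hk)))
  refine ⟨h, k, min r₁ r₂, hk, lt_min hr₁ hr₂, ?_, ?_⟩
  · intro q h1 h2
    refine hb₂ ?_
    rw [dist_zero_right, Prod.norm_def, max_lt_iff]
    exact ⟨h1.trans_le (min_le_right _ _), h2.trans_le (min_le_right _ _)⟩
  intro ε z hε hz hzr
  obtain ⟨hzR, a, b, c, x, u, ha, hb, hc, hx, hu, hu0, hab, -, hu1, hhx, huO⟩ :=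
    hb₁ ε z (hε.trans_le (min_le_left _ _)) hz (hzr.trans_le (min_le_left _ _))
  refine ⟨hzR, x, hx, hhx, ?_⟩
  obtain ⟨g, hg, hpos, hd'⟩ := exists_tangent hu ha hb hu0
  -- Two signs cancel: `c < 0`, and the exchange of coordinates reverses the field. The orbit thus
  -- leaves `σ` in forward time.
  obtain ⟨T, v, hT, hv, hv0, hvT⟩ := exists_isSol_of_pos_tangent (V := F.X ε)
    (W := F.quadrant ∩ O) (u := fun t => ((u t).2.1, (u t).1)) (g := fun t => -(c * g t))
    (hg.const_mul c).neg (fun t ht => neg_pos.2 (mul_neg_of_neg_of_pos hc (hpos t ht))) (by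
      intro t ht
      refine ⟨⟨?_, huO t ht⟩, ?_⟩
      · obtain ⟨hU, a', b', ha', hb', hab'⟩ := mem_quadrant hu ha hb hu0 ht
        exact ⟨hU, b', a', hb', ha', by rw [Prod.mk.injEq] at hab' ⊢; exact ⟨hab'.2, hab'.1⟩⟩
      · have h1 := (ContinuousLinearEquiv.prodComm ℝ ℂ ℂ).toContinuousLinearMap.hasFDerivAt
          |>.comp_hasDerivWithinAt t (hd' t ht)
        rw [swap_X] at h1
        convert h1 using 1
        · rfl
        · ext <;> simp)
  refine ⟨T, v, hT, hv, ?_, ?_⟩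
  · rw [hv0, hu0]
    have : (σ.param z).swap = ((a : ℂ), (b : ℂ)) := hab
    rw [← Prod.swap_swap (σ.param z), this]
    rfl
  · rw [hvT, hu1]

/-- The passage near the saddle for real data. -/
lemma exists_real_saddle_passage {δ : ℝ} (hδ : F.IsSaddleRadius δ) (hd : 0 < d) (hdδ : d < δ)
    {ε ξ : ℝ} (hε : |ε| < δ) (hξ : ξ < Real.log d) :
    ∃ y : ℝ, 0 < y ∧ F.saddleMap d ((ε : ℂ), (ξ : ℂ)) = y ∧ ∃ (T : ℝ) (v : ℝ → ℂ × ℂ), 0 < T ∧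
      IsSol (F.X ε) {p | p ∈ F.quadrant ∧ ‖p.1‖ ≤ d ∧ ‖p.2‖ ≤ d} v T ∧
      v 0 = (((Real.exp ξ : ℝ) : ℂ), (d : ℂ)) ∧ v T = ((d : ℂ), (y : ℂ)) := by
  obtain ⟨u, hu, hu0, hu1, -, hle⟩ := exists_saddle_passage hδ hd hdδ (ε := ε) (ξ := ξ)
    (by simpa using hε) (by simpa using hξ)
  have hu0' : u 0 = (((Real.exp ξ : ℝ) : ℂ), (d : ℂ), (ε : ℂ), ((Real.log d - ξ : ℝ) : ℂ)) := by
    rw [hu0]; push_cast; rfl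
  obtain ⟨a, y, -, hy, hay⟩ := pos_of_pos hu (Real.exp_pos ξ) hd hu0' (t := 1)
    ⟨zero_le_one, le_rfl⟩
  obtain ⟨T, v, hT, hv, hv0, hvT⟩ := exists_orbit_of_pos hu (Real.exp_pos ξ) hd hu0' (by linarith)
    (W := {p | p ∈ F.quadrant ∧ ‖p.1‖ ≤ d ∧ ‖p.2‖ ≤ d})
    (fun t ht => ⟨mem_quadrant hu (Real.exp_pos ξ) hd hu0' ht, hle t ht⟩)
  refine ⟨y, hy, ?_, T, v, hT, hv, ?_, ?_⟩
  · rw [saddleMap_eq hu hu0, hay]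
  · rw [hv0, hu0']
  · rw [hvT, hu1, hay]

end DeformedSaddle

/-! ### Assembly of the Dulac map and its continuation. -/

/-- An orbit from `σ` to `τ` in the first quadrant that meets the positive half of `τ` at one point
only gives the value of the Dulac map. -/
lemma isDulacValue_of_isSol {F : DeformedSaddle} {p q : ℂ × ℂ} {σ : CrossSection F p}
    {τ : CrossSection F q} {ε z w T : ℝ} {v : ℝ → ℂ × ℂ} (hε : |ε| < F.r) (hz : 0 < z)
    (hzR : z < σ.R) (hw : 0 < w) (hwR : w < τ.R) (hT : 0 ≤ T)
    (hv : IsSol (F.X ε) {p | p ∈ F.quadrant ∧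
      ∀ v' : ℝ, 0 < v' → v' < τ.R → p = τ.param v' → v' = w} v T)
    (h0 : v 0 = σ.param z) (hvT : v T = τ.param w) (hne : σ.param z ≠ τ.param w) :
    IsDulacValue σ τ ε z w := by
  have hclosed : IsClosed (Icc 0 T ∩ v ⁻¹' {τ.param w}) :=
    hv.continuousOn.preimage_isClosed_of_isClosed isClosed_Icc isClosed_singleton
  have hcomp : IsCompact (Icc 0 T ∩ v ⁻¹' {τ.param w}) :=
    isCompact_Icc.of_isClosed_subset hclosed inter_subset_left
  -- The orbit may reach `τ(w)` before `T`, so it is cut at the first such time, which is positive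
  -- because the starting point is different.
  obtain ⟨S, ⟨hS, hSw⟩, hmin⟩ := hcomp.exists_isLeast ⟨T, ⟨hT, le_rfl⟩, hvT⟩
  have hSw' : v S = τ.param w := hSw
  have hS0 : 0 < S := by
    refine lt_of_le_of_ne hS.1 ?_
    rintro rfl
    exact hne (h0.symm.trans hSw')
  have hvS := hv.restrict hS.2
  set γ : ℝ → ℝ × ℝ := fun t => ((v t).1.re, (v t).2.re) with hγ
  have hpt : ∀ t ∈ Icc 0 S, toC (γ t) = v t ∧ 0 < (γ t).1 ∧ 0 < (γ t).2 := by
    intro t ht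
    obtain ⟨⟨-, a, b, ha, hb, hab⟩, -⟩ := (hvS t ht).1
    simp [hγ, toC, hab, ha, hb]
  refine ⟨hε, hz, hzR, hw, hwR, S, γ, hS0, ?_, ?_, ?_, ?_⟩
  · rw [(hpt 0 ⟨le_rfl, hS0.le⟩).1, h0]
  · rw [(hpt S ⟨hS0.le, le_rfl⟩).1, hSw']
  · intro t ht
    obtain ⟨h1, h2, h3⟩ := hpt t ht
    rw [h1]
    exact ⟨(hvS t ht).1.1.1, h2, h3, (hvS t ht).2.congr_of_mem (fun s hs => (hpt s hs).1) ht⟩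
  · intro t ht v' hv' hvR heq
    have htS := Ico_subset_Icc_self ht
    rw [(hpt t htS).1] at heq
    obtain rfl := (hvS t htS).1.2 v' hv' hvR heq
    exact absurd (hmin ⟨⟨ht.1, ht.2.le.trans hS.2⟩, heq⟩) (not_le.2 ht.2)

/-- The Dulac map extends holomorphically to the universal covering of the punctured cross-section,
for parameters in a disc whose radius does not depend on the argument. -/
theorem exists_dulac_continuation (F : DeformedSaddle) (x₀ y₀ : ℝ) (hx₀ : 0 < x₀) (hy₀ : 0 < y₀)
    (hx : ∀ x : ℝ, 0 ≤ x → x ≤ x₀ → ((x : ℂ), (0 : ℂ)) ∈ F.U)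
    (hy : ∀ y : ℝ, 0 ≤ y → y ≤ y₀ → ((0 : ℂ), (y : ℂ)) ∈ F.U)
    (hx_reg : ∀ x : ℝ, 0 < x → x ≤ x₀ → fderiv ℂ F.f ((x : ℂ), (0 : ℂ)) ≠ 0)
    (hy_reg : ∀ y : ℝ, 0 < y → y ≤ y₀ → fderiv ℂ F.f ((0 : ℂ), (y : ℂ)) ≠ 0)
    (σ : CrossSection F ((0 : ℂ), (y₀ : ℂ)))
    (τ : CrossSection F ((x₀ : ℂ), (0 : ℂ))) :
    ∃ ε₀ : ℝ, 0 < ε₀ ∧ ∃ ρ : ℝ → ℝ, Continuous ρ ∧ (∀ φ, 0 < ρ φ) ∧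
      ∃ D : ℂ × ℂ → ℂ, AnalyticOnNhd ℂ D (contDomain ε₀ ρ) ∧
        ∀ ε z : ℝ, |ε| < ε₀ → 0 < z → z < ρ 0 →
          ∃ w : ℝ, IsDulacValue σ τ ε z w ∧ D ((ε : ℂ), (Real.log z : ℂ)) = (w : ℂ) := by
  -- points of `τ` on low levels of `f` are far from the `y`-axis
  obtain ⟨r₀, hr₀, hτx⟩ : ∃ r₀ > 0, ∀ v : ℝ, |v| < r₀ → x₀ / 2 < (τ.param v).1.re := by
    have hR0 : (0 : ℂ) ∈ ball (0 : ℂ) τ.R := by simpa using τ.R_pos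
    have hc : ContinuousAt (fun w : ℂ => (τ.param w).1.re) ((0 : ℝ) : ℂ) := by
      rw [Complex.ofReal_zero]
      exact Complex.continuous_re.continuousAt.comp (τ.analytic _ hR0).continuousAt.fst
    have hc' := hc.comp Complex.continuous_ofReal.continuousAt
    have hev := hc'.eventually (Ioi_mem_nhds (a := x₀ / 2) (by simp [τ.param_zero, hx₀]))
    obtain ⟨r₀, hr₀, hb⟩ := Metric.eventually_nhds_iff.1 hev
    exact ⟨r₀, hr₀, fun v hv => hb (by simpa using hv)⟩
  have hvac : ∀ p : ℂ × ℂ, ‖F.f p‖ < r₀ → ‖p.1‖ < x₀ / 2 → ∀ v : ℝ, 0 < v → v < τ.R →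
      p ≠ τ.param v := by
    rintro p hp1 hp2 v hv hvR rfl
    rw [τ.f_param v (by simpa [abs_of_pos hv] using hvR), Complex.norm_real] at hp1
    have h1 := hτx v hp1
    have h2 := Complex.re_le_norm (τ.param v).1
    linarith
  obtain ⟨b₀, hb₀, hfb⟩ : ∃ b₀ > 0, ∀ p : ℂ × ℂ, ‖p.1‖ < b₀ → ‖p.2‖ < b₀ → ‖F.f p‖ < r₀ := by
    have hc : ContinuousAt (fun p => ‖F.f p‖) (0, 0) := (F.f_analytic _ F.zero_mem).continuousAt.norm
    have hev := hc.eventually_lt continuousAt_const (show ‖F.f (0, 0)‖ < r₀ by simpa [F.f_zero] using hr₀)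
    obtain ⟨b₀, hb₀, hb⟩ := Metric.eventually_nhds_iff.1 hev
    refine ⟨b₀, hb₀, fun p h1 h2 => hb ?_⟩
    change dist p 0 < b₀
    rw [dist_zero_right, Prod.norm_def, max_lt_iff]
    exact ⟨h1, h2⟩
  -- The bound `b₀` keeps the saddle box on low levels of `f`, `x₀ / 2` keeps it away from `τ`, and
  -- `y₀` leaves room for the departure arc.
  obtain ⟨δ, hδ, hδ0, hδm⟩ := (F.eventually_isSaddleRadius.and
    (Ioo_mem_nhdsGT (lt_min hb₀ (lt_min (half_pos hx₀) hy₀)))).exists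
  have hδb : δ < b₀ := hδm.trans_le (min_le_left _ _)
  have hδx : δ < x₀ / 2 := hδm.trans_le ((min_le_right _ _).trans (min_le_left _ _))
  have hδy : δ < y₀ := hδm.trans_le ((min_le_right _ _).trans (min_le_right _ _))
  obtain ⟨d, hd, hdδ⟩ := exists_between hδ0
  obtain ⟨Ψ, s, hs, hΨ, hland⟩ := DeformedSaddle.exists_landing hd (by linarith) hx hx_reg τ
  obtain ⟨h, k, r, hk, hr, hh, hdep⟩ := DeformedSaddle.exists_departure hd (hdδ.trans hδy) hy
    hy_reg σ (O := {p | p ∈ F.U ∧ ‖F.f p‖ < r₀} ∩ {p | ‖p.1‖ < x₀ / 2})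
    ((F.isOpen_f_lt r₀).inter (isOpen_lt continuous_fst.norm continuous_const))
    (fun y h1 h2 => by
      have hy0 := hd.le.trans h1
      have hf0 : F.f ((0 : ℂ), (y : ℂ)) = 0 :=
        DeformedSaddle.f_xAxis_eq_zero (F := F.swap) hy hy0 h2
      exact ⟨⟨hy y hy0 h2, by simpa [hf0] using hr₀⟩, by simpa using hx₀⟩)
  -- The constant `4 > π` absorbs the argument of the logarithm in `Ξ`; the other term brings the
  -- exit height `d e^(-Re c / 2)` below the landing radius `s`.
  set M := max 4 (2 * Real.log (d / s)) with hM
  -- The first term gives `|z| < r`. The second gives `Re c > M + |φ|`, where the `1` bounds the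
  -- real part of the correcting logarithm.
  set C := max (-Real.log r) (M + 1 + Real.log k - Real.log d) with hC
  set ρ : ℝ → ℝ := fun φ => Real.exp (-(C + |φ|)) with hρ
  -- This is the lift of `log h` to the universal covering. The ratio `h / (k z)` is within `1/2` of
  -- `1`, so the principal logarithm is holomorphic there and no branch is crossed as the argument
  -- varies.
  set Ξ : ℂ × ℂ → ℂ := fun q => q.2 + Complex.log (h (q.1, Complex.exp q.2) * Complex.exp (-q.2) / k)
    + (Real.log k : ℂ) with hΞ
  set ε₀ := min r (min s δ) with hε₀
  have hkC : (k : ℂ) ≠ 0 := by exact_mod_cast hk.ne'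
  -- estimates on the domain
  have hexp : ∀ q ∈ contDomain ε₀ ρ, ‖Complex.exp q.2‖ < r := by
    intro q hq
    have h1 := Real.exp_lt_exp.1 hq.2
    rw [Complex.norm_exp, ← Real.exp_log hr, Real.exp_lt_exp]
    have h2 : -Real.log r ≤ C := le_max_left _ _
    have := abs_nonneg q.2.im
    linarith
  have hratio : ∀ q ∈ contDomain ε₀ ρ,
      ‖h (q.1, Complex.exp q.2) * Complex.exp (-q.2) / k - 1‖ ≤ 1 / 2 := by
    intro q hq
    have h1 := (hh (q.1, Complex.exp q.2) (hq.1.trans_le (min_le_left _ _)) (hexp q hq)).2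
    have hE := norm_pos_iff.2 (Complex.exp_ne_zero q.2)
    have e : h (q.1, Complex.exp q.2) * Complex.exp (-q.2) / k - 1
        = (h (q.1, Complex.exp q.2) - k * Complex.exp q.2) / (k * Complex.exp q.2) := by
      rw [Complex.exp_neg]
      have := Complex.exp_ne_zero q.2
      field_simp
    rw [e, norm_div, norm_mul, Complex.norm_real, Real.norm_eq_abs, abs_of_pos hk,
      div_le_iff₀ (by positivity)]
    simp only at h1
    linarith
  have hslit : ∀ q ∈ contDomain ε₀ ρ,
      h (q.1, Complex.exp q.2) * Complex.exp (-q.2) / k ∈ Complex.slitPlane := by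
    intro q hq
    left
    have h1 := (abs_le.1 ((Complex.abs_re_le_norm _).trans (hratio q hq))).1
    rw [Complex.sub_re, Complex.one_re] at h1
    linarith
  have hΞre : ∀ q ∈ contDomain ε₀ ρ, M + |q.2.im| < Real.log d - (Ξ q).re := by
    intro q hq
    have h1 := Real.exp_lt_exp.1 hq.2
    have h2 : M + 1 + Real.log k - Real.log d ≤ C := le_max_right _ _
    have h3 : (Complex.log (h (q.1, Complex.exp q.2) * Complex.exp (-q.2) / k)).re ≤ 1 := by
      rw [Complex.log_re]
      have h4 := norm_le_norm_add_norm_sub' (h (q.1, Complex.exp q.2) * Complex.exp (-q.2) / k) 1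
      have h5 := hratio q hq
      have h6 := Real.log_le_sub_one_of_pos
        (norm_pos_iff.2 (Complex.slitPlane_ne_zero (hslit q hq)))
      rw [norm_one] at h4
      linarith
    simp only [hΞ, Complex.add_re, Complex.ofReal_re]
    linarith
  have hΞim : ∀ q ∈ contDomain ε₀ ρ, |(Ξ q).im| < Real.log d - (Ξ q).re := by
    intro q hq
    have h1 : |(Ξ q).im| ≤ |q.2.im| + Real.pi := by
      simp only [hΞ, Complex.add_im, Complex.ofReal_im, add_zero, Complex.log_im]
      exact (abs_add_le _ _).trans (by gcongr; exact Complex.abs_arg_le_pi _)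
    have h2 := hΞre q hq
    have h3 : (4 : ℝ) ≤ M := le_max_left _ _
    linarith [Real.pi_lt_four]
  have hΞexp : ∀ q ∈ contDomain ε₀ ρ, Complex.exp (Ξ q) = h (q.1, Complex.exp q.2) := by
    intro q hq
    simp only [hΞ]
    rw [Complex.exp_add, Complex.exp_add, Complex.exp_log (Complex.slitPlane_ne_zero (hslit q hq)),
      ← Complex.ofReal_exp, Real.exp_log hk, Complex.exp_neg]
    have := Complex.exp_ne_zero q.2
    field_simp
  have hSmall : ∀ q ∈ contDomain ε₀ ρ, ‖F.saddleMap d (q.1, Ξ q)‖ < s := by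
    intro q hq
    obtain ⟨u, hu, hu0, -, hle, -⟩ := DeformedSaddle.exists_saddle_passage hδ hd hdδ
      (hq.1.trans_le ((min_le_right _ _).trans (min_le_right _ _))) (hΞim q hq)
    rw [DeformedSaddle.saddleMap_eq hu hu0]
    refine hle.trans_lt ?_
    have h1 := hΞre q hq
    have h2 : 2 * Real.log (d / s) ≤ M := le_max_right _ _
    have h3 : Real.exp (-(Real.log d - (Ξ q).re) / 2) < Real.exp (-Real.log (d / s)) := by
      rw [Real.exp_lt_exp]
      have := abs_nonneg q.2.im
      linarith
    rw [Real.exp_neg, Real.exp_log (by positivity), inv_div] at h3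
    calc d * Real.exp (-(Real.log d - (Ξ q).re) / 2) < d * (s / d) := by gcongr
      _ = s := by field_simp
  refine ⟨ε₀, lt_min hr (lt_min hs hδ0), ρ, by fun_prop, fun φ => Real.exp_pos _,
    fun q => Ψ (q.1, F.saddleMap d (q.1, Ξ q)), ?_, ?_⟩
  · intro q hq
    have hq1 : AnalyticAt ℂ (fun q : ℂ × ℂ => q.1) q := analyticAt_fst
    have hq2 : AnalyticAt ℂ (fun q : ℂ × ℂ => q.2) q := analyticAt_snd
    have hH : AnalyticAt ℂ (fun q : ℂ × ℂ => h (q.1, Complex.exp q.2)) q :=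
      AnalyticAt.comp (g := h) (f := fun q : ℂ × ℂ => (q.1, Complex.exp q.2))
        (hh (q.1, Complex.exp q.2) (hq.1.trans_le (min_le_left _ _)) (hexp q hq)).1 (hq1.prod hq2.cexp)
    have hΞa : AnalyticAt ℂ Ξ q :=
      (hq2.add (((hH.mul hq2.neg.cexp).div analyticAt_const hkC).clog (hslit q hq))).add
        analyticAt_const
    have hSa : AnalyticAt ℂ (fun q => F.saddleMap d (q.1, Ξ q)) q :=
      AnalyticAt.comp (g := F.saddleMap d) (f := fun q : ℂ × ℂ => (q.1, Ξ q))
        (DeformedSaddle.analyticAt_saddleMap hδ hd hdδ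
          (hq.1.trans_le ((min_le_right _ _).trans (min_le_right _ _))) (hΞim q hq)) (hq1.prod hΞa)
    exact AnalyticAt.comp (g := Ψ) (f := fun q : ℂ × ℂ => (q.1, F.saddleMap d (q.1, Ξ q)))
      (hΨ _ (hq.1.trans_le ((min_le_right _ _).trans (min_le_left _ _))) (hSmall q hq))
      (hq1.prod hSa)
  · intro ε z hε hz hzρ
    set q : ℂ × ℂ := ((ε : ℂ), ((Real.log z : ℝ) : ℂ)) with hq
    have hqd : q ∈ contDomain ε₀ ρ := by
      refine ⟨by simpa [hq] using hε, ?_⟩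
      simpa [hq, Real.exp_log hz] using hzρ
    have hez : Complex.exp q.2 = z := by
      rw [hq, ← Complex.ofReal_exp, Real.exp_log hz]
    have hzr : z < r := by
      have := hexp q hqd
      rwa [hez, Complex.norm_real, Real.norm_eq_abs, abs_of_pos hz] at this
    obtain ⟨hzR, x, hxpos, hhx, T₁, v₁, hT₁, hv₁, hv₁0, hv₁T⟩ :=
      hdep ε z (hε.trans_le (min_le_left _ _)) hz hzr
    have hξ : Ξ q = ((Real.log z + Real.log (x * z⁻¹ / k) + Real.log k : ℝ) : ℂ) := by
      have e : h (q.1, Complex.exp q.2) * Complex.exp (-q.2) / k = ((x * z⁻¹ / k : ℝ) : ℂ) := by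
        rw [Complex.exp_neg, hez, hq, hhx]; push_cast; rfl
      simp only [hΞ]
      rw [e, ← Complex.ofReal_log (by positivity)]
      push_cast
      rfl
    set ξ := Real.log z + Real.log (x * z⁻¹ / k) + Real.log k with hξdef
    have hξx : Real.exp ξ = x := by
      have h1 := hΞexp q hqd
      rw [hξ, hez, ← Complex.ofReal_exp] at h1
      exact Complex.ofReal_injective (h1.trans hhx)
    obtain ⟨y, hypos, hSy, T₂, v₂, hT₂, hv₂, hv₂0, hv₂T⟩ :=
      DeformedSaddle.exists_real_saddle_passage hδ hd hdδ (ε := ε) (ξ := ξ)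
        (hε.trans_le ((min_le_right _ _).trans (min_le_right _ _))) (by
          have h1 := hΞim q hqd
          rw [hξ, Complex.ofReal_re] at h1
          linarith [(abs_nonneg _).trans_lt h1])
    have hSq : F.saddleMap d (q.1, Ξ q) = y := by rw [hξ]; exact hSy
    have hys : y < s := by
      have := hSmall q hqd
      rwa [hSq, Complex.norm_real, Real.norm_eq_abs, abs_of_pos hypos] at this
    obtain ⟨w, hw, hwR, hΨw, T₃, v₃, hT₃, hv₃, hv₃0, hv₃T⟩ :=
      hland ε y (hε.trans_le ((min_le_right _ _).trans (min_le_left _ _))) hypos hys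
    refine ⟨w, ?_, by simpa only [hSq] using hΨw⟩
    set W : Set (ℂ × ℂ) := {p | p ∈ F.quadrant ∧
      ∀ v' : ℝ, 0 < v' → v' < τ.R → p = τ.param v' → v' = w} with hW
    have hv₁' : IsSol (F.X ε) W v₁ T₁ := hv₁.mono fun t ht => by
      obtain ⟨h1, ⟨-, h2⟩, h3⟩ := (hv₁ t ht).1
      exact ⟨h1, fun v' hv' hvR heq => absurd heq (hvac _ h2 h3 v' hv' hvR)⟩
    have hv₂' : IsSol (F.X ε) W v₂ T₂ := hv₂.mono fun t ht => by
      obtain ⟨h1, h2, h3⟩ := (hv₂ t ht).1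
      exact ⟨h1, fun v' hv' hvR heq => absurd heq (hvac _
        (hfb _ (by linarith) (by linarith)) (by linarith) v' hv' hvR)⟩
    have hv₁₂ := hv₁'.append hv₂' hT₁.le (by rw [hv₂0, hv₁T, hξx])
    have hv := hv₁₂.append hv₃ (by positivity) (by
      simp [hT₂, hv₂T, hv₃0])
    obtain ⟨-, ⟨-, hσf⟩, hσx⟩ := (hv₁ 0 ⟨le_rfl, hT₁.le⟩).1
    rw [hv₁0] at hσf hσx
    refine isDulacValue_of_isSol ?_ hz hzR hw hwR (by positivity) hv ?_ ?_
      (hvac _ hσf hσx w hw hwR)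
    -- The bound `|ε| < F.r` is read off from the inclusion of the saddle box in `dom`, at any point
    -- of the box with parameter `ε`.
    · have hmem : (((d : ℝ) : ℂ), (0 : ℂ), (ε : ℂ), (0 : ℂ)) ∈ DeformedSaddle.saddleBox δ := by
        refine ⟨⟨by simpa [abs_of_pos hd] using hdδ, by simpa using hδ0, ?_⟩, ?_⟩
        · rw [Complex.norm_real]
          exact hε.trans_le ((min_le_right _ _).trans (min_le_right _ _))
        · exact Complex.ofReal_ne_zero.2 hd.ne'
      have := (hδ.2.1 hmem).1.2.1
      rwa [Complex.norm_real] at this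
    · simp [hT₁.le, (by positivity : 0 ≤ T₁ + T₂), hv₁0]
    · simp [hT₃, hv₃T]

end Dulac

end

theorem theorem2 (F : Dulac.DeformedSaddle) (x₀ y₀ : ℝ) (hx₀ : 0 < x₀) (hy₀ : 0 < y₀)
    -- the separatrices join the origin to the cross-sections inside the domain,
    -- without meeting another critical point of `f`
    (hx : ∀ x : ℝ, 0 ≤ x → x ≤ x₀ → ((x : ℂ), (0 : ℂ)) ∈ F.U)
    (hy : ∀ y : ℝ, 0 ≤ y → y ≤ y₀ → ((0 : ℂ), (y : ℂ)) ∈ F.U)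
    (hx_reg : ∀ x : ℝ, 0 < x → x ≤ x₀ → fderiv ℂ F.f ((x : ℂ), (0 : ℂ)) ≠ 0)
    (hy_reg : ∀ y : ℝ, 0 < y → y ≤ y₀ → fderiv ℂ F.f ((0 : ℂ), (y : ℂ)) ≠ 0)
    (σ : Dulac.CrossSection F ((0 : ℂ), (y₀ : ℂ)))
    (τ : Dulac.CrossSection F ((x₀ : ℂ), (0 : ℂ))) :
    ∃ ε₀ : ℝ, 0 < ε₀ ∧ ∃ ρ : ℝ → ℝ, Continuous ρ ∧ (∀ φ, 0 < ρ φ) ∧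
      ∃ D : ℂ × ℂ → ℂ, AnalyticOnNhd ℂ D (Dulac.contDomain ε₀ ρ) ∧
        ∀ ε z : ℝ, |ε| < ε₀ → 0 < z → z < ρ 0 →
          ∃ w : ℝ, Dulac.IsDulacValue σ τ ε z w ∧ D ((ε : ℂ), (Real.log z : ℂ)) = (w : ℂ) :=
  Dulac.exists_dulac_continuation F x₀ y₀ hx₀ hy₀ hx hy hx_reg hy_reg σ τ
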